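/- **Theorem (hop-constrained oblivious network design).** For all constants $a, c \in \mathbb{N}$ there are a constant $C = C(a,c)$ and a randomized algorithm, running in time polynomial in the bit length of its input, such that the following holds. *Input.* The input is a complete graph $G$ on $n \ge 1$ vertices $V$ with integer edge weights $w(e) \in \{1, \dots, L\}$ where $L \le n^a$, together with an integer hop bound $h \ge 1$. The running time bound is worst case: it holds for every outcome of the algorithm's random bits. *Output.* With probability at least $1 - n^{-c}$ the algorithm outputs one (not necessarily simple) path $P_{uv}$ between $u$ and $v$ in $G$ for every $(u,v) \in V \times V$, such that 1. every $P_{uv}$ has at most $C \cdot h \cdot \log^3 n$ hops (edges, counted with repetition); and 2. for every monotone subadditive load function $f : \mathbb{R}_{\ge 0} \to \mathbb{R}_{\ge 0}$ (that is, $f(a+b) \le f(a) + f(b)$ and $f(a) \le f(a+b)$ for all $a,b \ge 0$) and every finite family of demand pairs $(s_1,t_1), \dots, (s_k,t_k) \in V \times V$ (repetitions allowed), $$\sum_{e \in E(G)} w(e)\, f(\ell_e) \;\le\; C \cdot \log^4 n \cdot \mathrm{OPT}, \qquad \ell_e := |\{ i : e \in P_{s_i t_i} \}| .$$ Here $\mathrm{OPT}$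 is the optimal cost of the non-oblivious $h$-hop-constrained problem for the same $f$ and the same demands: the minimum of $\sum_{e} w(e)\, f(|\{i : e \in Q_i\}|)$ over all families of paths $Q_1, \dots, Q_k$ in $G$ in which $Q_i$ joins $s_i$ to $t_i$ and has at most $h$ hops. The algorithm depends only on $a$ and $c$; it is not given $f$ or the demands. The computation model is a random access machine over the natural numbers with fair random bits and logarithmic cost (each operation is charged the bit lengths of the numbers involved). -/

import Mathlib

open scoped NNReal

namespace HopND

/-! ## Network design on a complete weighted graph -/

section Problem

variable {V : Type*} [Fintype V] [DecidableEq V]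

/-- A path between `u` and `v` in the complete graph on `V`. Paths need not be simple; the number of
hops of `P` is `P.length` and its edge set is the set of members of `P.edges`. -/
abbrev GPath (u v : V) : Type _ := (⊤ : SimpleGraph V).Walk u v

/-- The load of the edge `e`: the number of paths of the family that pass through `e`. -/
def load {k : ℕ} {s t : Fin k → V} (P : (i : Fin k) → GPath (s i) (t i)) (e : Sym2 V) : ℕ :=
  (Finset.univ.filter fun i : Fin k => e ∈ (P i).edges).card

/-- The cost `∑ₑ w(e) · f(ℓₑ)`, over all edges of the complete graph, of a family of paths. -/
noncomputable def netCost (w : Sym2 V → ℕ) (f : ℝ≥0 → ℝ≥0) {k : ℕ} {s t : Fin k → V}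
    (P : (i : Fin k) → GPath (s i) (t i)) : ℝ≥0 :=
  ∑ e ∈ (⊤ : SimpleGraph V).edgeFinset, (w e : ℝ≥0) * f (load P e : ℝ≥0)

/-- The optimum of (non-oblivious) `h`-hop-constrained network design for the demand pairs
`(s i, t i)`: the least cost of a family of paths, the `i`-th one between `s i` and `t i`, with at
most `h` hops each. For `1 ≤ h` there is such a family, as the graph is complete. -/
noncomputable def optCost (w : Sym2 V → ℕ) (f : ℝ≥0 → ℝ≥0) (h : ℕ) {k : ℕ} (s t : Fin k → V) :
    ℝ≥0 :=
  ⨅ P : {P : (i : Fin k) → GPath (s i) (t i) // ∀ i, (P i).length ≤ h}, netCost w f P.1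

/-- Monotone subadditive load functions. -/
def IsLoadFunction (f : ℝ≥0 → ℝ≥0) : Prop :=
  Monotone f ∧ ∀ a b : ℝ≥0, f (a + b) ≤ f a + f b

/-- A selection of one path for every ordered pair of vertices. -/
abbrev Selection (V : Type*) : Type _ := (u v : V) → GPath u v

/-- Every path of the selection has at most `hopBound` hops. -/
def Selection.HopsAtMost (P : Selection V) (hopBound : ℝ) : Prop :=
  ∀ u v : V, ((P u v).length : ℝ) ≤ hopBound

/-- For every load function and every finite family of demand pairs, the solution that the selection
induces costs at most `ratio` times the `h`-hop-constrained optimum for these demands. -/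
def Selection.IsCompetitive (P : Selection V) (w : Sym2 V → ℕ) (h : ℕ) (ratio : ℝ) : Prop :=
  ∀ f : ℝ≥0 → ℝ≥0, IsLoadFunction f → ∀ (k : ℕ) (s t : Fin k → V),
    (netCost w f (fun i => P (s i) (t i)) : ℝ) ≤ ratio * (optCost w f h s t : ℝ)

end Problem

/-- What the algorithm is given: a complete graph on the vertices `0, …, n - 1` with positive
integer edge weights, and a hop bound `h ≥ 1`. -/
structure Instance where
  n : ℕ
  n_pos : 1 ≤ n
  w : Sym2 (Fin n) → ℕ
  w_pos : ∀ e, ¬ e.IsDiag → 1 ≤ w e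
  h : ℕ
  h_pos : 1 ≤ h

/-! ## Randomized random access machines with logarithmic costs

Programs are structured (assignments, branching, loops). They work on natural numbers of arbitrary
size, held in finitely many variables and two-dimensional arrays that the program names. Every
operation is charged the bit lengths of the numbers involved. -/

/-- Arithmetic expressions. -/
inductive Expr where
  | const (k : ℕ)
  | var (x : ℕ)
  | get (a : ℕ) (i j : Expr)
  | add (e₁ e₂ : Expr)
  | sub (e₁ e₂ : Expr)
  | mul (e₁ e₂ : Expr)
  | div (e₁ e₂ : Expr)
  | lt (e₁ e₂ : Expr)
  | eq (e₁ e₂ : Expr)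

/-- Programs. `put a i j e` stores the value of `e` in the array `a` at position `(i, j)`, `flip x`
stores a fresh random bit in the variable `x`, and conditions hold if their value is not `0`. -/
inductive Cmd where
  | skip
  | assign (x : ℕ) (e : Expr)
  | put (a : ℕ) (i j e : Expr)
  | flip (x : ℕ)
  | seq (c₁ c₂ : Cmd)
  | cond (b : Expr) (c₁ c₂ : Cmd)
  | loop (b : Expr) (c : Cmd)

/-- The contents of the memory, and the number of random bits used so far. -/
structure State where
  vars : ℕ → ℕ
  arrs : ℕ → ℕ → ℕ → ℕ
  pos : ℕ

/-- The value of an expression. Subtraction is truncated, division is rounded down. -/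
def Expr.val (s : State) : Expr → ℕ
  | const k => k
  | var x => s.vars x
  | get a i j => s.arrs a (i.val s) (j.val s)
  | add e₁ e₂ => e₁.val s + e₂.val s
  | sub e₁ e₂ => e₁.val s - e₂.val s
  | mul e₁ e₂ => e₁.val s * e₂.val s
  | div e₁ e₂ => e₁.val s / e₂.val s
  | lt e₁ e₂ => if e₁.val s < e₂.val s then 1 else 0
  | eq e₁ e₂ => if e₁.val s = e₂.val s then 1 else 0

/-- The cost of evaluating an expression: one plus the bit length of the value, summed over all its
subexpressions. -/
def Expr.cost (s : State) : Expr → ℕ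
  | const k => 1 + Nat.size k
  | var x => 1 + Nat.size (s.vars x)
  | get a i j => i.cost s + j.cost s + (1 + Nat.size ((get a i j).val s))
  | add e₁ e₂ => e₁.cost s + e₂.cost s + (1 + Nat.size ((add e₁ e₂).val s))
  | sub e₁ e₂ => e₁.cost s + e₂.cost s + (1 + Nat.size ((sub e₁ e₂).val s))
  | mul e₁ e₂ => e₁.cost s + e₂.cost s + (1 + Nat.size ((mul e₁ e₂).val s))
  | div e₁ e₂ => e₁.cost s + e₂.cost s + (1 + Nat.size ((div e₁ e₂).val s))
  | lt e₁ e₂ => e₁.cost s + e₂.cost s + (1 + Nat.size ((lt e₁ e₂).val s))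
  | eq e₁ e₂ => e₁.cost s + e₂.cost s + (1 + Nat.size ((eq e₁ e₂).val s))

def State.setVar (s : State) (x v : ℕ) : State :=
  { s with vars := fun y => if y = x then v else s.vars y }

def State.setArr (s : State) (a i j v : ℕ) : State :=
  { s with arrs := fun b i' j' => if b = a ∧ i' = i ∧ j' = j then v else s.arrs b i' j' }

/-- Stores the next bit of the random tape `ω` in the variable `x`. -/
def State.flipVar (ω : ℕ → Bool) (s : State) (x : ℕ) : State :=
  { s.setVar x (ω s.pos).toNat with pos := s.pos + 1 }

/-- `Exec ω c s T s'`: started in the state `s` with the random tape `ω`, the program `c` halts in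
the state `s'` after exactly `T` units of time. There is no such `T` and `s'` if it runs forever. -/
inductive Exec (ω : ℕ → Bool) : Cmd → State → ℕ → State → Prop
  | skip (s : State) : Exec ω .skip s 1 s
  | assign (s : State) (x : ℕ) (e : Expr) :
      Exec ω (.assign x e) s (1 + e.cost s) (s.setVar x (e.val s))
  | put (s : State) (a : ℕ) (i j e : Expr) :
      Exec ω (.put a i j e) s (1 + i.cost s + j.cost s + e.cost s)
        (s.setArr a (i.val s) (j.val s) (e.val s))
  | flip (s : State) (x : ℕ) : Exec ω (.flip x) s 1 (s.flipVar ω x)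
  | seq {s s₁ s₂ : State} {T₁ T₂ : ℕ} {c₁ c₂ : Cmd} :
      Exec ω c₁ s T₁ s₁ → Exec ω c₂ s₁ T₂ s₂ → Exec ω (.seq c₁ c₂) s (T₁ + T₂) s₂
  | cond_true {s s₁ : State} {T : ℕ} {b : Expr} {c₁ c₂ : Cmd} :
      b.val s ≠ 0 → Exec ω c₁ s T s₁ → Exec ω (.cond b c₁ c₂) s (1 + b.cost s + T) s₁
  | cond_false {s s₁ : State} {T : ℕ} {b : Expr} {c₁ c₂ : Cmd} :
      b.val s = 0 → Exec ω c₂ s T s₁ → Exec ω (.cond b c₁ c₂) s (1 + b.cost s + T) s₁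
  | loop_true {s s₁ s₂ : State} {T₁ T₂ : ℕ} {b : Expr} {c : Cmd} :
      b.val s ≠ 0 → Exec ω c s T₁ s₁ → Exec ω (.loop b c) s₁ T₂ s₂ →
        Exec ω (.loop b c) s (1 + b.cost s + T₁ + T₂) s₂
  | loop_false {s : State} {b : Expr} {c : Cmd} :
      b.val s = 0 → Exec ω (.loop b c) s (1 + b.cost s) s

/-- The random tape that starts with the bits `r` and continues with zeros. -/
def tape {m : ℕ} (r : Fin m → Bool) : ℕ → Bool :=
  fun i => if hi : i < m then r ⟨i, hi⟩ else false

open Classical in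
/-- The probability of an event `E` about the random tape, for `m` independent fair random bits. A
program that halts within `m` units of time reads at most `m` bits, so that the rest of the tape is
irrelevant for its outcome. -/
noncomputable def coinProb (m : ℕ) (E : (ℕ → Bool) → Prop) : ℝ :=
  ((Finset.univ.filter fun r : Fin m → Bool => E (tape r)).card : ℝ) / 2 ^ m

/-! ## Input and output conventions -/

/-- The initial memory: `n` in variable `0`, `h` in variable `1`, and the weight of the edge between
`u` and `v` in array `0` at position `(u, v)`. Everything else is `0`. -/
def Instance.init (I : Instance) : State where
  vars := fun x => if x = 0 then I.n else if x = 1 then I.h else 0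
  arrs := fun a u v =>
    if hx : a = 0 ∧ u < I.n ∧ v < I.n ∧ u ≠ v then I.w s(⟨u, hx.2.1⟩, ⟨v, hx.2.2.1⟩) else 0
  pos := 0

/-- The length of the input in bits. -/
def Instance.size (I : Instance) : ℕ :=
  Nat.size I.n + Nat.size I.h + ∑ u : Fin I.n, ∑ v : Fin I.n, Nat.size (I.init.arrs 0 u v)

/-- The memory holds the selection `P`: for each pair `(u, v)`, array `1` contains at position
`(u, v)` the number of hops of `P u v`, and the row `u * n + v` of array `2` lists the vertices of
`P u v` in order. -/
def State.Holds (s : State) {n : ℕ} (P : Selection (Fin n)) : Prop :=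
  ∀ u v : Fin n, s.arrs 1 u v = (P u v).length ∧
    ∀ i ≤ (P u v).length, s.arrs 2 (u * n + v) i = ((P u v).getVert i : ℕ)

/-- On the instance `I` and for every random tape, the program halts within time `T`. -/
def HaltsWithin (prog : Cmd) (I : Instance) (T : ℕ) : Prop :=
  ∀ ω : ℕ → Bool, ∃ (T' : ℕ) (s : State), Exec ω prog I.init T' s ∧ T' ≤ T

/-- On the instance `I` and for the random tape `ω`, the program outputs the selection `P`. -/
def Outputs (prog : Cmd) (I : Instance) (ω : ℕ → Bool) (P : Selection (Fin I.n)) : Prop :=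
  ∃ (T : ℕ) (s : State), Exec ω prog I.init T s ∧ s.Holds P

end HopND

namespace HopND

/-! ## Total correctness with syntactic time bounds -/

/-! No randomness is needed: a deterministic algorithm succeeds on every tape.

Fix a scale `2 ^ j` and charge a hop along `e` the length `h * w e + 2 ^ j`. A walk with at most `h`
hops and weight at most `2 ^ j` has length at most `2 * h * 2 ^ j`. Conversely, a walk of length at
most `h * 2 ^ j * B` has at most `h * B` hops and weight at most `2 ^ j * B`. So one ordinary
shortest-path metric controls hops and weight together.

At every scale `1 ≤ j ≤ K`, each vertex gets one of `β = O(log n)` classes and a center at distance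
at most `8 * h * 2 ^ j * β`, such that vertices of the same class with different centers are more
than `8 * h * 2 ^ j` apart. This comes from ball carving. Within a class, a ball around a free
vertex is chosen whose next shell at most doubles it; the ball is assigned, the shell is set aside
for this class. Such a radius exists because `n < 2 ^ β` (`exists_radius`). The vertices set aside
are no more than those assigned (`CarveInv.step`), so each class at least halves what is unassigned
(`CarveInv.next_class`), and `β` classes suffice.

The scale of a pair `u`, `v` is the first `j ≥ 1` with distance at most `2 * h * 2 ^ j`. The path
climbs through the centers of `u` up to that level and descends through the centers of `v`. A block
at level `j` has length at most `h * 2 ^ j * (16 * β + 2)`, which bounds its hops and its weight;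
there are at most `2 * K` blocks (`Routing.length_path`).

For the cost, fix a level, a leg (ascent or descent) and a pair of classes. Below its scale a pair
is far apart, so any feasible path of a demand weighs at least `2 ^ (j - 1)` and has an initial part
of that weight near its endpoint. If the initial parts of two demands touch, the endpoints are so
close that the separation of classes forces the same centers, hence the same block
(`Routing.key_eq`). Therefore an edge has to pay for at most two blocks, and by subadditivity `m`
demands sharing a block cost the optimum a constant fraction of `2 ^ (j - 1) * f m` (`sum_keys_le`).
Summing over `K` levels, two legs and `β ^ 2` pairs of classes, with a loss of `O(β)` per block,
gives `O(K * β ^ 3) = O(log ^ 4 n)` (`Routing.netCost_path_le`). Unused edges cost `w e * f 0`, but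
the optimum pays this as well.

The program fills dynamic programming tables, carves, and writes the paths. It is verified with the
rules for `Reach`. The running time is read off the program text: if loops run at most `Y` times and
numbers have at most `Y` bits, the time is a fixed polynomial in `Y`, and `Y` is a polynomial in the
input length. -/

/-- All values in the memory have at most `Y` bits. -/
def State.Bdd (Y : ℕ) (s : State) : Prop :=
  (∀ x, s.vars x < 2 ^ Y) ∧ ∀ a i j, s.arrs a i j < 2 ^ Y

/-- A bound on the bit length of the value of an expression, if the memory holds numbers of at most
`Y` bits. -/
def Expr.sizeBound (Y : ℕ) : Expr → ℕ
  | const k => Nat.size k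
  | var _ => Y
  | get _ _ _ => Y
  | add e₁ e₂ => e₁.sizeBound Y + e₂.sizeBound Y + 1
  | sub e₁ _ => e₁.sizeBound Y
  | mul e₁ e₂ => e₁.sizeBound Y + e₂.sizeBound Y
  | div e₁ _ => e₁.sizeBound Y
  | lt _ _ => 1
  | eq _ _ => 1

/-- The corresponding bound on the cost of an expression. -/
def Expr.costBound (Y : ℕ) : Expr → ℕ
  | const k => 1 + Nat.size k
  | var _ => 1 + Y
  | get _ i j => i.costBound Y + j.costBound Y + (1 + Y)
  | add e₁ e₂ => e₁.costBound Y + e₂.costBound Y + (1 + (add e₁ e₂).sizeBound Y)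
  | sub e₁ e₂ => e₁.costBound Y + e₂.costBound Y + (1 + (sub e₁ e₂).sizeBound Y)
  | mul e₁ e₂ => e₁.costBound Y + e₂.costBound Y + (1 + (mul e₁ e₂).sizeBound Y)
  | div e₁ e₂ => e₁.costBound Y + e₂.costBound Y + (1 + (div e₁ e₂).sizeBound Y)
  | lt e₁ e₂ => e₁.costBound Y + e₂.costBound Y + (1 + (lt e₁ e₂).sizeBound Y)
  | eq e₁ e₂ => e₁.costBound Y + e₂.costBound Y + (1 + (eq e₁ e₂).sizeBound Y)

/-- A bound on the running time of a program whose loops run at most `Y` times each and whose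
memory holds numbers of at most `Y` bits. -/
def Cmd.timeBound (Y : ℕ) : Cmd → ℕ
  | skip => 1
  | assign _ e => 1 + e.costBound Y
  | put _ i j e => 1 + i.costBound Y + j.costBound Y + e.costBound Y
  | flip _ => 1
  | seq c₁ c₂ => c₁.timeBound Y + c₂.timeBound Y
  -- The sum of the branches instead of their maximum keeps the bound a polynomial in `Y`.
  | cond b c₁ c₂ => 1 + b.costBound Y + (c₁.timeBound Y + c₂.timeBound Y)
  -- The condition is tested once more than the body is run.
  | loop b c => (Y + 1) * (1 + b.costBound Y + c.timeBound Y)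

theorem Expr.size_val_le {Y : ℕ} {s : State} (hs : s.Bdd Y) (e : Expr) :
    Nat.size (e.val s) ≤ e.sizeBound Y := by
  induction e with
  | const k => exact le_rfl
  | var x => exact Nat.size_le.2 (hs.1 x)
  | get a i j => exact Nat.size_le.2 (hs.2 _ _ _)
  | add e₁ e₂ h₁ h₂ =>
    rw [Nat.size_le] at *
    simp only [val, sizeBound]
    have : 2 ^ (e₁.sizeBound Y) ≤ 2 ^ (e₁.sizeBound Y + e₂.sizeBound Y) :=
      Nat.pow_le_pow_right (by norm_num) (by omega)
    have : 2 ^ (e₂.sizeBound Y) ≤ 2 ^ (e₁.sizeBound Y + e₂.sizeBound Y) :=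
      Nat.pow_le_pow_right (by norm_num) (by omega)
    rw [pow_succ]; omega
  | sub e₁ e₂ h₁ h₂ => exact (Nat.size_le_size (Nat.sub_le _ _)).trans h₁
  | mul e₁ e₂ h₁ h₂ =>
    rw [Nat.size_le] at *
    simp only [val, sizeBound, pow_add]
    exact Nat.mul_lt_mul'' h₁ h₂
  | div e₁ e₂ h₁ h₂ => exact (Nat.size_le_size (Nat.div_le_self _ _)).trans h₁
  | lt e₁ e₂ h₁ h₂ =>
    simp only [val, sizeBound]; split_ifs <;> simp
  | eq e₁ e₂ h₁ h₂ =>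
    simp only [val, sizeBound]; split_ifs <;> simp

theorem Expr.cost_le {Y : ℕ} {s : State} (hs : s.Bdd Y) (e : Expr) :
    e.cost s ≤ e.costBound Y := by
  induction e with
  | const k => exact le_rfl
  | var x => exact Nat.add_le_add_left (Nat.size_le.2 (hs.1 x)) _
  | get a i j h₁ h₂ =>
    exact Nat.add_le_add (Nat.add_le_add h₁ h₂)
      (Nat.add_le_add_left (Nat.size_le.2 (hs.2 _ _ _)) _)
  | _ e₁ e₂ h₁ h₂ =>
    exact Nat.add_le_add (Nat.add_le_add h₁ h₂)
      (Nat.add_le_add_left (Expr.size_val_le hs _) _)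

/-! ### Polynomial bounds on running times -/

/-- The function is given by a polynomial. -/
def IsPoly (g : ℕ → ℕ) : Prop := ∃ p : Polynomial ℕ, ∀ Y, g Y = p.eval Y

theorem IsPoly.const (k : ℕ) : IsPoly fun _ => k := ⟨Polynomial.C k, by simp⟩

theorem IsPoly.id : IsPoly fun Y => Y := ⟨Polynomial.X, by simp⟩

theorem IsPoly.add {f g : ℕ → ℕ} (hf : IsPoly f) (hg : IsPoly g) : IsPoly fun Y => f Y + g Y := by
  obtain ⟨p, hp⟩ := hf
  obtain ⟨q, hq⟩ := hg
  exact ⟨p + q, fun Y => by simp [hp, hq]⟩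

theorem IsPoly.mul {f g : ℕ → ℕ} (hf : IsPoly f) (hg : IsPoly g) : IsPoly fun Y => f Y * g Y := by
  obtain ⟨p, hp⟩ := hf
  obtain ⟨q, hq⟩ := hg
  exact ⟨p * q, fun Y => by simp [hp, hq]⟩

theorem IsPoly.comp {f g : ℕ → ℕ} (hf : IsPoly f) (hg : IsPoly g) : IsPoly fun Y => f (g Y) := by
  obtain ⟨p, hp⟩ := hf
  obtain ⟨q, hq⟩ := hg
  exact ⟨p.comp q, fun Y => by simp [hp, hq]⟩

theorem Expr.isPoly_sizeBound (e : Expr) : IsPoly fun Y => e.sizeBound Y := by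
  induction e with
  | const k => exact .const _
  | var x => exact .id
  | get a i j => exact .id
  | add e₁ e₂ h₁ h₂ => exact (h₁.add h₂).add (.const 1)
  | sub e₁ e₂ h₁ h₂ => exact h₁
  | mul e₁ e₂ h₁ h₂ => exact h₁.add h₂
  | div e₁ e₂ h₁ h₂ => exact h₁
  | lt e₁ e₂ h₁ h₂ => exact .const 1
  | eq e₁ e₂ h₁ h₂ => exact .const 1

theorem Expr.isPoly_costBound (e : Expr) : IsPoly fun Y => e.costBound Y := by
  induction e with
  | const k => exact .const _
  | var x => exact (IsPoly.const 1).add .id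
  | get a i j h₁ h₂ => exact (h₁.add h₂).add ((IsPoly.const 1).add .id)
  | _ e₁ e₂ h₁ h₂ =>
    exact (h₁.add h₂).add ((IsPoly.const 1).add (Expr.isPoly_sizeBound _))

theorem Cmd.isPoly_timeBound (c : Cmd) : IsPoly fun Y => c.timeBound Y := by
  induction c with
  | skip => exact .const 1
  | assign x e => exact (IsPoly.const 1).add e.isPoly_costBound
  | put a i j e =>
    exact (((IsPoly.const 1).add i.isPoly_costBound).add j.isPoly_costBound).add
      e.isPoly_costBound
  | flip x => exact .const 1
  | seq c₁ c₂ h₁ h₂ => exact h₁.add h₂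
  | cond b c₁ c₂ h₁ h₂ => exact ((IsPoly.const 1).add b.isPoly_costBound).add (h₁.add h₂)
  | loop b c h =>
    exact (IsPoly.id.add (.const 1)).mul (((IsPoly.const 1).add b.isPoly_costBound).add h)

/-! ### Frames: what a program leaves alone -/

/-- The variables that a program may change. -/
def Cmd.modVars : Cmd → List ℕ
  | skip => []
  | assign x _ => [x]
  | put _ _ _ _ => []
  | flip x => [x]
  | seq c₁ c₂ => c₁.modVars ++ c₂.modVars
  | cond _ c₁ c₂ => c₁.modVars ++ c₂.modVars
  | loop _ c => c.modVars

/-- The arrays that a program may change. -/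
def Cmd.modArrs : Cmd → List ℕ
  | skip => []
  | assign _ _ => []
  | put a _ _ _ => [a]
  | flip _ => []
  | seq c₁ c₂ => c₁.modArrs ++ c₂.modArrs
  | cond _ c₁ c₂ => c₁.modArrs ++ c₂.modArrs
  | loop _ c => c.modArrs

/-- The two states agree on everything that the program cannot change. -/
structure Frame (c : Cmd) (s s' : State) : Prop where
  vars : ∀ x, x ∉ c.modVars → s'.vars x = s.vars x
  arrs : ∀ a, a ∉ c.modArrs → s'.arrs a = s.arrs a

theorem Frame.refl (c : Cmd) (s : State) : Frame c s s := ⟨fun _ _ => rfl, fun _ _ => rfl⟩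

theorem Frame.trans {c : Cmd} {s₁ s₂ s₃ : State} (h : Frame c s₁ s₂) (h' : Frame c s₂ s₃) :
    Frame c s₁ s₃ :=
  ⟨fun x hx => (h'.vars x hx).trans (h.vars x hx), fun a ha => (h'.arrs a ha).trans (h.arrs a ha)⟩

theorem Frame.mono {c c' : Cmd} {s s' : State} (h : Frame c s s')
    (hv : ∀ x ∈ c.modVars, x ∈ c'.modVars) (ha : ∀ x ∈ c.modArrs, x ∈ c'.modArrs) :
    Frame c' s s' :=
  ⟨fun x hx => h.vars x fun h => hx (hv x h), fun a hx => h.arrs a fun h => hx (ha a h)⟩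

@[simp] theorem State.vars_setVar (s : State) (x v y : ℕ) :
    (s.setVar x v).vars y = if y = x then v else s.vars y := rfl

@[simp] theorem State.arrs_setVar (s : State) (x v : ℕ) : (s.setVar x v).arrs = s.arrs := rfl

@[simp] theorem State.vars_setArr (s : State) (a i j v : ℕ) : (s.setArr a i j v).vars = s.vars :=
  rfl

theorem State.arrs_setArr (s : State) (a i j v b i' j' : ℕ) :
    (s.setArr a i j v).arrs b i' j' = if b = a ∧ i' = i ∧ j' = j then v else s.arrs b i' j' := rfl

theorem State.arrs_setArr_of_ne {s : State} {a i j v b : ℕ} (h : b ≠ a) :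
    (s.setArr a i j v).arrs b = s.arrs b := by
  funext i' j'
  simp [State.arrs_setArr, h]

theorem State.arrs_setArr_self (s : State) (a i j v i' j' : ℕ) :
    (s.setArr a i j v).arrs a i' j' = if i' = i ∧ j' = j then v else s.arrs a i' j' := by
  simp [State.arrs_setArr]

theorem Frame.setVar (c : Cmd) (s : State) {x : ℕ} (v : ℕ) (hx : x ∈ c.modVars) :
    Frame c s (s.setVar x v) :=
  ⟨fun y hy => by
    have : y ≠ x := fun h => hy (h ▸ hx)
    simp [this], fun _ _ => rfl⟩

/-- For a concrete program the lists of modified names are computable, so afterwards `decide`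
settles that a given variable or array has kept its value. Invariants then only need to mention what
really changes. -/
theorem Exec.frame {ω : ℕ → Bool} {c : Cmd} {s s' : State} {T : ℕ} (h : Exec ω c s T s') :
    Frame c s s' := by
  induction h with
  | skip s => exact .refl _ _
  | assign s x e => exact .setVar _ _ _ (by simp [Cmd.modVars])
  | put s a i j e =>
    refine ⟨fun _ _ => rfl, fun b hb => State.arrs_setArr_of_ne ?_⟩
    simpa [Cmd.modArrs] using hb
  | flip s x =>
    refine ⟨fun y hy => ?_, fun _ _ => rfl⟩
    have : y ≠ x := by simpa [Cmd.modVars] using hy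
    simp [State.flipVar, this]
  | seq _ _ h₁ h₂ =>
    refine (h₁.mono ?_ ?_).trans (h₂.mono ?_ ?_) <;> simp +contextual [Cmd.modVars, Cmd.modArrs]
  | cond_true _ _ h => refine h.mono ?_ ?_ <;> simp +contextual [Cmd.modVars, Cmd.modArrs]
  | cond_false _ _ h => refine h.mono ?_ ?_ <;> simp +contextual [Cmd.modVars, Cmd.modArrs]
  | loop_true _ _ _ h₁ h₂ =>
    exact (h₁.mono (c' := .loop _ _) (fun _ h => h) (fun _ h => h)).trans h₂
  | loop_false _ => exact .refl _ _

theorem State.Bdd.setVar {Y : ℕ} {s : State} (hs : s.Bdd Y) (x : ℕ) {v : ℕ} (hv : v < 2 ^ Y) :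
    (s.setVar x v).Bdd Y :=
  ⟨fun y => by rw [State.vars_setVar]; split_ifs; exacts [hv, hs.1 y], hs.2⟩

theorem State.Bdd.setArr {Y : ℕ} {s : State} (hs : s.Bdd Y) (a i j : ℕ) {v : ℕ} (hv : v < 2 ^ Y) :
    (s.setArr a i j v).Bdd Y :=
  ⟨hs.1, fun b i' j' => by rw [State.arrs_setArr]; split_ifs; exacts [hv, hs.2 _ _ _]⟩

/-! ### Rules for total correctness -/

/-- Started in `s`, the program `c` halts within its time bound in a state with property `Q`,
without using random bits. -/
def Reach (Y : ℕ) (c : Cmd) (s : State) (Q : State → Prop) : Prop :=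
  s.Bdd Y → ∃ (T : ℕ) (s' : State), (∀ ω, Exec ω c s T s') ∧ T ≤ c.timeBound Y ∧ s'.Bdd Y ∧ Q s'

/-- Besides weakening the postcondition, this hands the frame of the execution to the continuation.
That is how facts about the earlier state survive a subprogram whose specification does not mention
them. -/
theorem Reach.mono {Y : ℕ} {c : Cmd} {s : State} {Q Q' : State → Prop} (h : Reach Y c s Q)
    (hQ : ∀ s', s'.Bdd Y → Frame c s s' → Q s' → Q' s') : Reach Y c s Q' := by
  intro hs
  obtain ⟨T, s', h₁, h₂, h₃, h₄⟩ := h hs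
  exact ⟨T, s', h₁, h₂, h₃, hQ s' h₃ (h₁ fun _ => false).frame h₄⟩

theorem reach_skip {Y : ℕ} {s : State} {Q : State → Prop} (h : Q s) : Reach Y .skip s Q :=
  fun hs => ⟨1, s, fun _ => .skip s, le_rfl, hs, h⟩

theorem reach_assign {Y : ℕ} {s : State} {x : ℕ} {e : Expr} {Q : State → Prop}
    (hv : e.val s < 2 ^ Y) (h : Q (s.setVar x (e.val s))) : Reach Y (.assign x e) s Q :=
  fun hs => ⟨_, _, fun _ => .assign s x e, Nat.add_le_add_left (e.cost_le hs) _,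
    hs.setVar x hv, h⟩

theorem reach_put {Y : ℕ} {s : State} {a : ℕ} {i j e : Expr} {Q : State → Prop}
    (hv : e.val s < 2 ^ Y) (h : Q (s.setArr a (i.val s) (j.val s) (e.val s))) :
    Reach Y (.put a i j e) s Q :=
  fun hs => ⟨_, _, fun _ => .put s a i j e,
    Nat.add_le_add (Nat.add_le_add (Nat.add_le_add_left (i.cost_le hs) _) (j.cost_le hs))
      (e.cost_le hs), hs.setArr _ _ _ hv, h⟩

theorem reach_seq {Y : ℕ} {s : State} {c₁ c₂ : Cmd} {Q : State → Prop}
    (h : Reach Y c₁ s fun s₁ => Reach Y c₂ s₁ Q) : Reach Y (.seq c₁ c₂) s Q := by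
  intro hs
  obtain ⟨T₁, s₁, h₁, h₂, h₃, h₄⟩ := h hs
  obtain ⟨T₂, s₂, h₁', h₂', h₃', h₄'⟩ := h₄ h₃
  exact ⟨_, s₂, fun ω => .seq (h₁ ω) (h₁' ω), Nat.add_le_add h₂ h₂', h₃', h₄'⟩

theorem reach_cond {Y : ℕ} {s : State} {b : Expr} {c₁ c₂ : Cmd} {Q : State → Prop}
    (ht : b.val s ≠ 0 → Reach Y c₁ s Q) (hf : b.val s = 0 → Reach Y c₂ s Q) :
    Reach Y (.cond b c₁ c₂) s Q := by
  intro hs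
  have hb := b.cost_le hs
  by_cases h : b.val s = 0
  · obtain ⟨T₁, s₁, h₁, h₂, h₃, h₄⟩ := hf h hs
    exact ⟨_, s₁, fun ω => .cond_false h (h₁ ω), by simp only [Cmd.timeBound]; omega, h₃, h₄⟩
  · obtain ⟨T₁, s₁, h₁, h₂, h₃, h₄⟩ := ht h hs
    exact ⟨_, s₁, fun ω => .cond_true h (h₁ ω), by simp only [Cmd.timeBound]; omega, h₃, h₄⟩

/-- The body is executed for the values `0, 1, …, N - 1` of the variable `i`. -/
def Cmd.for (i : ℕ) (N : Expr) (body : Cmd) : Cmd :=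
  .seq (.assign i (.const 0))
    (.loop (.lt (.var i) N) (.seq body (.assign i (.add (.var i) (.const 1)))))

/-- Induction on the number of remaining iterations, each paid for by one unit of the time bound,
with one more unit for the final failing test. The body must not touch the counter and the bound
must be constant on the frame, so the number of iterations is exactly `k`. The invariant is required
after the counter has been advanced. -/
theorem reach_for {Y : ℕ} {s : State} {i : ℕ} {N : Expr} {body : Cmd} {Q : State → Prop}
    (k : ℕ) (I : ℕ → State → Prop) (hkY : k ≤ Y) (hi : i ∉ body.modVars)
    (hN : ∀ s', Frame (.for i N body) s s' → N.val s' = k)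
    (h0 : I 0 (s.setVar i 0))
    (hstep : ∀ m < k, ∀ s', Frame (.for i N body) s s' → s'.Bdd Y → s'.vars i = m → I m s' →
      Reach Y body s' fun s'' => I (m + 1) (s''.setVar i (m + 1)))
    (hQ : ∀ s', Frame (.for i N body) s s' → I k s' → Q s') :
    Reach Y (.for i N body) s Q := by
  have hiM : i ∈ (Cmd.for i N body).modVars := by simp [Cmd.for, Cmd.modVars]
  refine reach_seq (reach_assign (by simp [Expr.val]) ?_)
  simp only [Expr.val]
  set loopC : Cmd := .loop (.lt (.var i) N) (.seq body (.assign i (.add (.var i) (.const 1))))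
    with hloopC
  have hkey : ∀ d m s', m + d = k → Frame (.for i N body) s s' → s'.vars i = m → I m s' →
      s'.Bdd Y → ∃ (T : ℕ) (s'' : State), (∀ ω, Exec ω loopC s' T s'') ∧
        T ≤ (d + 1) * (1 + (Expr.lt (.var i) N).costBound Y +
          (Cmd.seq body (.assign i (.add (.var i) (.const 1)))).timeBound Y) ∧
        s''.Bdd Y ∧ Q s'' := by
    intro d
    induction d with
    | zero =>
      intro m s' hm hF hv hI hs
      have hm' : m = k := by omega
      subst hm'
      have hval : (Expr.lt (.var i) N).val s' = 0 := by simp [Expr.val, hv, hN s' hF]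
      refine ⟨_, s', fun ω => .loop_false hval, ?_, hs, hQ s' hF hI⟩
      have := (Expr.lt (.var i) N).cost_le hs
      rw [zero_add, one_mul]; omega
    | succ d ih =>
      intro m s' hm hF hv hI hs
      have hmk : m < k := by omega
      have hval : (Expr.lt (.var i) N).val s' ≠ 0 := by simp [Expr.val, hv, hN s' hF, hmk]
      have hbody : Reach Y (.seq body (.assign i (.add (.var i) (.const 1)))) s' fun s₁ =>
          Frame (.for i N body) s s₁ ∧ s₁.vars i = m + 1 ∧ I (m + 1) s₁ := by
        refine reach_seq ((hstep m hmk s' hF hs hv hI).mono fun s'' _ hF' hI' => ?_)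
        have hi' : s''.vars i = m := (hF'.vars i hi).trans hv
        have hlt : m + 1 < 2 ^ Y :=
          lt_of_le_of_lt (by omega : m + 1 ≤ Y) Nat.lt_two_pow_self
        refine reach_assign (by simpa [Expr.val, hi'] using hlt) ?_
        simp only [Expr.val, hi']
        refine ⟨(hF.trans (hF'.mono ?_ ?_)).trans (.setVar _ _ _ hiM), by simp, hI'⟩ <;>
          simp +contextual [Cmd.for, Cmd.modVars, Cmd.modArrs]
      obtain ⟨T₁, s₁, h₁, h₂, h₃, h₄, h₅, h₆⟩ := hbody hs
      obtain ⟨T₂, s₂, g₁, g₂, g₃, g₄⟩ := ih (m + 1) s₁ (by omega) h₄ h₅ h₆ h₃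
      refine ⟨_, s₂, fun ω => .loop_true hval (h₁ ω) (g₁ ω), ?_, g₃, g₄⟩
      have := (Expr.lt (.var i) N).cost_le hs
      rw [add_mul, one_mul]; omega
  intro hs
  obtain ⟨T, s'', h₁, h₂, h₃, h₄⟩ := hkey k 0 (s.setVar i 0) (by omega) (.setVar _ _ _ hiM)
    (by simp) h0 hs
  exact ⟨T, s'', h₁, h₂.trans (Nat.mul_le_mul_right _ (by omega)), h₃, h₄⟩

end HopND

namespace HopND

/-! ## Walks and hop-weighted distances -/

section Walks

variable {V : Type*}

/-- The total weight of a walk. -/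
def walkWeight (w : Sym2 V → ℕ) {x y : V} (q : GPath x y) : ℕ := (q.edges.map w).sum

@[simp] theorem walkWeight_nil (w : Sym2 V → ℕ) (x : V) :
    walkWeight w (SimpleGraph.Walk.nil : GPath x x) = 0 := rfl

@[simp] theorem walkWeight_cons (w : Sym2 V → ℕ) {x y z : V} (h : (⊤ : SimpleGraph V).Adj x y)
    (q : GPath y z) : walkWeight w (.cons h q : GPath x z) = w s(x, y) + walkWeight w q := by
  simp [walkWeight]

@[simp] theorem walkWeight_append (w : Sym2 V → ℕ) {x y z : V} (p : GPath x y) (q : GPath y z) :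
    walkWeight w (p.append q) = walkWeight w p + walkWeight w q := by
  simp [walkWeight]

@[simp] theorem walkWeight_reverse (w : Sym2 V → ℕ) {x y : V} (p : GPath x y) :
    walkWeight w p.reverse = walkWeight w p := by
  simp [walkWeight]

@[simp] theorem walkWeight_copy (w : Sym2 V → ℕ) {x y x' y' : V} (p : GPath x y) (hx : x = x')
    (hy : y = y') : walkWeight w (p.copy hx hy) = walkWeight w p := by
  simp [walkWeight]

@[simp] theorem walkWeight_concat (w : Sym2 V → ℕ) {x y z : V} (p : GPath x y)
    (h : (⊤ : SimpleGraph V).Adj y z) : walkWeight w (p.concat h) = walkWeight w p + w s(y, z) := by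
  simp [walkWeight, SimpleGraph.Walk.edges_concat]

/-- The edges of the bypass are distinct and occur in the walk, so they form a sublist up to order.
-/
theorem walkWeight_bypass_le [DecidableEq V] (w : Sym2 V → ℕ) {x y : V} (p : GPath x y) :
    walkWeight w p.bypass ≤ walkWeight w p := by
  obtain ⟨l, hl, hs⟩ := List.subperm_of_subset p.bypass_isPath.isTrail.edges_nodup
    p.edges_bypass_subset_edges
  unfold walkWeight
  rw [← (hl.map w).sum_eq]
  exact (hs.map w).sum_le_sum fun _ _ => Nat.zero_le _

/-- The weight of a walk if every hop is charged `h` times its weight plus `Δ`. -/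
def hopLength (w : Sym2 V → ℕ) (h Δ : ℕ) {x y : V} (q : GPath x y) : ℕ :=
  h * walkWeight w q + Δ * q.length

theorem hopLength_copy (w : Sym2 V → ℕ) (h Δ : ℕ) {x y x' y' : V} (p : GPath x y) (hx : x = x')
    (hy : y = y') : hopLength w h Δ (p.copy hx hy) = hopLength w h Δ p := by
  simp [hopLength]

/-- The corresponding weight of a single hop, or of staying. -/
def hopWeight [DecidableEq V] (w : Sym2 V → ℕ) (h Δ : ℕ) (x y : V) : ℕ :=
  if x = y then 0 else h * w s(x, y) + Δ

/-- `D` is the shortest path metric for the hop-weighted lengths. -/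
def IsHopDist (w : Sym2 V → ℕ) (h Δ : ℕ) (D : V → V → ℕ) : Prop :=
  (∀ (x y : V) (q : GPath x y), D x y ≤ hopLength w h Δ q) ∧
    ∀ x y : V, ∃ q : GPath x y, hopLength w h Δ q = D x y

namespace IsHopDist

variable {w : Sym2 V → ℕ} {h Δ : ℕ} {D : V → V → ℕ}

theorem self (hD : IsHopDist w h Δ D) (x : V) : D x x = 0 :=
  Nat.le_zero.1 (by simpa [hopLength] using hD.1 x x .nil)

theorem comm_le (hD : IsHopDist w h Δ D) (x y : V) : D x y ≤ D y x := by
  obtain ⟨q, hq⟩ := hD.2 y x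
  rw [← hq]
  simpa [hopLength] using hD.1 x y q.reverse

theorem comm (hD : IsHopDist w h Δ D) (x y : V) : D x y = D y x :=
  (hD.comm_le x y).antisymm (hD.comm_le y x)

theorem triangle (hD : IsHopDist w h Δ D) (x y z : V) : D x z ≤ D x y + D y z := by
  obtain ⟨p, hp⟩ := hD.2 x y
  obtain ⟨q, hq⟩ := hD.2 y z
  have := hD.1 x z (p.append q)
  simp only [hopLength, walkWeight_append, SimpleGraph.Walk.length_append] at *
  rw [← hp, ← hq]
  calc _ ≤ _ := this
    _ = _ := by ring

/-- Doubling the charge per hop at most doubles every length. This relates the metrics of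
consecutive scales. -/
theorem le_double {D' : V → V → ℕ} (hD : IsHopDist w h Δ D) (hD' : IsHopDist w h (2 * Δ) D')
    (x y : V) : D' x y ≤ 2 * D x y := by
  obtain ⟨p, hp⟩ := hD.2 x y
  have := hD'.1 x y p
  simp only [hopLength] at *
  rw [← hp]
  calc _ ≤ _ := this
    _ ≤ h * walkWeight w p + 2 * Δ * p.length + h * walkWeight w p := Nat.le_add_right _ _
    _ = _ := by ring

end IsHopDist

/-! ### Walks given by vertex sequences -/

/-- The walk through the vertices `p 0, …, p N`, where stays are left out. -/
def walkOf [DecidableEq V] (p : ℕ → V) : (N : ℕ) → GPath (p 0) (p N)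
  | 0 => .nil
  | N + 1 => if h : p N = p (N + 1) then (walkOf p N).copy rfl h else (walkOf p N).concat h

variable [DecidableEq V]

theorem walkOf_succ_of_eq (p : ℕ → V) {N : ℕ} (h : p N = p (N + 1)) :
    walkOf p (N + 1) = (walkOf p N).copy rfl h := by
  rw [walkOf, dif_pos h]

theorem walkOf_succ_of_ne (p : ℕ → V) {N : ℕ} (h : p N ≠ p (N + 1)) :
    walkOf p (N + 1) = (walkOf p N).concat h := by
  rw [walkOf, dif_neg h]

theorem length_walkOf_succ (p : ℕ → V) (N : ℕ) :
    (walkOf p (N + 1)).length = (walkOf p N).length + if p N = p (N + 1) then 0 else 1 := by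
  by_cases h : p N = p (N + 1)
  · simp [walkOf_succ_of_eq p h, if_pos h]
  · simp [walkOf_succ_of_ne p h, if_neg h]

theorem getVert_walkOf_succ_of_le (p : ℕ → V) {N i : ℕ} (hi : i ≤ (walkOf p N).length) :
    (walkOf p (N + 1)).getVert i = (walkOf p N).getVert i := by
  by_cases h : p N = p (N + 1)
  · simp [walkOf_succ_of_eq p h]
  · rw [walkOf_succ_of_ne p h, SimpleGraph.Walk.concat_eq_append, SimpleGraph.Walk.getVert_append]
    split_ifs with h'
    · rfl
    · have : i = (walkOf p N).length := by omega
      subst this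
      simp

theorem getVert_length_walkOf (p : ℕ → V) (N : ℕ) :
    (walkOf p N).getVert (walkOf p N).length = p N := by
  simp

theorem mem_edges_walkOf (p : ℕ → V) {N : ℕ} {e : Sym2 V} (he : e ∈ (walkOf p N).edges) :
    ∃ i < N, p i ≠ p (i + 1) ∧ e = s(p i, p (i + 1)) := by
  induction N with
  | zero => simp [walkOf] at he
  | succ N ih =>
    by_cases h : p N = p (N + 1)
    · rw [walkOf_succ_of_eq p h, SimpleGraph.Walk.edges_copy] at he
      obtain ⟨i, hi, h'⟩ := ih he
      exact ⟨i, by omega, h'⟩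
    · rw [walkOf_succ_of_ne p h, SimpleGraph.Walk.edges_concat] at he
      simp only [List.concat_eq_append, List.mem_append, List.mem_singleton] at he
      rcases he with he | he
      · obtain ⟨i, hi, h'⟩ := ih he
        exact ⟨i, by omega, h'⟩
      · exact ⟨N, by omega, h, he⟩

theorem mk_mem_edges_walkOf (p : ℕ → V) {N i : ℕ} (hi : i < N) (h : p i ≠ p (i + 1)) :
    s(p i, p (i + 1)) ∈ (walkOf p N).edges := by
  induction N with
  | zero => omega
  | succ N ih =>
    by_cases hN : p N = p (N + 1)
    · rw [walkOf_succ_of_eq p hN, SimpleGraph.Walk.edges_copy]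
      exact ih (lt_of_le_of_ne (by omega) fun h' => h (h' ▸ hN))
    · rw [walkOf_succ_of_ne p hN, SimpleGraph.Walk.edges_concat, List.concat_eq_append,
        List.mem_append, List.mem_singleton]
      rcases Nat.lt_succ_iff_lt_or_eq.1 hi with hi | rfl
      exacts [Or.inl (ih hi), Or.inr rfl]

theorem length_walkOf_add (p : ℕ → V) (M N : ℕ) :
    (walkOf p (M + N)).length =
      (walkOf p M).length + (walkOf (fun i => p (M + i)) N).length := by
  induction N with
  | zero => simp [walkOf]
  | succ N ih =>
    change (walkOf p (M + N + 1)).length = _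
    rw [length_walkOf_succ, ih, length_walkOf_succ]; simp [add_assoc]

theorem length_walkOf_congr {p p' : ℕ → V} {N : ℕ} (h : ∀ i ≤ N, p i = p' i) :
    (walkOf p N).length = (walkOf p' N).length := by
  induction N with
  | zero => simp [walkOf]
  | succ N ih =>
    rw [length_walkOf_succ, length_walkOf_succ, ih fun i hi => h i (by omega),
      h N (by omega), h (N + 1) le_rfl]

theorem hopLength_walkOf (w : Sym2 V → ℕ) (h Δ : ℕ) (p : ℕ → V) (N : ℕ) :
    hopLength w h Δ (walkOf p N) = ∑ i ∈ Finset.range N, hopWeight w h Δ (p i) (p (i + 1)) := by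
  induction N with
  | zero => simp [walkOf, hopLength]
  | succ N ih =>
    rw [Finset.sum_range_succ, ← ih]
    by_cases h' : p N = p (N + 1)
    · simp [walkOf_succ_of_eq p h', hopLength, hopWeight, if_pos h']
    · simp only [walkOf_succ_of_ne p h', hopLength, hopWeight, if_neg h', walkWeight_concat,
        SimpleGraph.Walk.length_concat]
      ring

/-! ### Shortest paths by dynamic programming -/

/-- The dynamic program for hop-weighted distances: `DD m x y` is the least length of a walk from
`x` to `y` with at most `m + 1` hops, and `nx m x y` the second vertex of such a walk. -/
structure IsDP (W : V → V → ℕ) (N : ℕ) (DD : ℕ → V → V → ℕ) (nx : ℕ → V → V → V) : Prop where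
  zero : ∀ x y, DD 0 x y = W x y
  nx_zero : ∀ x y, nx 0 x y = y
  succ : ∀ m, m + 1 < N → ∀ x y, DD (m + 1) x y = W x (nx (m + 1) x y) + DD m (nx (m + 1) x y) y
  succ_le : ∀ m, m + 1 < N → ∀ x y z, DD (m + 1) x y ≤ W x z + DD m z y

/-- The vertices visited on the way from `x` to `y`, in `N` steps. -/
def trace (nx : ℕ → V → V → V) (N : ℕ) (x y : V) : ℕ → V
  | 0 => x
  | i + 1 => nx (N - 1 - i) (trace nx N x y i) y

variable {w : Sym2 V → ℕ} {h Δ N : ℕ} {DD : ℕ → V → V → ℕ} {nx : ℕ → V → V → V}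

theorem IsDP.self (hDP : IsDP (hopWeight w h Δ) N DD nx) {m : ℕ} (hm : m < N) (x : V) :
    DD m x x = 0 := by
  induction m with
  | zero => simp [hDP.zero, hopWeight]
  | succ m ih =>
    have := hDP.succ_le m hm x x x
    rw [ih (by omega)] at this
    simpa [hopWeight] using this

theorem IsDP.le_hopLength (hDP : IsDP (hopWeight w h Δ) N DD nx) {m : ℕ} (hm : m < N) {x y : V}
    (q : GPath x y) (hq : q.length ≤ m + 1) : DD m x y ≤ hopLength w h Δ q := by
  induction m generalizing x with
  | zero =>
    cases q with
    | nil => simp [hDP.zero, hopWeight]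
    | cons hxz q =>
      rw [SimpleGraph.Walk.length_cons] at hq
      cases q with
      | nil =>
        have : x ≠ y := by simpa using hxz
        simp [hDP.zero, hopWeight, hopLength, this]
      | cons => simp at hq
  | succ m ih =>
    cases q with
    | nil => simp [hDP.self hm]
    | @cons _ z _ hxz q =>
      rw [SimpleGraph.Walk.length_cons] at hq
      have hxz' : x ≠ z := by simpa using hxz
      have h1 := ih (by omega) q (by omega)
      have h2 := hDP.succ_le m hm x y z
      simp only [hopWeight, if_neg hxz', hopLength, walkWeight_cons,
        SimpleGraph.Walk.length_cons] at *
      calc _ ≤ _ := h2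
        _ ≤ _ := Nat.add_le_add_left h1 _
        _ = _ := by ring

/-- The sum telescopes: each step along `nx` pays exactly the drop of the remaining table value. -/
theorem IsDP.sum_trace (hDP : IsDP (hopWeight w h Δ) N DD nx) (x y : V) {i : ℕ} (hi : i < N) :
    (∑ i' ∈ Finset.range i, hopWeight w h Δ (trace nx N x y i') (trace nx N x y (i' + 1))) +
      DD (N - 1 - i) (trace nx N x y i) y = DD (N - 1) x y := by
  induction i with
  | zero => simp [trace]
  | succ i ih =>
    rw [← ih (by omega), Finset.sum_range_succ, add_assoc]
    congr 1
    obtain ⟨m, hm⟩ : ∃ m, N - 1 - i = m + 1 := ⟨N - 1 - i - 1, by omega⟩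
    have hm' : N - 1 - (i + 1) = m := by omega
    rw [hm', hm, hDP.succ m (by omega), trace, hm]

theorem IsDP.trace_end (hDP : IsDP (hopWeight w h Δ) N DD nx) (hN : 0 < N) (x y : V) :
    trace nx N x y N = y := by
  obtain ⟨M, rfl⟩ : ∃ M, N = M + 1 := ⟨N - 1, by omega⟩
  simp [trace, hDP.nx_zero]

theorem IsDP.hopLength_trace (hDP : IsDP (hopWeight w h Δ) N DD nx) (hN : 0 < N) (x y : V) :
    hopLength w h Δ (walkOf (trace nx N x y) N) = DD (N - 1) x y := by
  obtain ⟨M, rfl⟩ : ∃ M, N = M + 1 := ⟨N - 1, by omega⟩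
  rw [hopLength_walkOf, Finset.sum_range_succ, ← hDP.sum_trace x y (Nat.lt_succ_self M),
    show M + 1 - 1 - M = 0 by omega, hDP.zero]
  have := hDP.trace_end hN x y
  rw [this]

/-- A shortest walk may be taken simple, hence with fewer than `N` hops, while `DD (N - 1)` allows
`N`. The value is attained by the traced walk. -/
theorem IsDP.isHopDist [Fintype V] (hDP : IsDP (hopWeight w h Δ) N DD nx)
    (hN : Fintype.card V = N) : IsHopDist w h Δ (DD (N - 1)) := by
  constructor
  · intro x y q
    have hpos : 0 < N := hN ▸ Fintype.card_pos_iff.2 ⟨x⟩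
    have hl := q.bypass_isPath.length_lt
    refine (hDP.le_hopLength (by omega) q.bypass (by omega)).trans ?_
    exact Nat.add_le_add (Nat.mul_le_mul_left _ (walkWeight_bypass_le w q))
      (Nat.mul_le_mul_left _ q.length_bypass_le_length)
  · intro x y
    have hpos : 0 < N := hN ▸ Fintype.card_pos_iff.2 ⟨x⟩
    exact ⟨(walkOf (trace nx N x y) N).copy rfl (hDP.trace_end hpos x y), by
      exact (hopLength_copy _ _ _ _ _ _).trans (hDP.hopLength_trace hpos x y)⟩

end Walks

/-! ## Load functions -/

section Load

/-- The factor is written `m + 1` because the inequality may fail for the factor `0`: `f 0` can be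
positive. -/
theorem IsLoadFunction.nsmul_le {f : ℝ≥0 → ℝ≥0} (hf : IsLoadFunction f) (m : ℕ) (a : ℝ≥0) :
    f ((m + 1 : ℕ) * a) ≤ (m + 1 : ℕ) * f a := by
  induction m with
  | zero => simp
  | succ m ih =>
    have := hf.2 ((m + 1 : ℕ) * a) a
    calc f ((m + 1 + 1 : ℕ) * a) = f ((m + 1 : ℕ) * a + a) := by congr 1; push_cast; ring
      _ ≤ _ := this
      _ ≤ (m + 1 : ℕ) * f a + f a := by gcongr
      _ = _ := by push_cast; ring

/-- Since `k` is at most `k / l + 1` copies of `l`, the average `f k / k` is at most `2 * f l / l`.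
This is how a load `l` on a part of the edges pays for a block used by `k` demands. -/
theorem IsLoadFunction.mul_le {f : ℝ≥0 → ℝ≥0} (hf : IsLoadFunction f) {l k m : ℕ} (hlk : l ≤ k)
    (hlm : l ≤ m) : (l : ℝ≥0) * f k ≤ 2 * k * f m := by
  rcases Nat.eq_zero_or_pos l with rfl | hl
  · simp
  have h1 : f k ≤ (k / l + 1 : ℕ) * f m := by
    have hk : k ≤ (k / l + 1) * l := by
      rw [mul_comm]; exact (Nat.lt_mul_div_succ k hl).le
    calc f k ≤ f ((k / l + 1 : ℕ) * (l : ℝ≥0)) := hf.1 (by exact_mod_cast hk)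
      _ ≤ (k / l + 1 : ℕ) * f l := hf.nsmul_le _ _
      _ ≤ _ := by gcongr; exact hf.1 (by exact_mod_cast hlm)
  have h2 : l * (k / l + 1) ≤ 2 * k := by
    have := Nat.mul_div_le k l
    rw [mul_add, mul_one]; omega
  calc (l : ℝ≥0) * f k ≤ l * ((k / l + 1 : ℕ) * f m) := by gcongr
    _ = ((l * (k / l + 1) : ℕ) : ℝ≥0) * f m := by push_cast; ring
    _ ≤ ((2 * k : ℕ) : ℝ≥0) * f m := by gcongr
    _ = _ := by push_cast; ring

/-- The summand `f 0` is only there for the empty sum. -/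
theorem IsLoadFunction.sum_le {f : ℝ≥0 → ℝ≥0} (hf : IsLoadFunction f) {γ : Type*} (S : Finset γ)
    (g : γ → ℝ≥0) : f (∑ i ∈ S, g i) ≤ f 0 + ∑ i ∈ S, f (g i) := by
  classical
  induction S using Finset.induction_on with
  | empty => simp
  | insert a S ha ih =>
    rw [Finset.sum_insert ha, Finset.sum_insert ha]
    calc _ ≤ f (g a) + f (∑ i ∈ S, g i) := hf.2 _ _
      _ ≤ f (g a) + (f 0 + ∑ i ∈ S, f (g i)) := by gcongr
      _ = _ := by ring

end Load

/-! ## Bounds on the cost of a family of paths -/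

section Cost

variable {V : Type*} [Fintype V] [DecidableEq V] {k : ℕ} {s t : Fin k → V}

omit [Fintype V] in
/-- A walk of weight at least `δ` starts with edges of total weight at least `δ` that are all
reached after a distance less than `δ`. -/
theorem exists_prefix_edges (w : Sym2 V → ℕ) {y z : V} (q : GPath y z) (hq : q.edges.Nodup)
    (δ : ℕ) (hδ : δ ≤ walkWeight w q) :
    ∃ F : Finset (Sym2 V), (∀ e ∈ F, e ∈ q.edges) ∧ δ ≤ ∑ e ∈ F, w e ∧
      ∀ e ∈ F, ∃ x ∈ e, ∃ q' : GPath y x, q'.length ≤ q.length ∧ walkWeight w q' < δ := by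
  induction q generalizing δ with
  | nil => exact ⟨∅, by simp, by simpa using hδ, by simp⟩
  | @cons y x z hyx q ih =>
    rcases Nat.eq_zero_or_pos δ with rfl | hpos
    · exact ⟨∅, by simp, by simp, by simp⟩
    rw [SimpleGraph.Walk.edges_cons, List.nodup_cons] at hq
    rw [walkWeight_cons] at hδ
    -- The subtraction is truncated: once the first edge covers `δ`, the remaining demand is `0`.
    obtain ⟨F, h1, h2, h3⟩ := ih hq.2 (δ - w s(y, x)) (by omega)
    have hnot : s(y, x) ∉ F := fun h => hq.1 (h1 _ h)
    refine ⟨insert s(y, x) F, ?_, ?_, ?_⟩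
    · intro e he
      rw [SimpleGraph.Walk.edges_cons]
      rcases Finset.mem_insert.1 he with rfl | he
      · simp
      · exact List.mem_cons_of_mem _ (h1 e he)
    · rw [Finset.sum_insert hnot]; omega
    · intro e he
      rcases Finset.mem_insert.1 he with rfl | he
      · exact ⟨y, by simp, .nil, by simp, by simpa using hpos⟩
      · obtain ⟨v, hv, q', h4, h5⟩ := h3 e he
        refine ⟨v, hv, .cons hyx q', by simpa using h4, ?_⟩
        rw [walkWeight_cons]; omega

-- An edge has two endpoints, and an endpoint determines the key. This produces one of the two
-- factors `2` in `sum_keys_le`.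
omit [Fintype V] in
theorem card_filter_le_two {κ : Type*} [DecidableEq κ] (S : Finset κ) (e : Sym2 V)
    (p : κ → V → Prop) (hp : ∀ c ∈ S, ∃ x ∈ e, p c x)
    (huniq : ∀ c ∈ S, ∀ c' ∈ S, ∀ x, p c x → p c' x → c = c') : S.card ≤ 2 := by
  rcases S.eq_empty_or_nonempty with rfl | ⟨c₀, hc₀⟩
  · simp
  have : Nonempty V := ⟨(hp c₀ hc₀).choose⟩
  choose! g hg hg' using hp
  have h1 : S.card ≤ e.toFinset.card := by
    refine Finset.card_le_card_of_injOn g (fun c hc => ?_) fun c hc c' hc' hcc => ?_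
    · simpa using hg c hc
    · exact huniq c hc c' hc' (g c) (hg' c hc) (hcc ▸ hg' c' hc')
  refine h1.trans ?_
  by_cases hd : e.IsDiag
  · simp [Sym2.card_toFinset_of_isDiag e hd]
  · simp [Sym2.card_toFinset_of_not_isDiag e hd]

/-- If demands with different keys are served near disjoint regions, then each key has to be paid
for separately. -/
theorem sum_keys_le (w : Sym2 V → ℕ) {f : ℝ≥0 → ℝ≥0} (hf : IsLoadFunction f)
    (Q : (i : Fin k) → GPath (s i) (t i)) (A : Finset (Fin k)) {κ : Type*} [DecidableEq κ]
    (key : Fin k → κ) (F : Fin k → Finset (Sym2 V)) (δ : ℕ) (R : Fin k → V → Prop)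
    (hF : ∀ i ∈ A, ∀ e ∈ F i, e ∈ (Q i).edges) (hδ : ∀ i ∈ A, δ ≤ ∑ e ∈ F i, w e)
    (hR : ∀ i ∈ A, ∀ e ∈ F i, ∃ x ∈ e, R i x)
    (hdisj : ∀ i ∈ A, ∀ i' ∈ A, ∀ x, R i x → R i' x → key i = key i') :
    ∑ c ∈ A.image key, (δ : ℝ≥0) * f ((A.filter fun i => key i = c).card : ℝ≥0) ≤
      4 * netCost w f Q := by
  classical
  set E : κ → Finset (Sym2 V) := fun c => (A.filter fun i => key i = c).biUnion F with hE
  have hkey : ∀ c ∈ A.image key, (δ : ℝ≥0) * f ((A.filter fun i => key i = c).card : ℝ≥0) ≤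
      2 * ∑ e ∈ E c, (w e : ℝ≥0) * f (load Q e : ℝ≥0) := by
    intro c hc
    set B := A.filter fun i => key i = c with hB
    have hBA : ∀ i ∈ B, i ∈ A := fun i hi => (Finset.mem_filter.1 hi).1
    have hpos : (0 : ℝ≥0) < (B.card : ℝ≥0) := by
      obtain ⟨i, hi, rfl⟩ := Finset.mem_image.1 hc
      have : i ∈ B := Finset.mem_filter.2 ⟨hi, rfl⟩
      exact_mod_cast Finset.card_pos.2 ⟨i, this⟩
    -- After multiplication by the number of demands with this key, the left side becomes a sum over
    -- these demands, and each contributes its own edges of total weight at least `δ`.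
    refine le_of_mul_le_mul_left ?_ hpos
    have hEF : ∀ i ∈ B, F i ⊆ E c := fun i hi => Finset.subset_biUnion_of_mem F hi
    calc (B.card : ℝ≥0) * (δ * f B.card)
        = ∑ i ∈ B, (δ : ℝ≥0) * f B.card := by rw [Finset.sum_const, nsmul_eq_mul]
      _ ≤ ∑ i ∈ B, ∑ e ∈ F i, (w e : ℝ≥0) * f B.card := by
          refine Finset.sum_le_sum fun i hi => ?_
          rw [← Finset.sum_mul]
          gcongr
          exact_mod_cast hδ i (hBA i hi)
      _ = ∑ i ∈ B, ∑ e ∈ E c, if e ∈ F i then (w e : ℝ≥0) * f B.card else 0 := by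
          refine Finset.sum_congr rfl fun i hi => ?_
          rw [← Finset.sum_filter]
          congr 1
          ext e
          simp only [Finset.mem_filter]
          exact ⟨fun h => ⟨hEF i hi h, h⟩, fun h => h.2⟩
      _ = ∑ e ∈ E c, (w e : ℝ≥0) * (((B.filter fun i => e ∈ F i).card : ℝ≥0) * f B.card) := by
          rw [Finset.sum_comm]
          refine Finset.sum_congr rfl fun e _ => ?_
          rw [← Finset.sum_filter, Finset.sum_const, nsmul_eq_mul]
          ring
      _ ≤ ∑ e ∈ E c, (w e : ℝ≥0) * (2 * B.card * f (load Q e)) := by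
          refine Finset.sum_le_sum fun e _ => mul_le_mul_of_nonneg_left ?_ zero_le
          -- Here `l` counts the demands with this key whose chosen edges include `e`. It is at most
          -- the size of `B` and at most the load of `e` in the given solution.
          refine hf.mul_le (l := (B.filter fun i => e ∈ F i).card)
            (Finset.card_filter_le _ _) (Finset.card_le_card fun i hi => ?_)
          rw [Finset.mem_filter] at hi ⊢
          exact ⟨Finset.mem_univ i, hF i (hBA i hi.1) e hi.2⟩
      _ = B.card * (2 * ∑ e ∈ E c, (w e : ℝ≥0) * f (load Q e)) := by
          rw [Finset.mul_sum, Finset.mul_sum]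
          exact Finset.sum_congr rfl fun e _ => by ring
  refine (Finset.sum_le_sum hkey).trans ?_
  rw [← Finset.mul_sum, show (4 : ℝ≥0) = 2 * 2 by norm_num, mul_assoc]
  gcongr
  have hEE : ∀ c, E c ⊆ (⊤ : SimpleGraph V).edgeFinset := by
    intro c e he
    obtain ⟨i, hi, he⟩ := Finset.mem_biUnion.1 he
    exact SimpleGraph.mem_edgeFinset.2
      ((Q i).edges_subset_edgeSet (hF i (Finset.mem_filter.1 hi).1 e he))
  calc ∑ c ∈ A.image key, ∑ e ∈ E c, (w e : ℝ≥0) * f (load Q e)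
      = ∑ c ∈ A.image key, ∑ e ∈ (⊤ : SimpleGraph V).edgeFinset,
          if e ∈ E c then (w e : ℝ≥0) * f (load Q e) else 0 := by
        refine Finset.sum_congr rfl fun c _ => ?_
        rw [← Finset.sum_filter]
        congr 1
        ext e
        simp only [Finset.mem_filter]
        exact ⟨fun h => ⟨hEE c h, h⟩, fun h => h.2⟩
    _ = ∑ e ∈ (⊤ : SimpleGraph V).edgeFinset,
          (((A.image key).filter fun c => e ∈ E c).card : ℝ≥0) *
            ((w e : ℝ≥0) * f (load Q e)) := by
        rw [Finset.sum_comm]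
        refine Finset.sum_congr rfl fun e _ => ?_
        rw [← Finset.sum_filter, Finset.sum_const, nsmul_eq_mul]
    _ ≤ ∑ e ∈ (⊤ : SimpleGraph V).edgeFinset, 2 * ((w e : ℝ≥0) * f (load Q e)) := by
        gcongr with e _
        have := card_filter_le_two ((A.image key).filter fun c => e ∈ E c) e
          (fun c x => ∃ i ∈ A, key i = c ∧ R i x) ?_ ?_
        · exact_mod_cast this
        · intro c hc
          obtain ⟨i, hi, he⟩ := Finset.mem_biUnion.1 (Finset.mem_filter.1 hc).2
          rw [Finset.mem_filter] at hi
          obtain ⟨x, hx, hRx⟩ := hR i hi.1 e he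
          exact ⟨x, hx, i, hi.1, hi.2, hRx⟩
        · rintro c - c' - x ⟨i, hi, rfl, hx⟩ ⟨i', hi', rfl, hx'⟩
          exact hdisj i hi i' hi' x hx hx'
    _ = _ := by rw [← Finset.mul_sum]; rfl

/-- The cost of a family of paths that are put together from shared blocks. -/
theorem netCost_le_of_blocks (w : Sym2 V → ℕ) {f : ℝ≥0 → ℝ≥0} (hf : IsLoadFunction f)
    (P : (i : Fin k) → GPath (s i) (t i)) {γ : Type*} (G : Finset γ)
    (A : γ → Finset (Fin k)) (E : γ → Finset (Sym2 V))
    (hP : ∀ i, ∀ e ∈ (P i).edges, ∃ g ∈ G, i ∈ A g ∧ e ∈ E g) :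
    netCost w f P ≤ (∑ e ∈ (⊤ : SimpleGraph V).edgeFinset, (w e : ℝ≥0) * f 0) +
      ∑ g ∈ G, if (A g).Nonempty then f (A g).card * ((∑ e ∈ E g, w e : ℕ) : ℝ≥0) else 0 := by
  classical
  have hload : ∀ e, f (load P e) ≤
      f 0 + ∑ g ∈ G.filter fun g => (A g).Nonempty ∧ e ∈ E g, f (A g).card := by
    intro e
    have : load P e ≤ ∑ g ∈ G.filter fun g => (A g).Nonempty ∧ e ∈ E g, (A g).card := by
      refine (Finset.card_le_card fun i hi => ?_).trans Finset.card_biUnion_le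
      rw [Finset.mem_filter] at hi
      obtain ⟨g, hg, hi', he⟩ := hP i e hi.2
      exact Finset.mem_biUnion.2 ⟨g, Finset.mem_filter.2 ⟨hg, ⟨i, hi'⟩, he⟩, hi'⟩
    refine le_trans (hf.1 (?_ : _ ≤ ∑ g ∈ G.filter fun g => (A g).Nonempty ∧ e ∈ E g,
      ((A g).card : ℝ≥0))) (hf.sum_le _ _)
    exact_mod_cast this
  have hsum : netCost w f P ≤ ∑ e ∈ (⊤ : SimpleGraph V).edgeFinset, (w e : ℝ≥0) *
      (f 0 + ∑ g ∈ G.filter fun g => (A g).Nonempty ∧ e ∈ E g, f (A g).card) :=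
    Finset.sum_le_sum fun e _ => mul_le_mul_of_nonneg_left (hload e) zero_le
  refine hsum.trans ?_
  simp only [mul_add, Finset.sum_add_distrib, Finset.mul_sum, Finset.sum_filter, mul_ite, mul_zero]
  rw [Finset.sum_comm (s := (⊤ : SimpleGraph V).edgeFinset) (t := G)]
  -- Blocks without users contribute nothing, so `f 0` is paid once per edge and not once for each
  -- of the many potential blocks.
  gcongr with g _
  split_ifs with hA
  · rw [Nat.cast_sum, Finset.mul_sum, ← Finset.sum_filter]
    refine (Finset.sum_le_sum_of_subset (t := E g) fun e he =>
      (Finset.mem_filter.1 he).2.2).trans (le_of_eq ?_)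
    exact Finset.sum_congr rfl fun e _ => mul_comm _ _
  · simp [hA]

end Cost

end HopND

namespace HopND

/-! ## Oblivious routing along neighbourhood covers -/

/-- The data from which the paths are put together. `dist j` is the hop-weighted metric of scale
`2 ^ j`, and `next j` the table of its shortest paths. At every scale, each vertex has a home, which
is given by a class and a center: the center is near, and vertices of the same class but with
different centers are far from each other. The scale of a pair is the first one at which its
vertices are near. -/
structure Routing {V : Type*} [Fintype V] [DecidableEq V] (w : Sym2 V → ℕ) (h β K : ℕ) where
  dist : ℕ → ℕ → V → V → ℕ
  next : ℕ → ℕ → V → V → V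
  center : ℕ → V → V
  cls : ℕ → V → ℕ
  scale : V → V → ℕ
  isDP : ∀ j ≤ K, IsDP (hopWeight w h (2 ^ j)) (Fintype.card V) (dist j) (next j)
  center_zero : ∀ x, center 0 x = x
  dist_center : ∀ j ≤ K, ∀ x, dist j (Fintype.card V - 1) x (center j x) ≤ 8 * h * 2 ^ j * β
  cls_lt : ∀ j ≤ K, ∀ x, cls j x < β
  center_eq : ∀ j, 1 ≤ j → j ≤ K → ∀ x y, cls j x = cls j y →
    dist j (Fintype.card V - 1) x y ≤ 8 * h * 2 ^ j → center j x = center j y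
  one_le_scale : ∀ x y, 1 ≤ scale x y
  scale_le : ∀ x y, scale x y ≤ K
  dist_scale : ∀ x y, dist (scale x y) (Fintype.card V - 1) x y ≤ 2 * h * 2 ^ scale x y
  lt_dist : ∀ x y j, 1 ≤ j → j < scale x y → 2 * h * 2 ^ j < dist j (Fintype.card V - 1) x y

namespace Routing

variable {V : Type*} [Fintype V] [DecidableEq V] {w : Sym2 V → ℕ} {h β K : ℕ}
  (A : Routing w h β K)

/-! ### The path of a pair and its blocks -/

/-- The metric of scale `2 ^ j`. -/
def D (j : ℕ) : V → V → ℕ := A.dist j (Fintype.card V - 1)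

theorem isHopDist {j : ℕ} (hj : j ≤ K) : IsHopDist w h (2 ^ j) (A.D j) :=
  (A.isDP j hj).isHopDist rfl

theorem D_succ_le {j : ℕ} (hj : j + 1 ≤ K) (x y : V) : A.D (j + 1) x y ≤ 2 * A.D j x y :=
  (A.isHopDist (by omega : j ≤ K)).le_double (by
    have := A.isHopDist hj
    rwa [pow_succ, mul_comm] at this) x y

/-- The level of the `b`-th block of the path from `u` to `v`. -/
def level (u v : V) (b : ℕ) : ℕ := if b < A.scale u v then b + 1 else 2 * A.scale u v - b

/-- The end of the `b`-th block of the path from `u` to `v`. -/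
def target (u v : V) (b : ℕ) : V :=
  if b < A.scale u v then A.center (b + 1) u else A.center (2 * A.scale u v - b - 1) v

/-- The beginning of the `b`-th block of the path from `u` to `v`. -/
def source (u v : V) : ℕ → V
  | 0 => u
  | b + 1 => A.target u v b

/-- The vertices on the path from `u` to `v`. -/
def node (u v : V) : ℕ → V
  | 0 => u
  | q + 1 => A.next (A.level u v (q / Fintype.card V))
      (Fintype.card V - 1 - q % Fintype.card V) (node u v q) (A.target u v (q / Fintype.card V))

/-- The vertices of the block at level `j` from `x` to `y`. -/
def blockTrace (j : ℕ) (x y : V) : ℕ → V := trace (A.next j) (Fintype.card V) x y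

/-- The edges of the block at level `j` from `x` to `y`. -/
def block (j : ℕ) (x y : V) : Finset (Sym2 V) :=
  (walkOf (A.blockTrace j x y) (Fintype.card V)).edges.toFinset

theorem level_le {u v : V} {b : ℕ} (hb : b < 2 * A.scale u v) : A.level u v b ≤ A.scale u v := by
  unfold level; split_ifs <;> omega

theorem one_le_level {u v : V} {b : ℕ} (hb : b < 2 * A.scale u v) : 1 ≤ A.level u v b := by
  unfold level; split_ifs <;> omega

omit [DecidableEq V] in
theorem card_pos_of (u : V) : 0 < Fintype.card V := Fintype.card_pos_iff.2 ⟨u⟩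

/-- Every block takes exactly `Fintype.card V` steps, stays included, so the quotient and remainder
of the step number give the block and the position inside it. -/
theorem node_block {u v : V} {b : ℕ}
    (hs : A.node u v (b * Fintype.card V) = A.source u v b) {i : ℕ} (hi : i ≤ Fintype.card V) :
    A.node u v (b * Fintype.card V + i) =
      A.blockTrace (A.level u v b) (A.source u v b) (A.target u v b) i := by
  have hpos := card_pos_of u
  induction i with
  | zero => simpa [blockTrace, trace] using hs
  | succ i ih =>
    have hdiv : (b * Fintype.card V + i) / Fintype.card V = b := by
      rw [mul_comm, Nat.mul_add_div hpos, Nat.div_eq_of_lt (by omega), add_zero]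
    have hmod : (b * Fintype.card V + i) % Fintype.card V = i := by
      rw [mul_comm, Nat.mul_add_mod, Nat.mod_eq_of_lt (by omega)]
    rw [← add_assoc, node, hdiv, hmod, ih (by omega)]
    rfl

theorem node_mul {u v : V} {b : ℕ} (hb : b ≤ 2 * A.scale u v) :
    A.node u v (b * Fintype.card V) = A.source u v b := by
  induction b with
  | zero => simp [node, source]
  | succ b ih =>
    have hl : A.level u v b ≤ K := (A.level_le (by omega)).trans (A.scale_le u v)
    rw [add_mul, one_mul, A.node_block (ih (by omega)) le_rfl]
    exact (A.isDP _ hl).trace_end (card_pos_of u) _ _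

theorem node_end (u v : V) : A.node u v (2 * A.scale u v * Fintype.card V) = v := by
  have h1 := A.one_le_scale u v
  rw [A.node_mul le_rfl]
  obtain ⟨m, hm⟩ : ∃ m, 2 * A.scale u v = m + 1 := ⟨2 * A.scale u v - 1, by omega⟩
  rw [hm, source, target, if_neg (by omega), show 2 * A.scale u v - m - 1 = 0 by omega,
    A.center_zero]

theorem node_zero (u v : V) : A.node u v 0 = u := rfl

/-- The path from `u` to `v`. -/
def path (u v : V) : GPath u v :=
  -- Even equal vertices have scale at least `1`, so the general path might visit centers, whereas
  -- the optimum can leave such a demand at home.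
  if huv : u = v then SimpleGraph.Walk.nil.copy rfl huv
  else (walkOf (A.node u v) (2 * A.scale u v * Fintype.card V)).copy
    (A.node_zero u v) (A.node_end u v)

/-- The endpoint of a demand, and the vertex whose home is used for it at level `j`. -/
def anchor (side : Bool) (u v : V) (j : ℕ) : V :=
  if side then (if j = A.scale u v then u else v) else u

/-- Read backwards, a block of the descent has the same form as a block of the ascent: it joins the
center of an endpoint at level `j - 1` to the center of a nearby vertex at level `j`. The exception
is the crossing at the top, where the upper center is still that of `u`; `anchor` accounts for it.
-/
theorem source_target {u v : V} {b : ℕ} (hb : b < 2 * A.scale u v) :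
    ∃ j, 1 ≤ j ∧ j ≤ A.scale u v ∧ A.level u v b = j ∧
      ((A.source u v b = A.center (j - 1) u ∧ A.target u v b = A.center j (A.anchor false u v j)) ∨
       (A.source u v b = A.center j (A.anchor true u v j) ∧
          A.target u v b = A.center (j - 1) v)) := by
  refine ⟨_, A.one_le_level hb, A.level_le hb, rfl, ?_⟩
  by_cases hlt : b < A.scale u v
  · left
    constructor
    · cases b with
      | zero => simp [source, level, hlt, A.center_zero]
      | succ b => rw [source, target, level, if_pos hlt, if_pos (by omega)]; rfl
    · simp [target, level, hlt, anchor]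
  · right
    constructor
    · cases b with
      | zero => have := A.one_le_scale u v; omega
      | succ b =>
        by_cases hb' : b < A.scale u v
        · have : b + 1 = A.scale u v := by omega
          simp only [source, target, level, if_neg hlt, if_pos hb', anchor, if_true]
          rw [if_pos (by omega), show 2 * A.scale u v - (b + 1) = b + 1 by omega]
        · simp only [source, target, level, if_neg hlt, if_neg hb', anchor, if_true]
          rw [if_neg (by omega), show 2 * A.scale u v - (b + 1) = 2 * A.scale u v - b - 1 by omega]
    · simp [target, level, hlt]

theorem mem_edges_path {u v : V} {e : Sym2 V} (he : e ∈ (A.path u v).edges) :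
    u ≠ v ∧ ∃ b < 2 * A.scale u v,
      e ∈ A.block (A.level u v b) (A.source u v b) (A.target u v b) := by
  unfold path at he
  split_ifs at he with huv
  · simp at he
  refine ⟨huv, ?_⟩
  rw [SimpleGraph.Walk.edges_copy] at he
  obtain ⟨q, hq, hne, rfl⟩ := mem_edges_walkOf _ he
  have hpos := card_pos_of u
  have hb : q / Fintype.card V < 2 * A.scale u v := Nat.div_lt_of_lt_mul (by rwa [mul_comm])
  have hi := Nat.mod_lt q hpos
  have hs := A.node_mul hb.le
  have h1 := A.node_block hs hi.le
  have h2 := A.node_block hs (Nat.succ_le_of_lt hi)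
  rw [Nat.div_add_mod'] at h1
  rw [← Nat.add_one, ← add_assoc, Nat.div_add_mod'] at h2
  refine ⟨_, hb, List.mem_toFinset.2 ?_⟩
  rw [h1, h2] at hne ⊢
  exact mk_mem_edges_walkOf _ hi hne

theorem length_path_le {u v : V} {B : ℕ}
    (hB : ∀ b < 2 * A.scale u v,
      (walkOf (A.blockTrace (A.level u v b) (A.source u v b) (A.target u v b))
        (Fintype.card V)).length ≤ B) : (A.path u v).length ≤ 2 * A.scale u v * B := by
  unfold path
  split_ifs with huv
  · simp
  rw [SimpleGraph.Walk.length_copy]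
  have hkey : ∀ b ≤ 2 * A.scale u v,
      (walkOf (A.node u v) (b * Fintype.card V)).length ≤ b * B := by
    intro b
    induction b with
    | zero =>
      have : ∀ M, M = 0 → (walkOf (A.node u v) M).length = 0 := by rintro _ rfl; rfl
      exact fun _ => (this _ (zero_mul _)).le.trans (Nat.zero_le _)
    | succ b ih =>
      intro hb
      rw [add_mul, one_mul, length_walkOf_add, add_mul, one_mul]
      refine Nat.add_le_add (ih (by omega)) (le_trans (le_of_eq ?_) (hB b (by omega)))
      exact length_walkOf_congr fun i hi => A.node_block (A.node_mul (by omega)) hi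
  exact hkey _ le_rfl

theorem dist_anchor {u v : V} (side : Bool) {j : ℕ} (hj : j ≤ A.scale u v) :
    A.D j (A.anchor side u v j) (if side then v else u) ≤ 2 * h * 2 ^ j := by
  unfold anchor
  split_ifs with h1 h2
  · subst h2; exact A.dist_scale u v
  · rw [(A.isHopDist (hj.trans (A.scale_le u v))).self]; exact Nat.zero_le _
  · rw [(A.isHopDist (hj.trans (A.scale_le u v))).self]; exact Nat.zero_le _

/-- In units of `h * 2 ^ j`: going from the lower center to the endpoint costs `8 * β`, because the
bound at level `j - 1` at most doubles; the way to the anchor costs `2`; its center costs another `8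
* β`. -/
theorem dist_block {u v : V} (side : Bool) {j : ℕ} (hj1 : 1 ≤ j) (hj : j ≤ A.scale u v) :
    A.D j (A.center (j - 1) (if side then v else u)) (A.center j (A.anchor side u v j)) ≤
      h * 2 ^ j * (16 * β + 2) := by
  have hjK := hj.trans (A.scale_le u v)
  set y := if side then v else u
  set x := A.anchor side u v j
  have hD := A.isHopDist hjK
  have h1 : A.D j (A.center (j - 1) y) y ≤ 8 * h * 2 ^ j * β := by
    obtain ⟨i, rfl⟩ : ∃ i, j = i + 1 := ⟨j - 1, by omega⟩
    have := A.dist_center i (by omega) y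
    rw [hD.comm]
    refine (A.D_succ_le hjK _ _).trans ?_
    rw [pow_succ]
    calc _ ≤ 2 * (8 * h * 2 ^ i * β) := Nat.mul_le_mul_left _ this
      _ = _ := by ring
  have h2 : A.D j y x ≤ 2 * h * 2 ^ j := by
    rw [hD.comm]; exact A.dist_anchor side hj
  have h3 : A.D j x (A.center j x) ≤ 8 * h * 2 ^ j * β := A.dist_center j hjK x
  calc _ ≤ _ := (hD.triangle _ y _).trans (Nat.add_le_add_left (hD.triangle _ x _) _)
    _ ≤ _ := Nat.add_le_add h1 (Nat.add_le_add h2 h3)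
    _ = _ := by ring

theorem hopLength_block {j : ℕ} (hj : j ≤ K) (x y : V) :
    hopLength w h (2 ^ j) (walkOf (A.blockTrace j x y) (Fintype.card V)) = A.D j x y :=
  (A.isDP j hj).hopLength_trace (card_pos_of x) x y

/-- Hop-weighted length charges `h` per unit of weight. The next lemma uses the other charge, `2 ^
j` per hop. -/
theorem sum_block_le (hh : 0 < h) {j B : ℕ} (hj : j ≤ K) {x y : V} (hB : A.D j x y ≤ h * B) :
    ∑ e ∈ A.block j x y, w e ≤ B := by
  have h1 : ∑ e ∈ A.block j x y, w e ≤
      walkWeight w (walkOf (A.blockTrace j x y) (Fintype.card V)) := by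
    unfold block walkWeight
    rw [← Finset.sum_congr (List.toFinset.ext fun _ => List.mem_dedup) fun _ _ => rfl,
      List.sum_toFinset _ (List.nodup_dedup _)]
    exact ((List.dedup_sublist _).map w).sum_le_sum fun _ _ => Nat.zero_le _
  have h2 := A.hopLength_block hj x y
  unfold hopLength at h2
  refine h1.trans (Nat.le_of_mul_le_mul_left ?_ hh)
  omega

theorem length_block_le {j B : ℕ} (hj : j ≤ K) {x y : V} (hB : A.D j x y ≤ 2 ^ j * B) :
    (walkOf (A.blockTrace j x y) (Fintype.card V)).length ≤ B := by
  have h2 := A.hopLength_block hj x y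
  unfold hopLength at h2
  refine Nat.le_of_mul_le_mul_left (?_ : 2 ^ j * _ ≤ 2 ^ j * B) (by positivity)
  omega

theorem length_path (u v : V) : (A.path u v).length ≤ 2 * K * (h * (16 * β + 2)) := by
  refine (A.length_path_le (B := h * (16 * β + 2)) fun b hb => ?_).trans
    (Nat.mul_le_mul_right _ (Nat.mul_le_mul_left _ (A.scale_le u v)))
  obtain ⟨j, hj1, hj, hl, hst⟩ := A.source_target hb
  have hjK := hj.trans (A.scale_le u v)
  rw [hl]
  refine A.length_block_le hjK ?_
  rcases hst with ⟨h1, h2⟩ | ⟨h1, h2⟩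
  · rw [h1, h2]
    calc _ ≤ _ := A.dist_block (u := u) (v := v) false hj1 hj
      _ = _ := by ring
  · rw [h1, h2, (A.isHopDist hjK).comm]
    calc _ ≤ _ := A.dist_block (u := u) (v := v) true hj1 hj
      _ = _ := by ring

/-- Demands with the same classes but different homes are far apart. -/
theorem key_eq (hw : ∀ x y : V, x ≠ y → 1 ≤ w s(x, y)) {j : ℕ} (hj1 : 1 ≤ j) (side : Bool)
    {u v u' v' y y' : V} (hy : y = if side then v else u) (hy' : y' = if side then v' else u')
    (hj : j ≤ A.scale u v) (hj' : j ≤ A.scale u' v') (hc : A.cls (j - 1) y = A.cls (j - 1) y')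
    (hc' : A.cls j (A.anchor side u v j) = A.cls j (A.anchor side u' v' j))
    {z : V} (q : GPath y z) (hq : q.length ≤ h) (hqw : walkWeight w q < 2 ^ (j - 1))
    (q' : GPath y' z) (hq' : q'.length ≤ h) (hqw' : walkWeight w q' < 2 ^ (j - 1)) :
    A.center (j - 1) y = A.center (j - 1) y' ∧
      A.center j (A.anchor side u v j) = A.center j (A.anchor side u' v' j) := by
  have hjK := hj.trans (A.scale_le u v)
  have ha := A.dist_anchor side hj
  have ha' := A.dist_anchor side hj'
  rw [← hy] at ha
  rw [← hy'] at ha'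
  set x := A.anchor side u v j
  set x' := A.anchor side u' v' j
  obtain ⟨i, rfl⟩ : ∃ i, j = i + 1 := ⟨j - 1, by omega⟩
  simp only [Nat.add_sub_cancel] at *
  have hD := A.isHopDist hjK
  have hD' := A.isHopDist (by omega : i ≤ K)
  have hlow : ∀ {a : V} (p : GPath a z), p.length ≤ h → walkWeight w p < 2 ^ i →
      A.D i a z ≤ 2 * h * 2 ^ i := by
    intro a p hp hpw
    refine (hD'.1 _ _ p).trans ?_
    calc _ ≤ h * 2 ^ i + 2 ^ i * h :=
          Nat.add_le_add (Nat.mul_le_mul_left _ hpw.le) (Nat.mul_le_mul_left _ hp)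
      _ = _ := by ring
  have h1 := hlow q hq hqw
  have h2 := hlow q' hq' hqw'
  -- Both endpoints reach the common vertex `z` by walks with few hops and small weight.
  have hyy : A.D i y y' ≤ 4 * h * 2 ^ i := by
    refine (hD'.triangle _ z _).trans ?_
    rw [hD'.comm z y']
    linarith
  constructor
  -- At level `0` every vertex is its own center and nothing is separated. But a walk of weight less
  -- than `1` is trivial, so the endpoints coincide.
  · rcases Nat.eq_zero_or_pos i with rfl | hi
    · have hnil : ∀ {a : V} (p : GPath a z), walkWeight w p < 2 ^ 0 → a = z := by
        intro a p hp
        cases p with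
        | nil => rfl
        | @cons _ b _ hab p =>
          have := hw a b (by simpa using hab)
          rw [walkWeight_cons] at hp
          omega
      rw [hnil q hqw, hnil q' hqw']
    · refine A.center_eq i hi (by omega) y y' hc (hyy.trans ?_)
      exact Nat.mul_le_mul_right _ (Nat.mul_le_mul_right _ (by norm_num))
  -- This is where the separation constant `8` is used up: `4` for the two endpoints, after doubling
  -- the bound of level `i`, and `2` for each of the two anchors.
  · refine A.center_eq (i + 1) (by omega) hjK x x' hc' ?_
    have h3 := A.D_succ_le hjK y y'
    have h4 := hD.triangle x y x'
    have h5 := hD.triangle y y' x'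
    rw [hD.comm y' x'] at h5
    rw [pow_succ] at *
    change A.D (i + 1) x x' ≤ _
    linarith

/-- Before the scale of a pair, every path with few hops between its vertices is long. -/
theorem le_walkWeight (hw : ∀ x y : V, x ≠ y → 1 ≤ w s(x, y)) {u v : V} (huv : u ≠ v) {j : ℕ}
    (hj1 : 1 ≤ j) (hj : j ≤ A.scale u v) (q : GPath u v) (hq : q.length ≤ h) :
    2 ^ (j - 1) ≤ walkWeight w q := by
  obtain ⟨i, rfl⟩ : ∃ i, j = i + 1 := ⟨j - 1, by omega⟩
  rw [Nat.add_sub_cancel]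
  -- The scale is minimal only among levels from `1` on; for `j = 1` the bound comes from the
  -- weights being at least `1`.
  rcases Nat.eq_zero_or_pos i with rfl | hi
  · cases q with
    | nil => exact absurd rfl huv
    | @cons _ b _ hab p =>
      have := hw u b (by simpa using hab)
      rw [walkWeight_cons]
      simp only [pow_zero]
      omega
  · have hK : i ≤ K := by have := A.scale_le u v; omega
    have h1 := A.lt_dist u v i hi (by omega)
    have h2 := (A.isHopDist hK).1 u v q
    by_contra! hlt
    have h3 : hopLength w h (2 ^ i) q ≤ h * 2 ^ i + 2 ^ i * h :=
      Nat.add_le_add (Nat.mul_le_mul_left _ hlt.le) (Nat.mul_le_mul_left _ hq)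
    have h4 : A.D i u v ≤ 2 * h * 2 ^ i := by
      calc _ ≤ _ := h2.trans h3
        _ = _ := by ring
    exact absurd h1 (not_lt.2 h4)

/-! ### Charging the blocks to the optimum -/

variable {k : ℕ} (s t : Fin k → V)

/-- The endpoint of a demand on the given side. -/
def endpoint (s t : Fin k → V) (side : Bool) (i : Fin k) : V := if side then t i else s i

/-- The demands whose paths have a block at level `j` on the given side, for given classes. -/
def demands (j : ℕ) (side : Bool) (b b' : ℕ) : Finset (Fin k) :=
  Finset.univ.filter fun i => s i ≠ t i ∧ j ≤ A.scale (s i) (t i) ∧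
    A.cls (j - 1) (endpoint s t side i) = b ∧ A.cls j (A.anchor side (s i) (t i) j) = b'

/-- The homes that determine the block of a demand. -/
def key (j : ℕ) (side : Bool) (i : Fin k) : V × V :=
  (A.center (j - 1) (endpoint s t side i), A.center j (A.anchor side (s i) (t i) j))

/-- The edges of the block for the given homes. -/
def keyBlock (j : ℕ) (side : Bool) (c : V × V) : Finset (Sym2 V) :=
  if side then A.block j c.2 c.1 else A.block j c.1 c.2

/-- The edges chosen for a demand are the first ones, seen from its endpoint, of total weight at
least `2 ^ (j - 1)` on its path `Q i`. They all lie close to the endpoint, so `key_eq` supplies the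
disjointness that `sum_keys_le` asks for. -/
theorem sum_demands_le (hw : ∀ x y : V, x ≠ y → 1 ≤ w s(x, y)) {f : ℝ≥0 → ℝ≥0}
    (hf : IsLoadFunction f) (Q : (i : Fin k) → GPath (s i) (t i)) (hQ : ∀ i, (Q i).length ≤ h)
    {j : ℕ} (hj1 : 1 ≤ j) (side : Bool) (b b' : ℕ) :
    ∑ c ∈ (A.demands s t j side b b').image (A.key s t j side), ((2 ^ (j - 1) : ℕ) : ℝ≥0) *
      f (((A.demands s t j side b b').filter fun i => A.key s t j side i = c).card : ℝ≥0) ≤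
      4 * netCost w f Q := by
  have hex : ∀ i ∈ A.demands s t j side b b', ∃ F : Finset (Sym2 V),
      (∀ e ∈ F, e ∈ (Q i).edges) ∧ 2 ^ (j - 1) ≤ ∑ e ∈ F, w e ∧
      ∀ e ∈ F, ∃ x ∈ e, ∃ q' : GPath (endpoint s t side i) x, q'.length ≤ h ∧
        walkWeight w q' < 2 ^ (j - 1) := by
    intro i hi
    obtain ⟨-, hne, hj, -, -⟩ := Finset.mem_filter.1 hi
    -- Passing to the simple path makes the edges distinct, without new edges or additional hops.
    have hQ' : (Q i).bypass.length ≤ h := (Q i).length_bypass_le_length.trans (hQ i)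
    have hle := A.le_walkWeight hw hne hj1 hj (Q i).bypass hQ'
    have hnd := (Q i).bypass_isPath.isTrail.edges_nodup
    cases side with
    | false =>
      obtain ⟨F, h1, h2, h3⟩ := exists_prefix_edges w _ hnd (2 ^ (j - 1)) hle
      refine ⟨F, fun e he => (Q i).edges_bypass_subset_edges (h1 e he), h2, fun e he => ?_⟩
      obtain ⟨x, hx, q', h4, h5⟩ := h3 e he
      exact ⟨x, hx, q', h4.trans hQ', h5⟩
    -- On the side of `t i`, the initial part of the reversed path is used.
    | true =>
      obtain ⟨F, h1, h2, h3⟩ := exists_prefix_edges w (Q i).bypass.reverse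
        (by rw [SimpleGraph.Walk.edges_reverse]; exact List.nodup_reverse.2 hnd) (2 ^ (j - 1))
        (by rwa [walkWeight_reverse])
      refine ⟨F, fun e he => (Q i).edges_bypass_subset_edges (by simpa using h1 e he), h2,
        fun e he => ?_⟩
      obtain ⟨x, hx, q', h4, h5⟩ := h3 e he
      exact ⟨x, hx, q', h4.trans (by simpa using hQ'), h5⟩
  choose! F hF1 hF2 hF3 using hex
  refine sum_keys_le w hf Q _ _ F _ (fun i x => ∃ q' : GPath (endpoint s t side i) x,
    q'.length ≤ h ∧ walkWeight w q' < 2 ^ (j - 1)) hF1 hF2 hF3 ?_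
  rintro i hi i' hi' x ⟨q, hq, hqw⟩ ⟨q', hq', hqw'⟩
  obtain ⟨-, -, hj, hb, hb'⟩ := Finset.mem_filter.1 hi
  obtain ⟨-, -, hj', hc, hc'⟩ := Finset.mem_filter.1 hi'
  have := A.key_eq hw hj1 side rfl rfl hj hj' (hb.trans hc.symm) (hb'.trans hc'.symm) q hq hqw
    q' hq' hqw'
  exact Prod.ext this.1 this.2

theorem sum_keyBlock_le (hh : 0 < h) {j : ℕ} (hj1 : 1 ≤ j) {side : Bool} {i : Fin k}
    (hj : j ≤ A.scale (s i) (t i)) :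
    ∑ e ∈ A.keyBlock j side (A.key s t j side i), w e ≤ 2 ^ j * (16 * β + 2) := by
  have hjK := hj.trans (A.scale_le _ _)
  have hd := A.dist_block side hj1 hj
  rw [mul_assoc] at hd
  cases side with
  | false => exact A.sum_block_le hh hjK hd
  | true =>
    rw [(A.isHopDist hjK).comm] at hd
    exact A.sum_block_le hh hjK hd

theorem mem_block_of_mem_path (i : Fin k) {e : Sym2 V} (he : e ∈ (A.path (s i) (t i)).edges) :
    ∃ j ∈ Finset.Icc 1 K, ∃ side : Bool, ∃ b < β, ∃ b' < β, i ∈ A.demands s t j side b b' ∧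
      e ∈ A.keyBlock j side (A.key s t j side i) := by
  obtain ⟨hne, b, hb, he⟩ := A.mem_edges_path he
  obtain ⟨j, hj1, hj, hl, hst⟩ := A.source_target hb
  have hjK := hj.trans (A.scale_le _ _)
  refine ⟨j, Finset.mem_Icc.2 ⟨hj1, hjK⟩, ?_⟩
  rw [hl] at he
  rcases hst with ⟨h1, h2⟩ | ⟨h1, h2⟩
  · refine ⟨false, _, A.cls_lt (j - 1) (by omega) (s i), _,
      A.cls_lt j hjK (A.anchor false (s i) (t i) j), ?_, ?_⟩
    · exact Finset.mem_filter.2 ⟨Finset.mem_univ i, hne, hj, rfl, rfl⟩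
    · rwa [h1, h2] at he
  · refine ⟨true, _, A.cls_lt (j - 1) (by omega) (t i), _,
      A.cls_lt j hjK (A.anchor true (s i) (t i) j), ?_, ?_⟩
    · exact Finset.mem_filter.2 ⟨Finset.mem_univ i, hne, hj, rfl, rfl⟩
    · rwa [h1, h2] at he

/-- Every edge of a path lies in a block named by level, side, two classes and two centers. For
fixed level, side and classes, the blocks together cost at most `8 * (16 * β + 2)` times the given
solution: the factor is `4` from `sum_keys_le`, and `2` because a block is measured by `2 ^ j` but
earns only `2 ^ (j - 1)`. -/
theorem netCost_path_le (hh : 0 < h) (hw : ∀ x y : V, x ≠ y → 1 ≤ w s(x, y)) {f : ℝ≥0 → ℝ≥0}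
    (hf : IsLoadFunction f) (Q : (i : Fin k) → GPath (s i) (t i))
    (hQ : ∀ i, (Q i).length ≤ h) :
    netCost w f (fun i => A.path (s i) (t i)) ≤
      ((1 + K * (2 * (β * (β * (8 * (16 * β + 2))))) : ℕ) : ℝ≥0) * netCost w f Q := by
  classical
  have h1 := netCost_le_of_blocks w hf (fun i => A.path (s i) (t i))
    (Finset.Icc 1 K ×ˢ (Finset.univ : Finset Bool) ×ˢ Finset.range β ×ˢ Finset.range β ×ˢ
      (Finset.univ : Finset (V × V)))
    (fun g => (A.demands s t g.1 g.2.1 g.2.2.1 g.2.2.2.1).filter fun i =>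
      A.key s t g.1 g.2.1 i = g.2.2.2.2)
    (fun g => A.keyBlock g.1 g.2.1 g.2.2.2.2) (by
      intro i e he
      obtain ⟨j, hj, side, b, hb, b', hb', hi, he'⟩ := A.mem_block_of_mem_path s t i he
      exact ⟨(j, side, b, b', A.key s t j side i), by simp [Finset.mem_Icc.1 hj, hb, hb'],
        Finset.mem_filter.2 ⟨hi, rfl⟩, he'⟩)
  refine h1.trans ?_
  rw [Nat.cast_add, add_mul, Nat.cast_one, one_mul]
  -- The given solution pays at least `w e * f 0` on every edge, by monotonicity.
  refine add_le_add (Finset.sum_le_sum fun e _ => mul_le_mul_of_nonneg_left (hf.1 zero_le)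
    zero_le) ?_
  simp only [Finset.sum_product]
  have h2 : ∀ j ∈ Finset.Icc 1 K, ∀ side ∈ (Finset.univ : Finset Bool), ∀ b ∈ Finset.range β,
      ∀ b' ∈ Finset.range β, ∑ c ∈ (Finset.univ : Finset (V × V)),
        (if ((A.demands s t j side b b').filter fun i => A.key s t j side i = c).Nonempty then
          f ((A.demands s t j side b b').filter fun i => A.key s t j side i = c).card *
            ((∑ e ∈ A.keyBlock j side c, w e : ℕ) : ℝ≥0) else 0) ≤
        ((8 * (16 * β + 2) : ℕ) : ℝ≥0) * netCost w f Q := by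
    intro j hj side _ b _ b' _
    obtain ⟨hj1, hjK⟩ := Finset.mem_Icc.1 hj
    have h3 := A.sum_demands_le s t hw hf Q hQ hj1 side b b'
    calc _ ≤ ∑ c ∈ (Finset.univ : Finset (V × V)),
        (if c ∈ (A.demands s t j side b b').image (A.key s t j side) then
          ((2 * (16 * β + 2) : ℕ) : ℝ≥0) * (((2 ^ (j - 1) : ℕ) : ℝ≥0) *
            f ((A.demands s t j side b b').filter fun i => A.key s t j side i = c).card)
          else 0) := by
          refine Finset.sum_le_sum fun c _ => ?_
          split_ifs with hne hmem hmem
          · obtain ⟨i, hi⟩ := hne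
            obtain ⟨hi₁, rfl⟩ := Finset.mem_filter.1 hi
            obtain ⟨-, -, hj', -, -⟩ := Finset.mem_filter.1 hi₁
            have h4 := A.sum_keyBlock_le s t hh hj1 (side := side) hj'
            have h5 : 2 ^ j * (16 * β + 2) = 2 * (16 * β + 2) * 2 ^ (j - 1) := by
              obtain ⟨m, rfl⟩ : ∃ m, j = m + 1 := ⟨j - 1, by omega⟩
              rw [Nat.add_sub_cancel, pow_succ]; ring
            rw [h5] at h4
            rw [← mul_assoc, mul_comm, ← Nat.cast_mul]
            gcongr
          · obtain ⟨i, hi⟩ := hne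
            obtain ⟨hi₁, rfl⟩ := Finset.mem_filter.1 hi
            exact absurd (Finset.mem_image_of_mem _ hi₁) hmem
          · exact zero_le
          · exact le_rfl
      _ = ((2 * (16 * β + 2) : ℕ) : ℝ≥0) *
          ∑ c ∈ (A.demands s t j side b b').image (A.key s t j side),
            ((2 ^ (j - 1) : ℕ) : ℝ≥0) *
            f ((A.demands s t j side b b').filter fun i => A.key s t j side i = c).card := by
          rw [← Finset.sum_filter, Finset.mul_sum]
          congr 1
          ext c
          simp
      _ ≤ ((2 * (16 * β + 2) : ℕ) : ℝ≥0) * (4 * netCost w f Q) := by gcongr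
      _ = _ := by push_cast; ring
  calc _ ≤ _ := Finset.sum_le_sum fun j hj => Finset.sum_le_sum fun side hs =>
        Finset.sum_le_sum fun b hb => Finset.sum_le_sum fun b' hb' => h2 j hj side hs b hb b' hb'
    _ = _ := by
        simp only [Finset.sum_const, Nat.card_Icc, Finset.card_univ, Fintype.card_bool,
          Finset.card_range, nsmul_eq_mul, Nat.add_sub_cancel]
        push_cast
        ring

end Routing

end HopND

namespace HopND

/-! ## The program: preliminaries and distances -/

instance : Add Expr := ⟨.add⟩
instance : Sub Expr := ⟨.sub⟩
instance : Mul Expr := ⟨.mul⟩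
instance : Div Expr := ⟨.div⟩
instance (k : ℕ) : OfNat Expr k := ⟨.const k⟩

infixr:60 " ;; " => Cmd.seq

section Val

variable (s : State)

@[simp] theorem Expr.val_var (x : ℕ) : (Expr.var x).val s = s.vars x := rfl
@[simp] theorem Expr.val_const (k : ℕ) : (Expr.const k).val s = k := rfl
@[simp] theorem Expr.val_ofNat (k : ℕ) : (no_index (OfNat.ofNat k : Expr)).val s = k := rfl
@[simp] theorem Expr.val_zero : (0 : Expr).val s = 0 := rfl
@[simp] theorem Expr.val_one : (1 : Expr).val s = 1 := rfl
@[simp] theorem Expr.val_get (a : ℕ) (i j : Expr) :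
    (Expr.get a i j).val s = s.arrs a (i.val s) (j.val s) := rfl
@[simp] theorem Expr.val_add (e e' : Expr) : (e + e').val s = e.val s + e'.val s := rfl
@[simp] theorem Expr.val_sub (e e' : Expr) : (e - e').val s = e.val s - e'.val s := rfl
@[simp] theorem Expr.val_mul (e e' : Expr) : (e * e').val s = e.val s * e'.val s := rfl
@[simp] theorem Expr.val_div (e e' : Expr) : (e / e').val s = e.val s / e'.val s := rfl
@[simp] theorem Expr.val_lt (e e' : Expr) :
    (Expr.lt e e').val s = if e.val s < e'.val s then 1 else 0 := rfl
@[simp] theorem Expr.val_eq (e e' : Expr) :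
    (Expr.eq e e').val s = if e.val s = e'.val s then 1 else 0 := rfl

theorem Expr.val_lt_eq_zero {s : State} {e e' : Expr} :
    (Expr.lt e e').val s = 0 ↔ e'.val s ≤ e.val s := by
  simp [Expr.val_lt]

theorem Expr.val_lt_ne_zero {s : State} {e e' : Expr} :
    (Expr.lt e e').val s ≠ 0 ↔ e.val s < e'.val s := by
  simp [Expr.val_lt]

theorem Expr.val_eq_eq_zero {s : State} {e e' : Expr} :
    (Expr.eq e e').val s = 0 ↔ e.val s ≠ e'.val s := by
  simp [Expr.val_eq]

theorem Expr.val_eq_ne_zero {s : State} {e e' : Expr} :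
    (Expr.eq e e').val s ≠ 0 ↔ e.val s = e'.val s := by
  simp [Expr.val_eq]

end Val

/-! ### Program text for the parameters and the distance tables -/

/-- Computes the bit length of `n` in variable `2` and the number of scales in variable `3`. -/
def sizeProg (a : ℕ) : Cmd :=
  .assign 4 1 ;;
  .for 5 (.var 0)
    (.cond (.lt (.var 0) (.var 4)) .skip
      (.assign 4 (.var 4 + .var 4) ;; .assign 2 (.var 2 + 1))) ;;
  .assign 3 (.const a * .var 2 + 1)

/-- Stores the powers of two in row `0` of array `3`. -/
def powProg : Cmd :=
  .assign 4 1 ;;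
  .for 5 (.var 3 + 1) (.put 3 0 (.var 5) (.var 4) ;; .assign 4 (.var 4 + .var 4))

/-- The hop-weight of going from `10` to the given vertex at scale `8`. -/
def stepExpr (z : Expr) : Expr :=
  (1 - .eq (.var 10) z) * (.var 1 * .get 0 (.var 10) z + .get 3 0 (.var 8))

/-- The length of a path from `10` to `11` whose second vertex is `12`. -/
def candExpr : Expr :=
  stepExpr (.var 12) + .get 4 (.var 6 - 1) (.var 12 * .var 0 + .var 11)

/-- Finds the best second vertex. -/
def argminProg : Cmd :=
  .assign 13 (.get 4 (.var 6 - 1) (.var 7)) ;;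
  .assign 14 (.var 10) ;;
  .for 12 (.var 0)
    (.cond (.lt candExpr (.var 13)) (.assign 13 candExpr ;; .assign 14 (.var 12)) .skip)

/-- Computes one entry of the tables. -/
def entryProg : Cmd :=
  .cond (.var 9) argminProg (.assign 13 (stepExpr (.var 11)) ;; .assign 14 (.var 11)) ;;
  .put 4 (.var 6) (.var 7) (.var 13) ;;
  .put 5 (.var 6) (.var 7) (.var 14)

/-- Fills the tables of distances (array `4`) and of second vertices (array `5`). -/
def distProg : Cmd :=
  .for 5 ((.var 3 + 1) * .var 0 * (.var 0 * .var 0))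
    (.assign 6 (.var 5 / (.var 0 * .var 0)) ;;
     .assign 7 (.var 5 - .var 6 * (.var 0 * .var 0)) ;;
     .assign 8 (.var 6 / .var 0) ;;
     .assign 9 (.var 6 - .var 8 * .var 0) ;;
     .assign 10 (.var 7 / .var 0) ;;
     .assign 11 (.var 7 - .var 10 * .var 0) ;;
     entryProg)

/-- Variable `4` is doubled until it exceeds `n`; its exponent is then the bit length. As long as it
has not exceeded `n`, every iteration has doubled it. -/
theorem reach_sizeProg {Y a n : ℕ} {s : State} (h0 : s.vars 0 = n) (h2 : s.vars 2 = 0)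
    (hn : n ≤ Y) (hnY : 2 * n + 1 < 2 ^ Y) (ha : a * Nat.size n + 1 < 2 ^ Y) :
    Reach Y (sizeProg a) s fun s' =>
      s'.vars 2 = Nat.size n ∧ s'.vars 3 = a * Nat.size n + 1 := by
  refine reach_seq (reach_assign (by rw [Expr.val_one]; omega) ?_)
  refine reach_seq (reach_for n (fun i s' => ∃ b ≤ i, s'.vars 4 = 2 ^ b ∧ s'.vars 2 = b ∧
    (∀ b' < b, 2 ^ b' ≤ n) ∧ (2 ^ b ≤ n → b = i)) hn (by decide) ?_ ?_ ?_ ?_)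
  · intro s' hF
    simp [hF.vars 0 (by decide), h0]
  · exact ⟨0, le_rfl, by simp, by simp [h2], by simp, fun _ => rfl⟩
  · rintro i hi s' hF - hi' ⟨b, hb, h4, h2', hlow, hup⟩
    have h0' : s'.vars 0 = n := by simp [hF.vars 0 (by decide), h0]
    refine reach_cond (fun hlt => reach_skip ?_) fun hlt => ?_
    · have hlt' : n < 2 ^ b := by
        by_contra hcon; exact hlt (by simp [h0', h4, hcon])
      exact ⟨b, by omega, by simpa using h4, by simpa using h2', hlow, fun h => by omega⟩
    · have hlt' : 2 ^ b ≤ n := by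
        by_contra hcon; simp [h0', h4, not_le.1 hcon] at hlt
      refine reach_seq (reach_assign ?_ (reach_assign ?_ ?_))
      · simp only [Expr.val_add, Expr.val_var, h4]; omega
      · simp only [Expr.val_add, Expr.val_var, Expr.val_one, State.vars_setVar, h2']
        norm_num
        omega
      · refine ⟨b + 1, by omega, ?_, ?_, fun b' hb' => ?_, fun _ => by rw [hup hlt']⟩
        · simp [h4, pow_succ, mul_two]
        · simp [h2']
        · rcases Nat.lt_succ_iff_lt_or_eq.1 hb' with hb' | rfl
          exacts [hlow b' hb', hlt']
  · rintro s' hF ⟨b, hb, h4, h2', hlow, hup⟩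
    -- Otherwise all `n` iterations doubled, and `2 ^ n ≤ n`.
    have hlt : n < 2 ^ b := by
      by_contra! hcon
      have := hup hcon
      subst this
      exact absurd hcon (not_le.2 Nat.lt_two_pow_self)
    have hsize : Nat.size n = b := by
      refine le_antisymm (Nat.size_le.2 hlt) ?_
      rcases Nat.eq_zero_or_pos b with rfl | hpos
      · exact Nat.zero_le _
      · have := Nat.lt_size.2 (hlow (b - 1) (by omega))
        omega
    rw [hsize] at ha ⊢
    exact reach_assign (by simpa [h2'] using ha) (by simp [h2'])

theorem reach_powProg {Y K : ℕ} {s : State} (h3 : s.vars 3 = K) (hKY : K + 1 ≤ Y)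
    (hK : 2 ^ (K + 1) < 2 ^ Y) :
    Reach Y powProg s fun s' => ∀ j ≤ K, s'.arrs 3 0 j = 2 ^ j := by
  refine reach_seq (reach_assign (by
    simpa using lt_of_le_of_lt (Nat.one_le_two_pow (n := K + 1)) hK) ?_)
  refine reach_for (K + 1) (fun i s' => s'.vars 4 = 2 ^ i ∧ ∀ j < i, s'.arrs 3 0 j = 2 ^ j) hKY
    (by decide) ?_ ?_ ?_ ?_
  · intro s' hF
    simp [hF.vars 3 (by decide), h3]
  · simp
  · rintro i hi s' hF - hi' ⟨h4, hI⟩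
    have hle : 2 ^ (i + 1) < 2 ^ Y :=
      lt_of_le_of_lt (Nat.pow_le_pow_right (by norm_num) (by omega)) hK
    rw [pow_succ] at hle
    refine reach_seq (reach_put (by simp only [Expr.val_var, h4]; omega) (reach_assign ?_ ⟨?_, ?_⟩))
    · simp only [Expr.val_add, Expr.val_var, State.vars_setArr, h4]; omega
    · simp [h4, pow_succ, mul_two]
    · intro j hj
      simp only [State.arrs_setVar, State.arrs_setArr_self, Expr.val_var, Expr.val_zero, hi', h4,
        true_and]
      split_ifs with h
      · rw [h]
      · exact hI j (by omega)
  · exact fun s' _ hI j hj => hI.2 j (by omega)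

/-! ### Verification of the distance tables -/

/-- The parameters of an execution, and what bounds their sizes: `n` vertices, hop bound `h`,
`β` classes, `K` scales, weights `w`, and numbers of at most `Y` bits. -/
structure Params where
  n : ℕ
  h : ℕ
  β : ℕ
  K : ℕ
  Y : ℕ
  w : ℕ → ℕ → ℕ
  n_pos : 1 ≤ n
  h_pos : 1 ≤ h
  K_pos : 1 ≤ K
  lt_pow : n < 2 ^ β
  w_le : ∀ x y, w x y ≤ 2 ^ K
  size_table : (K + 1) * n * (n * n) ≤ Y
  size_path : 2 * K * n ≤ Y
  size_cls : β ≤ Y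
  size_scale : 8 * h * 2 ^ K + 2 ^ (K + 1) < 2 ^ Y

namespace Params

variable (P : Params)

/-- The largest entry of the distance table. -/
def top : ℕ := P.h * 2 ^ P.K + 2 ^ P.K

theorem top_lt : P.top < 2 ^ P.Y := by
  refine lt_of_le_of_lt ?_ P.size_scale
  have : 1 * (P.h * 2 ^ P.K) ≤ 8 * (P.h * 2 ^ P.K) := Nat.mul_le_mul_right _ (by norm_num)
  rw [top, pow_succ, mul_assoc]
  omega

theorem lt_of_le {x : ℕ} (h : x ≤ P.Y) : x < 2 ^ P.Y := lt_of_le_of_lt h Nat.lt_two_pow_self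

theorem table_le {x : ℕ} (h : x ≤ P.n * P.n) : x ≤ P.Y := by
  refine h.trans (le_trans ?_ P.size_table)
  have := P.n_pos
  exact Nat.le_mul_of_pos_left _ (Nat.mul_pos (Nat.succ_pos _) this)

theorem n_le {x : ℕ} (h : x ≤ P.n) : x ≤ P.Y :=
  P.table_le (h.trans (Nat.le_mul_of_pos_left _ P.n_pos))

theorem K_le {x : ℕ} (h : x ≤ P.K + 1) : x ≤ P.Y := by
  refine h.trans (le_trans ?_ P.size_table)
  have := P.n_pos
  rw [mul_assoc]
  exact Nat.le_mul_of_pos_right _ (by positivity)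

/-- The hop-weights. -/
def W (j x y : ℕ) : ℕ := if x = y then 0 else P.h * P.w x y + 2 ^ j

theorem W_le {j : ℕ} (hj : j ≤ P.K) (x y : ℕ) : P.W j x y ≤ P.top := by
  unfold W top
  split_ifs
  · exact Nat.zero_le _
  · exact Nat.add_le_add (Nat.mul_le_mul_left _ (P.w_le x y))
      (Nat.pow_le_pow_right (by norm_num) hj)

/-- The memory holds the parameters. -/
structure Env (s : State) : Prop where
  n_eq : s.vars 0 = P.n
  h_eq : s.vars 1 = P.h
  β_eq : s.vars 2 = P.β
  K_eq : s.vars 3 = P.K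
  w_eq : s.arrs 0 = P.w
  pow_eq : ∀ j ≤ P.K, s.arrs 3 0 j = 2 ^ j

variable {P}

theorem Env.frame {c : Cmd} {s s' : State} (hE : P.Env s) (hF : Frame c s s')
    (hc : (∀ x < 4, x ∉ c.modVars) ∧ 0 ∉ c.modArrs ∧ 3 ∉ c.modArrs) : P.Env s' where
  n_eq := (hF.vars 0 (hc.1 0 (by norm_num))).trans hE.n_eq
  h_eq := (hF.vars 1 (hc.1 1 (by norm_num))).trans hE.h_eq
  β_eq := (hF.vars 2 (hc.1 2 (by norm_num))).trans hE.β_eq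
  K_eq := (hF.vars 3 (hc.1 3 (by norm_num))).trans hE.K_eq
  w_eq := (hF.arrs 0 hc.2.1).trans hE.w_eq
  pow_eq j hj := by rw [hF.arrs 3 hc.2.2]; exact hE.pow_eq j hj

theorem Env.setVar {s : State} (hE : P.Env s) {x : ℕ} (v : ℕ) (hx : 4 ≤ x) :
    P.Env (s.setVar x v) :=
  hE.frame (c := .assign x 0) (.setVar _ _ _ (by simp [Cmd.modVars]))
    ⟨fun y hy => by simp only [Cmd.modVars, List.mem_singleton]; omega, by simp [Cmd.modArrs]⟩

/-- The entry of the tables at row `r = j * n + m` and column `q = x * n + y` is right. -/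
structure TableEntry (P : Params) (T N : ℕ → ℕ → ℕ) (r q : ℕ) : Prop where
  next_lt : N r q < P.n
  le_top : T r q ≤ P.top
  zero : r % P.n = 0 → T r q = P.W (r / P.n) (q / P.n) (q % P.n) ∧ N r q = q % P.n
  succ : r % P.n ≠ 0 → T r q = P.W (r / P.n) (q / P.n) (N r q) +
    T (r - 1) (N r q * P.n + q % P.n) ∧
    ∀ z < P.n, T r q ≤ P.W (r / P.n) (q / P.n) z + T (r - 1) (z * P.n + q % P.n)

theorem val_stepExpr {s : State} (hE : P.Env s) {z : Expr} (hj : s.vars 8 ≤ P.K) :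
    (stepExpr z).val s = P.W (s.vars 8) (s.vars 10) (z.val s) := by
  unfold stepExpr W
  by_cases h : s.vars 10 = z.val s
  · simp [h]
  · simp [h, hE.h_eq, hE.w_eq, hE.pow_eq _ hj]

theorem val_candExpr {s : State} (hE : P.Env s) (hj : s.vars 8 ≤ P.K) :
    candExpr.val s = P.W (s.vars 8) (s.vars 10) (s.vars 12) +
      s.arrs 4 (s.vars 6 - 1) (s.vars 12 * P.n + s.vars 11) := by
  unfold candExpr
  rw [Expr.val_add, val_stepExpr hE hj]
  simp [hE.n_eq]

/-- The search starts with the option of staying at the first vertex, whose value is the entry of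
the previous row. Hence entries never grow with the number of hops and stay below `top`. -/
theorem reach_argminProg {s : State} (hE : P.Env s) (hj : s.vars 8 ≤ P.K) (hx : s.vars 10 < P.n)
    (hq : s.vars 7 = s.vars 10 * P.n + s.vars 11)
    (htop : s.arrs 4 (s.vars 6 - 1) (s.vars 7) ≤ P.top) :
    Reach P.Y argminProg s fun s' => s'.vars 14 < P.n ∧ s'.vars 13 ≤ P.top ∧
      s'.vars 13 = P.W (s.vars 8) (s.vars 10) (s'.vars 14) +
        s.arrs 4 (s.vars 6 - 1) (s'.vars 14 * P.n + s.vars 11) ∧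
      ∀ z < P.n, s'.vars 13 ≤ P.W (s.vars 8) (s.vars 10) z +
        s.arrs 4 (s.vars 6 - 1) (z * P.n + s.vars 11) := by
  unfold argminProg
  refine reach_seq (reach_assign (by simpa using lt_of_le_of_lt htop P.top_lt) ?_)
  refine reach_seq (reach_assign (by simpa using P.lt_of_le (P.n_le hx.le)) ?_)
  refine reach_for P.n (fun z s' => s'.vars 14 < P.n ∧ s'.vars 13 ≤ P.top ∧
      s'.vars 13 = P.W (s.vars 8) (s.vars 10) (s'.vars 14) +
        s.arrs 4 (s.vars 6 - 1) (s'.vars 14 * P.n + s.vars 11) ∧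
      ∀ z' < z, s'.vars 13 ≤ P.W (s.vars 8) (s.vars 10) z' +
        s.arrs 4 (s.vars 6 - 1) (z' * P.n + s.vars 11)) (P.n_le le_rfl) (by decide) ?_ ?_ ?_ ?_
  · intro s' hF
    simp [hF.vars 0 (by decide), hE.n_eq]
  · simp [hx, htop, W, ← hq]
  · intro z hz s' hF _ hz' hI
    have hE' : P.Env s' := ((hE.setVar _ (by norm_num)).setVar _ (by norm_num)).frame hF (by decide)
    have h6 : s'.vars 6 = s.vars 6 := by simp [hF.vars 6 (by decide)]
    have h8 : s'.vars 8 = s.vars 8 := by simp [hF.vars 8 (by decide)]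
    have h10 : s'.vars 10 = s.vars 10 := by simp [hF.vars 10 (by decide)]
    have h11 : s'.vars 11 = s.vars 11 := by simp [hF.vars 11 (by decide)]
    have h4 : s'.arrs 4 = s.arrs 4 := by simp [hF.arrs 4 (by decide)]
    have hc := val_candExpr hE' (by rw [h8]; exact hj)
    rw [h6, h8, h10, h11, h4, hz'] at hc
    obtain ⟨hI1, hI2, hI3, hI4⟩ := hI
    refine reach_cond (fun hlt => ?_) fun hlt => reach_skip ?_
    · have hlt' : candExpr.val s' < s'.vars 13 := by
        by_contra hcon; exact hlt (by simp [hcon])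
      refine reach_seq (reach_assign (lt_of_le_of_lt (hlt'.le.trans hI2) P.top_lt) ?_)
      refine reach_assign (by simpa [hz'] using P.lt_of_le (P.n_le hz.le)) ?_
      simp only [Expr.val_var, State.vars_setVar, hz']
      norm_num
      refine ⟨hz, hlt'.le.trans hI2, hc, fun z' hz'' => ?_⟩
      rcases Nat.lt_or_eq_of_le hz'' with hz'' | rfl
      · exact hlt'.le.trans (hI4 z' hz'')
      · exact hc.le
    · have hlt' : s'.vars 13 ≤ candExpr.val s' := by
        by_contra hcon; simp [not_le.1 hcon] at hlt
      simp only [State.vars_setVar]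
      norm_num
      refine ⟨hI1, hI2, hI3, fun z' hz'' => ?_⟩
      rcases Nat.lt_or_eq_of_le hz'' with hz'' | rfl
      · exact hI4 z' hz''
      · exact hlt'.trans hc.le
  · intro s' _ hI
    exact hI

/-- An entry only refers to itself and to the row before it, so writing elsewhere does not spoil it.
-/
theorem TableEntry.congr {T N T' N' : ℕ → ℕ → ℕ} {r q : ℕ} (h : P.TableEntry T N r q)
    (hT : T' r q = T r q) (hN : N' r q = N r q)
    (hprev : r % P.n ≠ 0 → ∀ c, T' (r - 1) c = T (r - 1) c) : P.TableEntry T' N' r q where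
  next_lt := hN ▸ h.next_lt
  le_top := hT ▸ h.le_top
  zero := by rw [hT, hN]; exact h.zero
  succ hm := by
    rw [hT, hN]
    simp only [hprev hm]
    exact h.succ hm

theorem reach_entryProg {s : State} (hE : P.Env s) {r q : ℕ} (hq : q < P.n * P.n)
    (hj : r / P.n ≤ P.K) (h6 : s.vars 6 = r) (h7 : s.vars 7 = q) (h8 : s.vars 8 = r / P.n)
    (h9 : s.vars 9 = r % P.n) (h10 : s.vars 10 = q / P.n) (h11 : s.vars 11 = q % P.n)
    (htop : r % P.n ≠ 0 → s.arrs 4 (r - 1) q ≤ P.top) :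
    Reach P.Y entryProg s fun s' => P.TableEntry (s'.arrs 4) (s'.arrs 5) r q ∧
      ∀ r' q', ¬ (r' = r ∧ q' = q) → s'.arrs 4 r' q' = s.arrs 4 r' q' ∧
        s'.arrs 5 r' q' = s.arrs 5 r' q' := by
  have hn := P.n_pos
  have hxn : q / P.n < P.n := Nat.div_lt_of_lt_mul hq
  have hyn : q % P.n < P.n := Nat.mod_lt _ hn
  have hdm : q / P.n * P.n + q % P.n = q := Nat.div_add_mod' _ _
  refine reach_seq ((reach_cond (Q := fun s' => s'.vars 14 < P.n ∧ s'.vars 13 ≤ P.top ∧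
    (r % P.n = 0 → s'.vars 13 = P.W (r / P.n) (q / P.n) (q % P.n) ∧ s'.vars 14 = q % P.n) ∧
    (r % P.n ≠ 0 → s'.vars 13 = P.W (r / P.n) (q / P.n) (s'.vars 14) +
      s.arrs 4 (r - 1) (s'.vars 14 * P.n + q % P.n) ∧
      ∀ z < P.n, s'.vars 13 ≤ P.W (r / P.n) (q / P.n) z +
        s.arrs 4 (r - 1) (z * P.n + q % P.n))) (fun hm => ?_) fun hm => ?_).mono ?_)
  · rw [Expr.val_var, h9] at hm
    refine (reach_argminProg hE (h8 ▸ hj) (h10 ▸ hxn) (by rw [h7, h10, h11, hdm])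
      (by rw [h6, h7]; exact htop hm)).mono fun s' _ _ hs => ?_
    rw [h6, h8, h10, h11] at hs
    exact ⟨hs.1, hs.2.1, fun h => absurd h hm, fun _ => hs.2.2⟩
  · rw [Expr.val_var, h9] at hm
    have hv := val_stepExpr hE (z := .var 11) (h8 ▸ hj)
    rw [Expr.val_var, h8, h10, h11] at hv
    have hW := P.W_le hj (q / P.n) (q % P.n)
    refine reach_seq (reach_assign (by rw [hv]; exact lt_of_le_of_lt hW P.top_lt) ?_)
    refine reach_assign (by simpa [h11] using P.lt_of_le (P.n_le hyn.le)) ?_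
    simp [hv, h11, hm, hyn, hW]
  · intro s₁ _ hF ⟨hI1, hI2, hI3, hI4⟩
    have g6 : s₁.vars 6 = r := (hF.vars 6 (by decide)).trans h6
    have g7 : s₁.vars 7 = q := (hF.vars 7 (by decide)).trans h7
    have g4 : s₁.arrs 4 = s.arrs 4 := hF.arrs 4 (by decide)
    have g5 : s₁.arrs 5 = s.arrs 5 := hF.arrs 5 (by decide)
    refine reach_seq (reach_put (lt_of_le_of_lt hI2 P.top_lt) ?_)
    refine reach_put (P.lt_of_le (P.n_le hI1.le)) ?_
    have a4 : ∀ r' q', ((s₁.setArr 4 r q (s₁.vars 13)).setArr 5 r q (s₁.vars 14)).arrs 4 r' q' =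
        if r' = r ∧ q' = q then s₁.vars 13 else s.arrs 4 r' q' := fun r' q' => by
      rw [State.arrs_setArr_of_ne (by norm_num), State.arrs_setArr_self, g4]
    have a5 : ∀ r' q', ((s₁.setArr 4 r q (s₁.vars 13)).setArr 5 r q (s₁.vars 14)).arrs 5 r' q' =
        if r' = r ∧ q' = q then s₁.vars 14 else s.arrs 5 r' q' := fun r' q' => by
      rw [State.arrs_setArr_self, State.arrs_setArr_of_ne (by norm_num), g5]
    simp only [Expr.val_var, State.vars_setArr, g6, g7]
    refine ⟨⟨?_, ?_, ?_, fun hm => ?_⟩, fun r' q' hne => ?_⟩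
    · simpa [a5] using hI1
    · simpa [a4] using hI2
    · simpa [a4, a5] using hI3
    -- The subtraction is not truncated here, so the write to row `r` leaves the row that the
    -- recursion refers to intact.
    · have hr : r - 1 ≠ r := by
        have : r ≠ 0 := fun h0 => hm (by simp [h0])
        omega
      simpa [a4, a5, hr] using hI4 hm
    · rw [a4, a5, if_neg hne, if_neg hne]; exact ⟨rfl, rfl⟩

/-- The tables are right. -/
def Tables (P : Params) (s : State) : Prop :=
  ∀ r < (P.K + 1) * P.n, ∀ q < P.n * P.n, P.TableEntry (s.arrs 4) (s.arrs 5) r q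

/-- A single loop runs through the pairs of row and column in lexicographic order, so the previous
row is complete when a row is computed. A row encodes scale and number of hops, a column the two
vertices. -/
theorem reach_distProg {s : State} (hE : P.Env s) : Reach P.Y distProg s P.Tables := by
  have hn := P.n_pos
  have hnn : 0 < P.n * P.n := Nat.mul_pos hn hn
  refine reach_for ((P.K + 1) * P.n * (P.n * P.n)) (fun idx s' => ∀ r q, q < P.n * P.n →
    r * (P.n * P.n) + q < idx → P.TableEntry (s'.arrs 4) (s'.arrs 5) r q) P.size_table
    (by decide) ?_ ?_ ?_ ?_
  · intro s' hF
    have hE' := hE.frame hF (by decide)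
    simp [hE'.n_eq, hE'.K_eq]
  · intro r q _ h; omega
  · intro idx hidx s' hF _ hidx' hI
    have hE' := hE.frame hF (by decide)
    have hY : ∀ {x}, x ≤ idx → x < 2 ^ P.Y := fun hx =>
      P.lt_of_le (hx.trans (hidx.le.trans P.size_table))
    obtain ⟨r, q, hq, rfl⟩ : ∃ r q, q < P.n * P.n ∧ idx = r * (P.n * P.n) + q :=
      ⟨idx / (P.n * P.n), idx % (P.n * P.n), Nat.mod_lt _ hnn, (Nat.div_add_mod' _ _).symm⟩
    have hr : r < (P.K + 1) * P.n := by
      by_contra! hcon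
      have := Nat.mul_le_mul_right (P.n * P.n) hcon
      omega
    have hdiv : (r * (P.n * P.n) + q) / (P.n * P.n) = r := by
      rw [mul_comm r, Nat.mul_add_div hnn, Nat.div_eq_of_lt hq, add_zero]
    have hjK : r / P.n ≤ P.K := Nat.lt_succ_iff.1 (Nat.div_lt_of_lt_mul (by rwa [mul_comm]))
    have hxn : q / P.n < P.n := Nat.div_lt_of_lt_mul hq
    have hrle : r ≤ r * (P.n * P.n) + q := le_trans (Nat.le_mul_of_pos_right _ hnn)
      (Nat.le_add_right _ _)
    have e7 : r * (P.n * P.n) + q - r * (P.n * P.n) = q := by omega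
    have e9 : r - r / P.n * P.n = r % P.n := by
      have := Nat.div_add_mod' r P.n; omega
    have e11 : q - q / P.n * P.n = q % P.n := by
      have := Nat.div_add_mod' q P.n; omega
    refine reach_seq (reach_assign (hY ?_) ?_)
    · simp only [Expr.val_div, Expr.val_var, hidx']; exact Nat.div_le_self _ _
    refine reach_seq (reach_assign (hY ?_) ?_)
    · simp [hidx']
    refine reach_seq (reach_assign (hY ?_) ?_)
    · simp [hidx', hE'.n_eq, hdiv]; exact (Nat.div_le_self _ _).trans hrle
    refine reach_seq (reach_assign (hY ?_) ?_)
    · simp [hidx', hE'.n_eq, hdiv]; omega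
    refine reach_seq (reach_assign (hY ?_) ?_)
    · simp [hidx', hE'.n_eq, hdiv, e7]; exact (Nat.div_le_self _ _).trans (Nat.le_add_left _ _)
    refine reach_seq (reach_assign (hY ?_) ?_)
    · simp [hidx', hE'.n_eq, hdiv, e7]; omega
    simp only [Expr.val_div, Expr.val_mul, Expr.val_sub, Expr.val_var, State.vars_setVar, hidx',
      hE'.n_eq]
    norm_num [hdiv, e7, e9, e11]
    refine (reach_entryProg (r := r) (q := q) ?_ hq hjK (by simp) (by simp) (by simp) (by simp)
      (by simp) (by simp) fun hm => ?_).mono fun s₂ _ _ hI' r' q' hq' hlt => ?_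
    · exact (((((hE'.setVar _ (by norm_num)).setVar _ (by norm_num)).setVar _
        (by norm_num)).setVar _ (by norm_num)).setVar _ (by norm_num)).setVar _ (by norm_num)
    · refine (hI (r - 1) q hq ?_).le_top
      have : 1 ≤ r := Nat.pos_of_ne_zero fun h0 => hm (by simp [h0])
      have := Nat.mul_lt_mul_of_pos_right (show r - 1 < r by omega) hnn
      omega
    · have hr' : r' ≤ r := by
        by_contra! hcon
        have := Nat.mul_le_mul_right (P.n * P.n) (Nat.succ_le_of_lt hcon)
        rw [Nat.succ_mul] at this
        omega
      by_cases hrq : r' = r ∧ q' = q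
      · rw [hrq.1, hrq.2]; exact hI'.1
      · have hlt' : r' * (P.n * P.n) + q' < r * (P.n * P.n) + q := by
          rcases Nat.lt_or_eq_of_le hr' with hr' | rfl
          · have := Nat.mul_le_mul_right (P.n * P.n) (Nat.succ_le_of_lt hr')
            rw [Nat.succ_mul] at this
            omega
          · omega
        refine (hI r' q' hq' hlt').congr (hI'.2 r' q' hrq).1 (hI'.2 r' q' hrq).2 fun hm c => ?_
        have : 1 ≤ r' := Nat.pos_of_ne_zero fun h0 => hm (by simp [h0])
        exact (hI'.2 (r' - 1) c (by omega)).1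
  · intro s' _ hI r hr q hq
    refine hI r q hq ?_
    have := Nat.mul_le_mul_right (P.n * P.n) (Nat.succ_le_of_lt hr)
    rw [Nat.succ_mul] at this
    omega

end Params

end HopND

namespace HopND

/-! ## Ball carving -/

/-- The vertices that are neither assigned nor removed, at distance at most `r` from `v`. -/
def freeBall (n : ℕ) (D : ℕ → ℕ → ℕ) (asg rem : ℕ → ℕ) (v r : ℕ) : Finset ℕ :=
  (Finset.range n).filter fun x => (asg x = 0 ∧ rem x = 0) ∧ D v x ≤ r

/-- `D` is a pseudometric on the first `n` natural numbers. -/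
structure IsMetric (n : ℕ) (D : ℕ → ℕ → ℕ) : Prop where
  self : ∀ x < n, D x x = 0
  comm : ∀ x < n, ∀ y < n, D x y = D y x
  triangle : ∀ x < n, ∀ y < n, ∀ z < n, D x z ≤ D x y + D y z

/-- The state of the carving during class `b`: `asg` and `rem` mark assigned and removed vertices,
`c` and `cl` are the centers and classes of assigned vertices. -/
structure CarveInv (n β ρ b : ℕ) (D : ℕ → ℕ → ℕ) (asg rem c cl : ℕ → ℕ) : Prop where
  center_lt : ∀ x < n, asg x ≠ 0 → c x < n
  cls_le : ∀ x < n, asg x ≠ 0 → cl x ≤ b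
  dist_le : ∀ x < n, asg x ≠ 0 → D x (c x) ≤ ρ * β
  far : ∀ x < n, ∀ y < n, asg x ≠ 0 → asg y ≠ 0 → cl x = cl y → c x ≠ c y → ρ < D x y
  free_far : ∀ x < n, ∀ y < n, asg x ≠ 0 → cl x = b → asg y = 0 → rem y = 0 → ρ < D x y
  removed_le : ((Finset.range n).filter fun x => asg x = 0 ∧ rem x ≠ 0).card ≤
    ((Finset.range n).filter fun x => asg x ≠ 0 ∧ cl x = b).card
  total : 2 ^ b * ((Finset.range n).filter fun x => asg x = 0 ∨ cl x = b).card ≤ n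

/-- The result of carving the ball with center `v` and radius `t * ρ`. -/
def CarveStep (n ρ b v t : ℕ) (D : ℕ → ℕ → ℕ) (asg rem c cl asg' rem' c' cl' : ℕ → ℕ) : Prop :=
  ∀ x < n,
    (asg x = 0 ∧ rem x = 0 ∧ D v x ≤ t * ρ ∧ asg' x = 1 ∧ rem' x = 0 ∧ c' x = v ∧ cl' x = b) ∨
    (asg x = 0 ∧ rem x = 0 ∧ t * ρ < D v x ∧ D v x ≤ (t + 1) * ρ ∧ asg' x = 0 ∧ rem' x = 1) ∨
    ((asg x ≠ 0 ∨ rem x ≠ 0 ∨ (t + 1) * ρ < D v x) ∧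
      asg' x = asg x ∧ rem' x = rem x ∧ c' x = c x ∧ cl' x = cl x)

section Carve

variable {n β ρ b v t : ℕ} {D : ℕ → ℕ → ℕ} {asg rem c cl asg' rem' c' cl' : ℕ → ℕ}

/-- The shell between the radii `t * ρ` and `(t + 1) * ρ` is removed. By the triangle inequality,
what stays free is therefore more than `ρ` away from the new ball, and a later ball of this class is
far from all earlier ones. The choice of `t` makes the shell no larger than the ball, which
preserves `removed_le`. The set in `total` consists of candidates at the start of the class and
cannot grow. -/
theorem CarveInv.step (hI : CarveInv n β ρ b D asg rem c cl)
    (hD : IsMetric n D) (hv : v < n) (ht : t < β)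
    (hcard : (freeBall n D asg rem v ((t + 1) * ρ)).card ≤
      2 * (freeBall n D asg rem v (t * ρ)).card)
    (h : CarveStep n ρ b v t D asg rem c cl asg' rem' c' cl') :
    CarveInv n β ρ b D asg' rem' c' cl' := by
  refine ⟨?_, ?_, ?_, ?_, ?_, ?_, ?_⟩
  · intro x hx ha
    rcases h x hx with h | h | ⟨-, h1, h2, h3, h4⟩
    · omega
    · omega
    · rw [h3]; exact hI.center_lt x hx (h1 ▸ ha)
  · intro x hx ha
    rcases h x hx with h | h | ⟨-, h1, h2, h3, h4⟩
    · omega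
    · omega
    · rw [h4]; exact hI.cls_le x hx (h1 ▸ ha)
  · intro x hx ha
    rcases h x hx with h | h | ⟨-, h1, h2, h3, h4⟩
    · rw [h.2.2.2.2.2.1, hD.comm x hx v hv]
      refine h.2.2.1.trans ?_
      rw [mul_comm]
      exact Nat.mul_le_mul_left _ ht.le
    · omega
    · rw [h3]; exact hI.dist_le x hx (h1 ▸ ha)
  · intro x hx y hy hax hay hcl hc
    rcases h x hx with h1 | h1 | ⟨-, h1⟩ <;> rcases h y hy with h2 | h2 | ⟨-, h2⟩
    · omega
    · omega
    · rw [hD.comm x hx y hy]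
      exact hI.free_far y hy x hx (by omega) (by omega) (by omega) (by omega)
    · omega
    · omega
    · omega
    · exact hI.free_far x hx y hy (by omega) (by omega) (by omega) (by omega)
    · omega
    · exact hI.far x hx y hy (by omega) (by omega) (by omega) (by omega)
  · intro x hx y hy hax hcl hay hry
    rcases h y hy with h2 | h2 | ⟨h2', h2⟩
    · omega
    · omega
    · rcases h x hx with h1 | h1 | ⟨-, h1⟩
      · have := hD.triangle v hv x hx y hy
        have h3 : (t + 1) * ρ < D v y := by omega
        rw [add_mul, one_mul] at h3
        omega
      · omega
      · exact hI.free_far x hx y hy (by omega) (by omega) (by omega) (by omega)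
  · have hsub : freeBall n D asg rem v (t * ρ) ⊆ freeBall n D asg rem v ((t + 1) * ρ) := by
      intro x hx
      simp only [freeBall, Finset.mem_filter] at hx ⊢
      exact ⟨hx.1, hx.2.1, hx.2.2.trans (Nat.mul_le_mul_right _ (Nat.le_succ t))⟩
    have h1 : ((Finset.range n).filter fun x => asg' x = 0 ∧ rem' x ≠ 0).card ≤
        ((Finset.range n).filter fun x => asg x = 0 ∧ rem x ≠ 0).card +
          (freeBall n D asg rem v ((t + 1) * ρ) \ freeBall n D asg rem v (t * ρ)).card := by
      refine (Finset.card_le_card fun x hx => ?_).trans (Finset.card_union_le _ _)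
      simp only [Finset.mem_filter, Finset.mem_range, Finset.mem_union, Finset.mem_sdiff,
        freeBall] at hx ⊢
      rcases h x hx.1 with h1 | h1 | ⟨-, h1⟩
      · omega
      · right; omega
      · left; omega
    have h2 : ((Finset.range n).filter fun x => asg x ≠ 0 ∧ cl x = b).card +
        (freeBall n D asg rem v (t * ρ)).card ≤
        ((Finset.range n).filter fun x => asg' x ≠ 0 ∧ cl' x = b).card := by
      rw [← Finset.card_union_of_disjoint]
      · refine Finset.card_le_card fun x hx => ?_
        simp only [Finset.mem_filter, Finset.mem_range, Finset.mem_union, freeBall] at hx ⊢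
        have hmono : t * ρ ≤ (t + 1) * ρ := Nat.mul_le_mul_right _ (Nat.le_succ t)
        rcases h x (by omega) with h1 | h1 | h1 <;> omega
      · rw [Finset.disjoint_left]
        intro x hx hx'
        simp only [Finset.mem_filter, freeBall] at hx hx'
        omega
    -- The shell has at most as many free vertices as the ball, by `hcard`.
    rw [Finset.card_sdiff_of_subset hsub] at h1
    have := hI.removed_le
    omega
  · refine le_trans (Nat.mul_le_mul_left _ (Finset.card_le_card fun x hx => ?_)) hI.total
    simp only [Finset.mem_filter, Finset.mem_range] at hx ⊢
    rcases h x hx.1 with h1 | h1 | ⟨-, h1⟩ <;> omega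

theorem CarveStep.free_center (h : CarveStep n ρ b v t D asg rem c cl asg' rem' c' cl')
    (hD : IsMetric n D) (hv : v < n) : asg' v ≠ 0 ∨ rem' v ≠ 0 := by
  have := hD.self v hv
  rcases h v hv with h1 | h1 | h1 <;> omega

theorem CarveStep.free_of_free (h : CarveStep n ρ b v t D asg rem c cl asg' rem' c' cl') {x : ℕ}
    (hx : x < n) (hx' : asg x ≠ 0 ∨ rem x ≠ 0) : asg' x ≠ 0 ∨ rem' x ≠ 0 := by
  rcases h x hx with h | h | ⟨-, h⟩ <;> omega

/-- Some radius is good: otherwise, the balls would grow too much. -/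
theorem exists_radius (hβ : n < 2 ^ β) (hD : IsMetric n D) (hv : v < n)
    (ha : asg v = 0) (hr : rem v = 0) : ∃ t < β, (freeBall n D asg rem v ((t + 1) * ρ)).card ≤
      2 * (freeBall n D asg rem v (t * ρ)).card := by
  by_contra! hcon
  have hgrow : ∀ t ≤ β, 2 ^ t ≤ (freeBall n D asg rem v (t * ρ)).card := by
    intro t
    induction t with
    | zero =>
      intro _
      refine Finset.card_pos.2 ⟨v, ?_⟩
      simp [freeBall, hv, ha, hr, hD.self v hv]
    | succ t ih =>
      intro ht
      have h1 := hcon t (by omega)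
      have h2 := ih (by omega)
      rw [pow_succ]
      omega
  have h1 := hgrow β le_rfl
  have h2 : (freeBall n D asg rem v (β * ρ)).card ≤ n := by
    simpa [freeBall] using Finset.card_filter_le (Finset.range n) _
  omega

theorem CarveInv.start (hasg : ∀ x < n, asg x = 0) (hrem : ∀ x < n, rem x = 0) :
    CarveInv n β ρ 0 D asg rem c cl := by
  refine ⟨?_, ?_, ?_, ?_, ?_, ?_, ?_⟩
  · exact fun x hx h => absurd (hasg x hx) h
  · exact fun x hx h => absurd (hasg x hx) h
  · exact fun x hx h => absurd (hasg x hx) h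
  · exact fun x hx _ _ h => absurd (hasg x hx) h
  · exact fun x hx _ _ h => absurd (hasg x hx) h
  · rw [Finset.filter_false_of_mem]
    · simp
    · intro x hx h; exact h.2 (hrem x (Finset.mem_range.1 hx))
  · simpa using Finset.card_filter_le (Finset.range n) _

/-- When nothing is free any more, the unassigned vertices are the removed ones. They are no more
than the vertices assigned in this class, and both sets are disjoint parts of the candidates, so the
candidates for the next class are at most half as many. This makes up for the additional factor `2`
in `total`. -/
theorem CarveInv.next_class (hI : CarveInv n β ρ b D asg rem c cl)
    (hdone : ∀ x < n, asg x ≠ 0 ∨ rem x ≠ 0) (hrem : ∀ x < n, rem' x = 0) :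
    CarveInv n β ρ (b + 1) D asg rem' c cl := by
  refine ⟨hI.center_lt, fun x hx h => (hI.cls_le x hx h).trans (Nat.le_succ b), hI.dist_le, hI.far,
    ?_, ?_, ?_⟩
  · intro x hx y hy h hcl
    have := hI.cls_le x hx h
    omega
  · rw [Finset.filter_false_of_mem]
    · simp
    · intro x hx h; exact h.2 (hrem x (Finset.mem_range.1 hx))
  · refine le_trans ?_ hI.total
    rw [pow_succ, mul_assoc]
    refine Nat.mul_le_mul_left _ ?_
    have h1 : ((Finset.range n).filter fun x => asg x = 0 ∨ cl x = b + 1).card ≤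
        ((Finset.range n).filter fun x => asg x = 0 ∧ rem x ≠ 0).card := by
      refine Finset.card_le_card fun x hx => ?_
      simp only [Finset.mem_filter, Finset.mem_range] at hx ⊢
      have h2 := hdone x hx.1
      have h3 := hI.cls_le x hx.1
      omega
    have h2 : ((Finset.range n).filter fun x => asg x = 0 ∧ rem x ≠ 0).card +
        ((Finset.range n).filter fun x => asg x ≠ 0 ∧ cl x = b).card ≤
        ((Finset.range n).filter fun x => asg x = 0 ∨ cl x = b).card := by
      rw [← Finset.card_union_of_disjoint]
      · refine Finset.card_le_card fun x hx => ?_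
        simp only [Finset.mem_filter, Finset.mem_range, Finset.mem_union] at hx ⊢
        omega
      · rw [Finset.disjoint_left]
        intro x hx hx'
        simp only [Finset.mem_filter] at hx hx'
        omega
    have := hI.removed_le
    omega

/-- Every vertex has a near center, and vertices of the same class with different centers are far
from each other. -/
structure Homes (n β ρ : ℕ) (D : ℕ → ℕ → ℕ) (c cl : ℕ → ℕ) : Prop where
  center_lt : ∀ x < n, c x < n
  cls_lt : ∀ x < n, cl x < β
  dist_le : ∀ x < n, D x (c x) ≤ ρ * β
  far : ∀ x < n, ∀ y < n, cl x = cl y → c x ≠ c y → ρ < D x y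

/-- After `β` classes, `total` leaves fewer than one candidate since `n < 2 ^ β`. So all vertices
are assigned, to classes below `β`. -/
theorem CarveInv.homes (hI : CarveInv n β ρ β D asg rem c cl) (hβ : n < 2 ^ β) :
    Homes n β ρ D c cl := by
  have hzero : ((Finset.range n).filter fun x => asg x = 0 ∨ cl x = β) = ∅ := by
    rw [← Finset.card_eq_zero]
    by_contra hne
    have := Nat.mul_le_mul_left (2 ^ β) (Nat.pos_of_ne_zero hne)
    have := hI.total
    omega
  have hall : ∀ x < n, asg x ≠ 0 ∧ cl x ≠ β := by
    intro x hx
    have : x ∉ (Finset.range n).filter fun x => asg x = 0 ∨ cl x = β := by rw [hzero]; simp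
    simp only [Finset.mem_filter, Finset.mem_range] at this
    omega
  refine ⟨fun x hx => hI.center_lt x hx (hall x hx).1, fun x hx => ?_,
    fun x hx => hI.dist_le x hx (hall x hx).1,
    fun x hx y hy => hI.far x hx y hy (hall x hx).1 (hall y hy).1⟩
  have h1 := hI.cls_le x hx (hall x hx).1
  have h2 := (hall x hx).2
  omega

end Carve

end HopND

namespace HopND

/-! ## The program: homes -/

/-- Whether the vertex is neither assigned (array `8`) nor removed (array `9`). -/
def freeExpr (x : Expr) : Expr :=
  .eq (.get 8 (.var 8) x + .get 9 (.var 8 * .var 2 + .var 16) x) 0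

/-- The distance from `17` to the given vertex at scale `8`. -/
def distExpr (x : Expr) : Expr :=
  .get 4 (.var 8 * .var 0 + (.var 0 - 1)) (.var 17 * .var 0 + x)

/-- Counts the vertices in two consecutive balls around `17`. -/
def countProg : Cmd :=
  .assign 20 0 ;; .assign 21 0 ;;
  .for 19 (.var 0)
    (.assign 20 (.var 20 + freeExpr (.var 19) *
        .lt (distExpr (.var 19)) (.var 18 * .var 23 + 1)) ;;
     .assign 21 (.var 21 + freeExpr (.var 19) *
        .lt (distExpr (.var 19)) ((.var 18 + 1) * .var 23 + 1)))

/-- Finds a radius at which the ball around `17` does not grow much. -/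
def radiusProg : Cmd :=
  .for 18 (.var 2) (countProg ;; .cond (.lt (.var 20 + .var 20) (.var 21)) .skip
    (.assign 22 (.var 18)))

/-- Assigns or removes the vertex `19`. -/
def markProg : Cmd :=
  .cond (freeExpr (.var 19))
    (.cond (.lt (distExpr (.var 19)) (.var 22 * .var 23 + 1))
      (.put 8 (.var 8) (.var 19) 1 ;; .put 6 (.var 8) (.var 19) (.var 17) ;;
        .put 7 (.var 8) (.var 19) (.var 16))
      (.cond (.lt (distExpr (.var 19)) ((.var 22 + 1) * .var 23 + 1))
        (.put 9 (.var 8 * .var 2 + .var 16) (.var 19) 1) .skip))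
    .skip

/-- Carves the ball around `17`. -/
def ballProg : Cmd :=
  .cond (freeExpr (.var 17)) (radiusProg ;; .for 19 (.var 0) markProg) .skip

/-- Computes the homes at scale `8`. -/
def levelProg : Cmd :=
  .assign 23 (8 * .var 1 * .get 3 0 (.var 8)) ;; .for 16 (.var 2) (.for 17 (.var 0) ballProg)

/-- Fills the tables of centers (array `6`) and classes (array `7`). -/
def homeProg : Cmd :=
  .for 19 (.var 0) (.put 6 0 (.var 19) (.var 19)) ;;
  .for 15 (.var 3) (.assign 8 (.var 15 + 1) ;; levelProg)

/-! ### Verification of the carving program -/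

namespace Params

variable {P : Params}

/-- The metric at scale `j`, as stored in the memory. -/
def stDist (P : Params) (s : State) (j x y : ℕ) : ℕ :=
  s.arrs 4 (j * P.n + (P.n - 1)) (x * P.n + y)

/-- The memory during the carving of the ball around `v`. -/
structure CarveEnv (P : Params) (j b v ρ : ℕ) (s : State) : Prop where
  env : P.Env s
  j_eq : s.vars 8 = j
  b_eq : s.vars 16 = b
  v_eq : s.vars 17 = v
  ρ_eq : s.vars 23 = ρ

theorem CarveEnv.frame {j b v ρ : ℕ} {c : Cmd} {s s' : State} (hE : P.CarveEnv j b v ρ s)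
    (hF : Frame c s s') (hc : (∀ x < 4, x ∉ c.modVars) ∧ 0 ∉ c.modArrs ∧ 3 ∉ c.modArrs)
    (hc' : 8 ∉ c.modVars ∧ 16 ∉ c.modVars ∧ 17 ∉ c.modVars ∧ 23 ∉ c.modVars) :
    P.CarveEnv j b v ρ s' where
  env := hE.env.frame hF hc
  j_eq := (hF.vars 8 hc'.1).trans hE.j_eq
  b_eq := (hF.vars 16 hc'.2.1).trans hE.b_eq
  v_eq := (hF.vars 17 hc'.2.2.1).trans hE.v_eq
  ρ_eq := (hF.vars 23 hc'.2.2.2).trans hE.ρ_eq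

theorem val_freeExpr {j b v ρ : ℕ} {s : State} (hE : P.CarveEnv j b v ρ s) (x : Expr) :
    (freeExpr x).val s =
      if s.arrs 8 j (x.val s) = 0 ∧ s.arrs 9 (j * P.β + b) (x.val s) = 0 then 1 else 0 := by
  simp [freeExpr, hE.env.β_eq, hE.j_eq, hE.b_eq]

theorem val_distExpr {j b v ρ : ℕ} {s : State} (hE : P.CarveEnv j b v ρ s) (x : Expr) :
    (distExpr x).val s = P.stDist s j v (x.val s) := by
  simp [distExpr, hE.env.n_eq, hE.j_eq, hE.v_eq, stDist]

theorem card_freeBall_succ (n : ℕ) (D : ℕ → ℕ → ℕ) (asg rem : ℕ → ℕ) (v r : ℕ) :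
    (freeBall (n + 1) D asg rem v r).card = (freeBall n D asg rem v r).card +
      (if asg n = 0 ∧ rem n = 0 then 1 else 0) * if D v n < r + 1 then 1 else 0 := by
  unfold freeBall
  rw [Finset.range_add_one, Finset.filter_insert]
  by_cases h1 : asg n = 0 ∧ rem n = 0 <;> by_cases h2 : D v n ≤ r <;>
    simp [h1, h2]

theorem card_freeBall_le (n : ℕ) (D : ℕ → ℕ → ℕ) (asg rem : ℕ → ℕ) (v r : ℕ) :
    (freeBall n D asg rem v r).card ≤ n := by
  simpa [freeBall] using Finset.card_filter_le (Finset.range n) _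

/-- Products of indicator values are added up, and membership in the closed ball is tested as
distance less than radius plus `1`. -/
theorem reach_countProg {j b v ρ t : ℕ} {s : State} (hE : P.CarveEnv j b v ρ s)
    (h18 : s.vars 18 = t) :
    Reach P.Y countProg s fun s' =>
      s'.vars 20 = (freeBall P.n (P.stDist s j) (s.arrs 8 j) (s.arrs 9 (j * P.β + b)) v
        (t * ρ)).card ∧
      s'.vars 21 = (freeBall P.n (P.stDist s j) (s.arrs 8 j) (s.arrs 9 (j * P.β + b)) v
        ((t + 1) * ρ)).card := by
  refine reach_seq (reach_assign (by simp) (reach_seq (reach_assign (by simp) ?_)))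
  set s₁ := (s.setVar 20 (Expr.val s 0)).setVar 21 (Expr.val (s.setVar 20 (Expr.val s 0)) 0)
  have hF₁ : Frame countProg s s₁ :=
    (Frame.setVar _ _ _ (by decide)).trans (Frame.setVar _ _ _ (by decide))
  have hE₁ := hE.frame hF₁ (by decide) (by decide)
  refine reach_for P.n (fun x s' =>
      s'.vars 20 = (freeBall x (P.stDist s j) (s.arrs 8 j) (s.arrs 9 (j * P.β + b)) v
        (t * ρ)).card ∧
      s'.vars 21 = (freeBall x (P.stDist s j) (s.arrs 8 j) (s.arrs 9 (j * P.β + b)) v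
        ((t + 1) * ρ)).card) (P.n_le le_rfl) (by decide) ?_ ?_ ?_ ?_
  · intro s' hF
    exact (hE₁.frame hF (by decide) (by decide)).env.n_eq
  · simp [s₁, freeBall]
  · rintro x hx s' hF - hx' ⟨hI1, hI2⟩
    have hE' := hE₁.frame hF (by decide) (by decide)
    have h18' : s'.vars 18 = t := by rw [hF.vars 18 (by decide)]; simpa [s₁] using h18
    have ha : ∀ a, a ∉ countProg.modArrs → s'.arrs a = s.arrs a := fun a ha =>
      (hF.arrs a (by simp [Cmd.for, Cmd.modArrs])).trans (hF₁.arrs a ha)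
    have h8 := ha 8 (by decide)
    have h9 := ha 9 (by decide)
    have hD : P.stDist s' j = P.stDist s j := by
      funext x y; simp only [stDist, ha 4 (by decide)]
    have e1 : (Expr.var 20 + freeExpr (.var 19) *
        .lt (distExpr (.var 19)) (.var 18 * .var 23 + 1)).val s' =
        (freeBall (x + 1) (P.stDist s j) (s.arrs 8 j) (s.arrs 9 (j * P.β + b)) v
        (t * ρ)).card := by
      rw [card_freeBall_succ]
      simp [val_freeExpr hE', val_distExpr hE', hI1, h8, h9, hD, hx', h18', hE'.ρ_eq]
    refine reach_seq (reach_assign ?_ ?_)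
    · rw [e1]
      exact P.lt_of_le (P.n_le ((card_freeBall_le _ _ _ _ _ _).trans hx))
    rw [e1]
    set s₂ := s'.setVar 20 (freeBall (x + 1) (P.stDist s j) (s.arrs 8 j)
      (s.arrs 9 (j * P.β + b)) v (t * ρ)).card with hs₂
    have hE₂ : P.CarveEnv j b v ρ s₂ :=
      hE'.frame (c := countProg) (Frame.setVar _ _ _ (by decide)) (by decide) (by decide)
    have hD₂ : P.stDist s₂ j = P.stDist s j := hD
    have e2 : (Expr.var 21 + freeExpr (.var 19) *
        .lt (distExpr (.var 19)) ((.var 18 + 1) * .var 23 + 1)).val s₂ =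
        (freeBall (x + 1) (P.stDist s j) (s.arrs 8 j) (s.arrs 9 (j * P.β + b)) v
        ((t + 1) * ρ)).card := by
      rw [card_freeBall_succ]
      have g8 : s₂.arrs 8 = s.arrs 8 := h8
      have g9 : s₂.arrs 9 = s.arrs 9 := h9
      have g18 : s₂.vars 18 = t := by simp [hs₂, h18']
      have g19 : s₂.vars 19 = x := by simp [hs₂, hx']
      have g21 : s₂.vars 21 = s'.vars 21 := by simp [hs₂]
      simp [val_freeExpr hE₂, val_distExpr hE₂, hI2, g8, g9, hD₂, g18, g19, g21, hE₂.ρ_eq]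
    refine reach_assign ?_ ?_
    · rw [e2]
      exact P.lt_of_le (P.n_le ((card_freeBall_le _ _ _ _ _ _).trans hx))
    rw [e2]
    simp [hs₂]
  · exact fun s' _ hI => hI

theorem reach_radiusProg {j b v ρ : ℕ} {s : State} (hE : P.CarveEnv j b v ρ s)
    (hD₀ : IsMetric P.n (P.stDist s j)) (hv : v < P.n) (ha : s.arrs 8 j v = 0)
    (hr : s.arrs 9 (j * P.β + b) v = 0) :
    Reach P.Y radiusProg s fun s' => s'.vars 22 < P.β ∧
      (freeBall P.n (P.stDist s j) (s.arrs 8 j) (s.arrs 9 (j * P.β + b)) v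
        ((s'.vars 22 + 1) * ρ)).card ≤
      2 * (freeBall P.n (P.stDist s j) (s.arrs 8 j) (s.arrs 9 (j * P.β + b)) v
        (s'.vars 22 * ρ)).card := by
  set good : ℕ → Prop := fun t =>
    (freeBall P.n (P.stDist s j) (s.arrs 8 j) (s.arrs 9 (j * P.β + b)) v ((t + 1) * ρ)).card ≤
      2 * (freeBall P.n (P.stDist s j) (s.arrs 8 j) (s.arrs 9 (j * P.β + b)) v (t * ρ)).card
    with hgood
  -- Variable `22` may hold a value left by an earlier ball, so before a good radius is met the
  -- invariant only says that none has been passed. `exists_radius` rules this out at the end.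
  refine reach_for P.β (fun t s' => (s'.vars 22 < P.β ∧ good (s'.vars 22)) ∨ ∀ t' < t, ¬ good t')
    P.size_cls (by decide) ?_ ?_ ?_ ?_
  · intro s' hF
    exact (hE.frame hF (by decide) (by decide)).env.β_eq
  · exact Or.inr (by simp)
  · intro t ht s' hF _ ht' hI
    have hE' := hE.frame hF (by decide) (by decide)
    have h8 : s'.arrs 8 = s.arrs 8 := hF.arrs 8 (by decide)
    have h9 : s'.arrs 9 = s.arrs 9 := hF.arrs 9 (by decide)
    have hD : P.stDist s' j = P.stDist s j := by
      funext x y; simp only [stDist, hF.arrs 4 (by decide)]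
    refine reach_seq ((reach_countProg hE' ht').mono fun s₁ _ hF₁ hI₁ => ?_)
    rw [h8, h9, hD] at hI₁
    have h22 : s₁.vars 22 = s'.vars 22 := hF₁.vars 22 (by decide)
    have h18 : s₁.vars 18 = t := (hF₁.vars 18 (by decide)).trans ht'
    refine reach_cond (fun hlt => reach_skip ?_) fun hlt => ?_
    · have hbad : ¬ good t := by
        intro hg
        simp only [hgood, ← hI₁.1, ← hI₁.2] at hg
        rw [Expr.val_lt_ne_zero] at hlt
        simp only [Expr.val_add, Expr.val_var] at hlt
        omega
      simp only [State.vars_setVar]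
      norm_num [h22]
      rcases hI with hI | hI
      · exact Or.inl hI
      · refine Or.inr fun t' ht'' => ?_
        rcases Nat.lt_or_eq_of_le ht'' with h | rfl
        exacts [hI t' h, hbad]
    · have hg : good t := by
        simp only [hgood, ← hI₁.1, ← hI₁.2]
        rw [Expr.val_lt_eq_zero] at hlt
        simp only [Expr.val_add, Expr.val_var] at hlt
        omega
      refine reach_assign (by simpa [h18] using P.lt_of_le (ht.le.trans P.size_cls)) ?_
      left
      simp [h18, ht, hg]
  · intro s' _ hI
    rcases hI with hI | hI
    · exact hI
    · obtain ⟨t, ht, hg⟩ := exists_radius P.lt_pow hD₀ hv ha hr (ρ := ρ)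
      exact absurd hg (hI t ht)

/-- What the carving of balls at level `j` in class `b` does not change. -/
structure SameRows (j r : ℕ) (s s' : State) : Prop where
  center : ∀ i ≠ j, s'.arrs 6 i = s.arrs 6 i
  cls : ∀ i ≠ j, s'.arrs 7 i = s.arrs 7 i
  asg : ∀ i ≠ j, s'.arrs 8 i = s.arrs 8 i
  rem : ∀ i ≠ r, s'.arrs 9 i = s.arrs 9 i

theorem SameRows.refl (j r : ℕ) (s : State) : SameRows j r s s :=
  ⟨fun _ _ => rfl, fun _ _ => rfl, fun _ _ => rfl, fun _ _ => rfl⟩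

theorem SameRows.trans {j r : ℕ} {s s' s'' : State} (h : SameRows j r s s')
    (h' : SameRows j r s' s'') : SameRows j r s s'' :=
  ⟨fun i hi => (h'.center i hi).trans (h.center i hi), fun i hi => (h'.cls i hi).trans (h.cls i hi),
    fun i hi => (h'.asg i hi).trans (h.asg i hi), fun i hi => (h'.rem i hi).trans (h.rem i hi)⟩

/-- The invariant of the loop that assigns and removes vertices. -/
structure MarkInv (P : Params) (j b v ρ t : ℕ) (s : State) (x : ℕ) (s' : State) : Prop where
  step : CarveStep x ρ b v t (P.stDist s j) (s.arrs 8 j) (s.arrs 9 (j * P.β + b)) (s.arrs 6 j)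
    (s.arrs 7 j) (s'.arrs 8 j) (s'.arrs 9 (j * P.β + b)) (s'.arrs 6 j) (s'.arrs 7 j)
  rest : ∀ y, x ≤ y → s'.arrs 8 j y = s.arrs 8 j y ∧
    s'.arrs 9 (j * P.β + b) y = s.arrs 9 (j * P.β + b) y ∧ s'.arrs 6 j y = s.arrs 6 j y ∧
    s'.arrs 7 j y = s.arrs 7 j y
  rows : SameRows j (j * P.β + b) s s'

theorem MarkInv.succ {j b v ρ t x : ℕ} {s s' s'' : State} (hI : P.MarkInv j b v ρ t s x s')
    (hne : ∀ y ≠ x, s''.arrs 8 j y = s'.arrs 8 j y ∧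
      s''.arrs 9 (j * P.β + b) y = s'.arrs 9 (j * P.β + b) y ∧ s''.arrs 6 j y = s'.arrs 6 j y ∧
      s''.arrs 7 j y = s'.arrs 7 j y)
    (hrows : SameRows j (j * P.β + b) s' s'')
    (hx : (s.arrs 8 j x = 0 ∧ s.arrs 9 (j * P.β + b) x = 0 ∧ P.stDist s j v x ≤ t * ρ ∧
        s''.arrs 8 j x = 1 ∧ s''.arrs 9 (j * P.β + b) x = 0 ∧ s''.arrs 6 j x = v ∧
        s''.arrs 7 j x = b) ∨
      (s.arrs 8 j x = 0 ∧ s.arrs 9 (j * P.β + b) x = 0 ∧ t * ρ < P.stDist s j v x ∧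
        P.stDist s j v x ≤ (t + 1) * ρ ∧ s''.arrs 8 j x = 0 ∧ s''.arrs 9 (j * P.β + b) x = 1) ∨
      ((s.arrs 8 j x ≠ 0 ∨ s.arrs 9 (j * P.β + b) x ≠ 0 ∨ (t + 1) * ρ < P.stDist s j v x) ∧
        s''.arrs 8 j x = s.arrs 8 j x ∧
        s''.arrs 9 (j * P.β + b) x = s.arrs 9 (j * P.β + b) x ∧
        s''.arrs 6 j x = s.arrs 6 j x ∧ s''.arrs 7 j x = s.arrs 7 j x)) :
    P.MarkInv j b v ρ t s (x + 1) s'' := by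
  refine ⟨fun y hy => ?_, fun y hy => ?_, hI.rows.trans hrows⟩
  · rcases Nat.lt_succ_iff_lt_or_eq.1 hy with hy | rfl
    · obtain ⟨h1, h2, h3, h4⟩ := hne y hy.ne
      rw [h1, h2, h3, h4]
      exact hI.step y hy
    · exact hx
  · obtain ⟨h1, h2, h3, h4⟩ := hne y (by omega)
    rw [h1, h2, h3, h4]
    exact hI.rest y (by omega)

/-- The fate of a vertex depends on the marks before the loop. By `rest`, these are still in place
when its turn comes, as each iteration writes only at its own vertex. -/
theorem reach_markLoop {j b v ρ t : ℕ} {s : State} (hE : P.CarveEnv j b v ρ s) (hb : b < P.β)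
    (hv : v < P.n) (ht : s.vars 22 = t) :
    Reach P.Y (.for 19 (.var 0) markProg) s fun s' => P.MarkInv j b v ρ t s P.n s' := by
  refine reach_for P.n (fun x s' => P.MarkInv j b v ρ t s x s') (P.n_le le_rfl) (by decide)
    ?_ ?_ ?_ ?_
  · intro s' hF
    exact (hE.frame hF (by decide) (by decide)).env.n_eq
  · exact ⟨fun x hx => by omega, fun y _ => ⟨rfl, rfl, rfl, rfl⟩,
      ⟨fun _ _ => rfl, fun _ _ => rfl, fun _ _ => rfl, fun _ _ => rfl⟩⟩
  · intro x hx s' hF _ hx' hI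
    have hE' := hE.frame hF (by decide) (by decide)
    have h22 : s'.vars 22 = t := (hF.vars 22 (by decide)).trans ht
    have hD : P.stDist s' j = P.stDist s j := by
      funext x y; simp only [stDist, hF.arrs 4 (by decide)]
    obtain ⟨r8, r9, r6, r7⟩ := hI.rest x le_rfl
    have hfree := val_freeExpr hE' (.var 19)
    have hdist := val_distExpr hE' (.var 19)
    rw [Expr.val_var, hx', hD] at hdist
    rw [Expr.val_var, hx', r8, r9] at hfree
    have hunch : ∀ {s'' : State}, s''.arrs = s'.arrs →
        (s.arrs 8 j x ≠ 0 ∨ s.arrs 9 (j * P.β + b) x ≠ 0 ∨ (t + 1) * ρ < P.stDist s j v x) →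
        P.MarkInv j b v ρ t s (x + 1) s'' := by
      intro s'' hs'' hcase
      refine hI.succ ?_ ?_ (Or.inr (Or.inr ⟨hcase, ?_⟩))
      · rw [hs'']; exact fun y _ => ⟨rfl, rfl, rfl, rfl⟩
      · constructor <;> rw [hs''] <;> exact fun _ _ => rfl
      · rw [hs'']; exact ⟨r8, r9, r6, r7⟩
    refine reach_cond (fun hf => ?_) fun hf => reach_skip (hunch rfl ?_)
    · have hfree' : s.arrs 8 j x = 0 ∧ s.arrs 9 (j * P.β + b) x = 0 := by
        by_contra hcon; exact hf (by rw [hfree, if_neg hcon])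
      refine reach_cond (fun hlt => ?_) fun hlt => reach_cond (fun hlt' => ?_) fun hlt' =>
        reach_skip (hunch rfl (Or.inr (Or.inr ?_)))
      · rw [Expr.val_lt_ne_zero] at hlt
        simp only [Expr.val_add, Expr.val_mul, Expr.val_var, Expr.val_one, hdist, h22,
          hE'.ρ_eq] at hlt
        -- The stored value `1` is small enough because `b < β` and `β ≤ Y`.
        refine reach_seq (reach_put (P.lt_of_le ((Nat.succ_le_of_lt hb).trans' (by simp) |>.trans
          P.size_cls)) (reach_seq (reach_put ?_ (reach_put ?_ ?_))))
        · simpa [hE'.v_eq] using P.lt_of_le (P.n_le hv.le)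
        · simpa [hE'.b_eq] using P.lt_of_le (hb.le.trans P.size_cls)
        simp only [Expr.val_var, Expr.val_one, State.vars_setArr, hx', hE'.j_eq, hE'.v_eq,
          hE'.b_eq]
        refine hI.succ ?_ ?_ (Or.inl ⟨hfree'.1, hfree'.2, by omega, ?_⟩)
        · intro y hy
          simp [State.arrs_setArr, hy]
        · constructor <;> intro i hi <;> funext y <;> simp [State.arrs_setArr, hi]
        · simpa [State.arrs_setArr, r9] using hfree'.2
      · rw [Expr.val_lt_ne_zero] at hlt'
        rw [Expr.val_lt_eq_zero] at hlt
        simp only [Expr.val_add, Expr.val_mul, Expr.val_var, Expr.val_one, hdist, h22,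
          hE'.ρ_eq] at hlt hlt'
        refine reach_put (P.lt_of_le ((Nat.succ_le_of_lt hb).trans' (by simp) |>.trans
          P.size_cls)) ?_
        simp only [Expr.val_var, Expr.val_one, Expr.val_add, Expr.val_mul, hx', hE'.j_eq,
          hE'.b_eq, hE'.env.β_eq]
        refine hI.succ ?_ ?_ (Or.inr (Or.inl ⟨hfree'.1, hfree'.2, by omega, by omega, ?_⟩))
        · intro y hy
          simp [State.arrs_setArr, hy]
        · constructor <;> intro i hi <;> funext y <;> simp [State.arrs_setArr, hi]
        · simpa [State.arrs_setArr, r8] using hfree'.1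
      · rw [Expr.val_lt_eq_zero] at hlt'
        simp only [Expr.val_add, Expr.val_mul, Expr.val_var, Expr.val_one, hdist, h22,
          hE'.ρ_eq] at hlt'
        omega
    · by_contra! hcon
      rw [hfree, if_pos ⟨hcon.1, hcon.2.1⟩] at hf
      exact absurd hf (by norm_num)
  · exact fun s' _ hI => hI

/-- The carving invariant, for the tables in the memory. -/
def StCarveInv (P : Params) (j b ρ : ℕ) (D : ℕ → ℕ → ℕ) (s : State) : Prop :=
  CarveInv P.n P.β ρ b D (s.arrs 8 j) (s.arrs 9 (j * P.β + b)) (s.arrs 6 j) (s.arrs 7 j)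

/-- The vertex is assigned or removed. -/
def Processed (P : Params) (j b : ℕ) (s : State) (x : ℕ) : Prop :=
  s.arrs 8 j x ≠ 0 ∨ s.arrs 9 (j * P.β + b) x ≠ 0

theorem reach_ballProg {j b v ρ : ℕ} {s : State} (hE : P.CarveEnv j b v ρ s) (hb : b < P.β)
    (hv : v < P.n) (hD : IsMetric P.n (P.stDist s j))
    (hI : P.StCarveInv j b ρ (P.stDist s j) s) :
    Reach P.Y ballProg s fun s' => P.StCarveInv j b ρ (P.stDist s j) s' ∧
      SameRows j (j * P.β + b) s s' ∧ P.Processed j b s' v ∧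
      ∀ x < P.n, P.Processed j b s x → P.Processed j b s' x := by
  have hfree := val_freeExpr hE (.var 17)
  rw [Expr.val_var, hE.v_eq] at hfree
  refine reach_cond (fun hf => ?_) fun hf => reach_skip ⟨hI, SameRows.refl _ _ _, ?_,
    fun _ _ h => h⟩
  · have hfree' : s.arrs 8 j v = 0 ∧ s.arrs 9 (j * P.β + b) v = 0 := by
      by_contra hcon; exact hf (by rw [hfree, if_neg hcon])
    refine reach_seq ((reach_radiusProg hE hD hv hfree'.1 hfree'.2).mono fun s₁ _ hF ht => ?_)
    refine (reach_markLoop (hE.frame hF (by decide) (by decide)) hb hv rfl).mono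
      fun s₂ _ _ hM => ?_
    have hstep := hM.step
    have hD₁ : P.stDist s₁ j = P.stDist s j := by
      funext x y; simp only [stDist, hF.arrs 4 (by decide)]
    have hrows := hM.rows
    have e6 : s₁.arrs 6 = s.arrs 6 := hF.arrs 6 (by decide)
    have e7 : s₁.arrs 7 = s.arrs 7 := hF.arrs 7 (by decide)
    have e8 : s₁.arrs 8 = s.arrs 8 := hF.arrs 8 (by decide)
    have e9 : s₁.arrs 9 = s.arrs 9 := hF.arrs 9 (by decide)
    rw [hD₁, e6, e7, e8, e9] at hstep
    refine ⟨CarveInv.step hI hD hv ht.1 ht.2 hstep, ⟨?_, ?_, ?_, ?_⟩,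
      hstep.free_center hD hv, fun x hx h => hstep.free_of_free hx h⟩
    · rw [← e6]; exact hrows.center
    · rw [← e7]; exact hrows.cls
    · rw [← e8]; exact hrows.asg
    · rw [← e9]; exact hrows.rem
  · by_contra hcon
    unfold Processed at hcon
    push Not at hcon
    rw [hfree, if_pos hcon] at hf
    exact absurd hf (by norm_num)

/-- Each vertex in turn serves as a center if it is still free. Processed vertices remain processed,
so no vertex is free at the end. -/
theorem reach_classLoop {j b ρ : ℕ} {s : State} (hE : P.Env s) (hj : s.vars 8 = j)
    (hb' : s.vars 16 = b) (hρ : s.vars 23 = ρ) (hb : b < P.β)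
    (hD : IsMetric P.n (P.stDist s j)) (hI : P.StCarveInv j b ρ (P.stDist s j) s) :
    Reach P.Y (.for 17 (.var 0) ballProg) s fun s' => P.StCarveInv j b ρ (P.stDist s j) s' ∧
      SameRows j (j * P.β + b) s s' ∧ ∀ x < P.n, P.Processed j b s' x := by
  refine reach_for P.n (fun v s' => P.StCarveInv j b ρ (P.stDist s j) s' ∧
      SameRows j (j * P.β + b) s s' ∧ ∀ x < v, P.Processed j b s' x) (P.n_le le_rfl) (by decide)
      ?_ ?_ ?_ ?_
  · intro s' hF
    exact (hE.frame hF (by decide)).n_eq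
  · exact ⟨hI, ⟨fun _ _ => rfl, fun _ _ => rfl, fun _ _ => rfl, fun _ _ => rfl⟩, by simp⟩
  · rintro v hv s' hF - hv' ⟨hI', hS, hP⟩
    have hE' : P.CarveEnv j b v ρ s' := ⟨hE.frame hF (by decide), (hF.vars 8 (by decide)).trans hj,
      (hF.vars 16 (by decide)).trans hb', hv', (hF.vars 23 (by decide)).trans hρ⟩
    have hD' : P.stDist s' j = P.stDist s j := by
      funext x y; simp only [stDist, hF.arrs 4 (by decide)]
    refine (reach_ballProg hE' hb hv (hD' ▸ hD) (hD' ▸ hI')).mono ?_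
    rintro s₂ - - ⟨h1, h2, h3, h4⟩
    refine ⟨hD' ▸ h1, hS.trans ⟨h2.1, h2.2, h2.3, h2.4⟩, fun x hx => ?_⟩
    rcases Nat.lt_succ_iff_lt_or_eq.1 hx with hx | rfl
    exacts [h4 x (hx.trans hv) (hP x hx), h3]
  · exact fun s' _ h => h

/-- Removal marks for scale `j` and class `b` live in row `j * β + b`. Every class thus begins with
a row of zeros that has never been written, and nothing has to be reset between classes or scales.
-/
theorem reach_levelProg {j : ℕ} {s : State} (hE : P.Env s) (hj : s.vars 8 = j) (hjK : j ≤ P.K)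
    (hD : IsMetric P.n (P.stDist s j)) (h8 : ∀ x, s.arrs 8 j x = 0)
    (h9 : ∀ r ≥ j * P.β, ∀ x, s.arrs 9 r x = 0) :
    Reach P.Y levelProg s fun s' =>
      Homes P.n P.β (8 * P.h * 2 ^ j) (P.stDist s j) (s'.arrs 6 j) (s'.arrs 7 j) ∧
      (∀ i ≠ j, s'.arrs 6 i = s.arrs 6 i ∧ s'.arrs 7 i = s.arrs 7 i ∧
        s'.arrs 8 i = s.arrs 8 i) ∧
      ∀ r ≥ (j + 1) * P.β, ∀ x, s'.arrs 9 r x = 0 := by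
  have hval : (8 * .var 1 * .get 3 0 (.var 8) : Expr).val s = 8 * P.h * 2 ^ j := by
    simp [hE.h_eq, hj, hE.pow_eq j hjK]
  have hlt : 8 * P.h * 2 ^ j < 2 ^ P.Y := by
    refine lt_of_le_of_lt ?_ P.size_scale
    refine le_trans ?_ (Nat.le_add_right _ _)
    exact Nat.mul_le_mul_left _ (Nat.pow_le_pow_right (by norm_num) hjK)
  refine reach_seq (reach_assign (by rw [hval]; exact hlt) ?_)
  rw [hval]
  set s₁ := s.setVar 23 (8 * P.h * 2 ^ j) with hs₁
  refine reach_for P.β (fun b s' => P.StCarveInv j b (8 * P.h * 2 ^ j) (P.stDist s j) s' ∧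
      (∀ i ≠ j, s'.arrs 6 i = s.arrs 6 i ∧ s'.arrs 7 i = s.arrs 7 i ∧
        s'.arrs 8 i = s.arrs 8 i) ∧
      ∀ r ≥ j * P.β + b, ∀ x, s'.arrs 9 r x = 0) P.size_cls (by decide) ?_ ?_ ?_ ?_
  · intro s' hF
    exact ((hE.setVar _ (by norm_num)).frame hF (by decide)).β_eq
  · exact ⟨CarveInv.start (fun x _ => h8 x) fun x _ => h9 _ le_rfl x, fun i _ => ⟨rfl, rfl, rfl⟩,
      h9⟩
  · rintro b hb s' hF - hb' ⟨hI, hS, hR⟩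
    have hE' := (hE.setVar (8 * P.h * 2 ^ j) (by norm_num : 4 ≤ 23)).frame hF (by decide)
    have hj' : s'.vars 8 = j := by rw [hF.vars 8 (by decide)]; simpa [hs₁] using hj
    have hρ' : s'.vars 23 = 8 * P.h * 2 ^ j := by rw [hF.vars 23 (by decide)]; simp [hs₁]
    have hD' : P.stDist s' j = P.stDist s j := by
      funext x y
      simp only [stDist, hF.arrs 4 (by decide)]
      rfl
    refine (reach_classLoop hE' hj' hb' hρ' hb (hD' ▸ hD) (hD' ▸ hI)).mono ?_
    rintro s₂ - - ⟨h1, h2, h3⟩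
    rw [hD'] at h1
    have hR' : ∀ r ≥ j * P.β + (b + 1), ∀ x, s₂.arrs 9 r x = 0 := by
      intro r hr x
      rw [h2.rem r (by omega)]
      exact hR r (by omega) x
    refine ⟨CarveInv.next_class h1 h3 fun x _ => hR' _ le_rfl x, fun i hi => ?_, hR'⟩
    obtain ⟨g1, g2, g3⟩ := hS i hi
    exact ⟨(h2.center i hi).trans g1, (h2.cls i hi).trans g2, (h2.asg i hi).trans g3⟩
  · rintro s' - ⟨hI, hS, hR⟩
    refine ⟨hI.homes P.lt_pow, hS, fun r hr => hR r ?_⟩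
    rw [add_mul, one_mul] at hr
    exact hr

/-- The tables of homes are right. -/
structure HomeTables (P : Params) (s : State) : Prop where
  center_zero : ∀ x < P.n, s.arrs 6 0 x = x
  cls_zero : ∀ x < P.n, s.arrs 7 0 x = 0
  homes : ∀ j, 1 ≤ j → j ≤ P.K →
    Homes P.n P.β (8 * P.h * 2 ^ j) (P.stDist s j) (s.arrs 6 j) (s.arrs 7 j)

/-- Only the centers of scale `0` are written explicitly. Its classes rely on array `7` starting
with zeros, and the marks of the other scales on arrays `8` and `9` doing so. -/
theorem reach_homeProg {s : State} (hE : P.Env s)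
    (hD : ∀ j ≤ P.K, IsMetric P.n (P.stDist s j)) (h7 : ∀ x, s.arrs 7 0 x = 0)
    (h8 : ∀ j x, s.arrs 8 j x = 0) (h9 : ∀ r x, s.arrs 9 r x = 0) :
    Reach P.Y homeProg s P.HomeTables := by
  refine reach_seq ((reach_for (Q := fun s' => ∀ x < P.n, s'.arrs 6 0 x = x) P.n
    (fun y s' => ∀ x < y, s'.arrs 6 0 x = x) (P.n_le le_rfl) (by decide)
    ?_ ?_ ?_ ?_).mono fun s₁ _ hF₁ h6 => ?_)
  · exact fun s' hF => (hE.frame hF (by decide)).n_eq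
  · simp
  · intro y hy s' hF _ hy' hI
    refine reach_put (by simpa [hy'] using P.lt_of_le (P.n_le hy.le)) fun x hx => ?_
    simp only [State.arrs_setVar, State.arrs_setArr_self, Expr.val_var, Expr.val_zero, hy',
      true_and]
    split_ifs with h
    · exact h.symm
    · exact hI x (by omega)
  · exact fun s' _ h => h
  have hE₁ := hE.frame hF₁ (by decide)
  have g7 : s₁.arrs 7 = s.arrs 7 := hF₁.arrs 7 (by decide)
  have g8 : s₁.arrs 8 = s.arrs 8 := hF₁.arrs 8 (by decide)
  have g9 : s₁.arrs 9 = s.arrs 9 := hF₁.arrs 9 (by decide)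
  have g4 : s₁.arrs 4 = s.arrs 4 := hF₁.arrs 4 (by decide)
  refine reach_for P.K (fun i s' => (∀ x < P.n, s'.arrs 6 0 x = x) ∧ (∀ x, s'.arrs 7 0 x = 0) ∧
    (∀ j > i, ∀ x, s'.arrs 8 j x = 0) ∧ (∀ r ≥ (i + 1) * P.β, ∀ x, s'.arrs 9 r x = 0) ∧
    ∀ j, 1 ≤ j → j ≤ i →
      Homes P.n P.β (8 * P.h * 2 ^ j) (P.stDist s₁ j) (s'.arrs 6 j) (s'.arrs 7 j))
    (P.K_le (Nat.le_succ _)) (by decide) ?_ ?_ ?_ ?_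
  · exact fun s' hF => (hE₁.frame hF (by decide)).K_eq
  · refine ⟨h6, ?_, ?_, ?_, ?_⟩
    · intro x; rw [State.arrs_setVar, g7]; exact h7 x
    · intro j _ x; rw [State.arrs_setVar, g8]; exact h8 j x
    · intro j _ x; rw [State.arrs_setVar, g9]; exact h9 j x
    · intro j hj hj'; omega
  · rintro i hi s' hF - hi' ⟨I6, I7, I8, I9, IH⟩
    have hE' := hE₁.frame hF (by decide)
    have hD' : ∀ j, P.stDist s' j = P.stDist s₁ j := by
      intro j; funext x y; simp only [stDist, hF.arrs 4 (by decide)]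
    have hD₁ : ∀ j, P.stDist s₁ j = P.stDist s j := by
      intro j; funext x y; simp only [stDist, g4]
    refine reach_seq (reach_assign
      (by simpa [hi'] using P.lt_of_le (P.K_le (show i + 1 ≤ P.K + 1 by omega))) ?_)
    have hval : (.var 15 + 1 : Expr).val s' = i + 1 := by simp [hi']
    rw [hval]
    set s₂ := s'.setVar 8 (i + 1) with hs₂
    have hD₂ : P.stDist s₂ (i + 1) = P.stDist s₁ (i + 1) := hD' (i + 1)
    refine (reach_levelProg (hE'.setVar _ (by norm_num)) (j := i + 1) (by simp) (by omega)
      (by rw [← hs₂, hD₂, hD₁]; exact hD _ (by omega)) (I8 (i + 1) (by omega)) I9).mono ?_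
    rintro s₃ - - ⟨h1, h2, h3⟩
    rw [← hs₂, hD₂] at h1
    refine ⟨?_, ?_, ?_, h3, ?_⟩
    · intro x hx
      rw [State.arrs_setVar, (h2 0 (by omega)).1]
      exact I6 x hx
    · intro x
      rw [State.arrs_setVar, (h2 0 (by omega)).2.1]
      exact I7 x
    · intro j hj x
      rw [State.arrs_setVar, (h2 j (by omega)).2.2]
      exact I8 j (by omega) x
    · intro j hj hj'
      rw [State.arrs_setVar]
      rcases Nat.lt_or_eq_of_le hj' with hj'' | rfl
      · rw [(h2 j (by omega)).1, (h2 j (by omega)).2.1]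
        exact IH j hj (by omega)
      · exact h1
  · rintro s' hF ⟨I6, I7, I8, I9, IH⟩
    refine ⟨I6, fun x _ => I7 x, fun j hj hj' => ?_⟩
    have : P.stDist s' j = P.stDist s₁ j := by
      funext x y; simp only [stDist, hF.arrs 4 (by decide)]
    rw [this]
    exact IH j hj hj'

end Params

end HopND

namespace HopND

/-! ## The program: output -/

/-- Computes the scale of the pair `25`, `26` in variable `29`. -/
def scaleProg : Cmd :=
  .assign 29 (.var 3) ;;
  .for 27 (.var 3)
    (.assign 28 (.var 3 - .var 27) ;;
     .cond (.lt (2 * .var 1 * .get 3 0 (.var 28))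
        (.get 4 (.var 28 * .var 0 + (.var 0 - 1)) (.var 25 * .var 0 + .var 26)))
      .skip (.assign 29 (.var 28)))

/-- Moves from `34` to the next vertex on the path from `25` to `26`. -/
def moveProg : Cmd :=
  .assign 31 (.var 30 / .var 0) ;;
  .assign 32 (.var 0 - 1 - (.var 30 - .var 31 * .var 0)) ;;
  .cond (.lt (.var 31) (.var 29))
    (.assign 28 (.var 31 + 1) ;; .assign 33 (.get 6 (.var 28) (.var 25)))
    (.assign 28 (2 * .var 29 - .var 31) ;; .assign 33 (.get 6 (.var 28 - 1) (.var 26))) ;;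
  .assign 36 (.get 5 (.var 28 * .var 0 + .var 32) (.var 34 * .var 0 + .var 33)) ;;
  .cond (.eq (.var 36) (.var 34)) .skip
    (.assign 35 (.var 35 + 1) ;; .put 2 (.var 24) (.var 35) (.var 36) ;; .assign 34 (.var 36))

/-- Writes the path from `25` to `26`. -/
def walkProg : Cmd :=
  .assign 34 (.var 25) ;; .assign 35 0 ;; .put 2 (.var 24) 0 (.var 25) ;;
  .for 30 (2 * .var 29 * .var 0) moveProg ;;
  .put 1 (.var 25) (.var 26) (.var 35)

/-- Writes the path for the pair of vertices with number `24`. -/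
def pairProg : Cmd :=
  .assign 25 (.var 24 / .var 0) ;;
  .assign 26 (.var 24 - .var 25 * .var 0) ;;
  .cond (.eq (.var 25) (.var 26))
    (.put 1 (.var 25) (.var 26) 0 ;; .put 2 (.var 24) 0 (.var 25))
    (scaleProg ;; walkProg)

/-- Writes all paths. -/
def outputProg : Cmd := .for 24 (.var 0 * .var 0) pairProg

/-! ### Verification of the output program -/

namespace Params

variable {P : Params}

section Tables

variable {s : State} {w : Sym2 (Fin P.n) → ℕ}

theorem row_div {j m : ℕ} (hm : m < P.n) : (j * P.n + m) / P.n = j := by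
  rw [mul_comm, Nat.mul_add_div P.n_pos, Nat.div_eq_of_lt hm, add_zero]

theorem row_mod {j m : ℕ} (hm : m < P.n) : (j * P.n + m) % P.n = m := by
  rw [mul_comm, Nat.mul_add_mod, Nat.mod_eq_of_lt hm]

theorem row_lt {j m J : ℕ} (hj : j < J) (hm : m < P.n) : j * P.n + m < J * P.n := by
  have := Nat.mul_le_mul_right P.n (Nat.succ_le_of_lt hj)
  rw [Nat.succ_mul] at this
  omega

/-- The table of distances. -/
def tableDist (P : Params) (s : State) (j m : ℕ) (x y : Fin P.n) : ℕ :=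
  s.arrs 4 (j * P.n + m) (x * P.n + y)

/-- The table of second vertices. -/
def tableNext (P : Params) (s : State) (j m : ℕ) (x y : Fin P.n) : Fin P.n :=
  ⟨s.arrs 5 (j * P.n + m) (x * P.n + y) % P.n, Nat.mod_lt _ P.n_pos⟩

theorem Tables.entry (hT : P.Tables s) {j m : ℕ} (hj : j ≤ P.K) (hm : m < P.n) (x y : Fin P.n) :
    P.TableEntry (s.arrs 4) (s.arrs 5) (j * P.n + m) (x * P.n + y) :=
  hT _ (row_lt (Nat.lt_succ_of_le hj) hm) _ (row_lt x.2 y.2)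

theorem Tables.tableNext (hT : P.Tables s) {j m : ℕ} (hj : j ≤ P.K) (hm : m < P.n)
    (x y : Fin P.n) : (P.tableNext s j m x y : ℕ) = s.arrs 5 (j * P.n + m) (x * P.n + y) :=
  Nat.mod_eq_of_lt (hT.entry hj hm x y).next_lt

theorem hopWeight_eq (hw : ∀ x y : Fin P.n, x ≠ y → w s(x, y) = P.w x y) (j : ℕ)
    (x y : Fin P.n) : hopWeight w P.h (2 ^ j) x y = P.W j x y := by
  unfold hopWeight W
  by_cases h : x = y
  · simp [h]
  · have h' : (x : ℕ) ≠ y := fun h' => h (Fin.ext h')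
    rw [if_neg h, if_neg h', hw x y h]

theorem Tables.isDP (hT : P.Tables s) (hw : ∀ x y : Fin P.n, x ≠ y → w s(x, y) = P.w x y) {j : ℕ}
    (hj : j ≤ P.K) :
    IsDP (hopWeight w P.h (2 ^ j)) P.n (P.tableDist s j) (P.tableNext s j) := by
  have hn := P.n_pos
  have hsucc : ∀ m, m + 1 < P.n → ∀ x y : Fin P.n,
      P.tableDist s j (m + 1) x y = P.W j x (P.tableNext s j (m + 1) x y) +
        P.tableDist s j m (P.tableNext s j (m + 1) x y) y ∧
      ∀ z : Fin P.n, P.tableDist s j (m + 1) x y ≤ P.W j x z + P.tableDist s j m z y := by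
    intro m hm x y
    have h1 := (hT.entry hj hm x y).succ
    rw [row_mod hm, row_div hm, row_div y.2, row_mod y.2,
      show j * P.n + (m + 1) - 1 = j * P.n + m by omega] at h1
    obtain ⟨h2, h3⟩ := h1 (Nat.succ_ne_zero m)
    rw [← hT.tableNext hj hm x y] at h2
    exact ⟨h2, fun z => h3 z z.2⟩
  refine ⟨fun x y => ?_, fun x y => ?_, fun m hm x y => ?_, fun m hm x y z => ?_⟩
  · have h1 := (hT.entry hj hn x y).zero
    rw [row_mod hn, row_div hn, row_div y.2, row_mod y.2] at h1
    rw [hopWeight_eq hw]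
    exact (h1 rfl).1
  · have h1 := (hT.entry hj hn x y).zero
    rw [row_mod hn, row_div hn, row_div y.2, row_mod y.2] at h1
    exact Fin.ext ((hT.tableNext hj hn x y).trans (h1 rfl).2)
  · rw [hopWeight_eq hw]
    exact (hsucc m hm x y).1
  · rw [hopWeight_eq hw]
    exact (hsucc m hm x y).2 z

theorem Tables.isHopDist (hT : P.Tables s)
    (hw : ∀ x y : Fin P.n, x ≠ y → w s(x, y) = P.w x y) {j : ℕ} (hj : j ≤ P.K) :
    IsHopDist w P.h (2 ^ j) (P.tableDist s j (P.n - 1)) :=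
  (hT.isDP hw hj).isHopDist (Fintype.card_fin _)

theorem Tables.isMetric (hT : P.Tables s)
    (hw : ∀ x y : Fin P.n, x ≠ y → w s(x, y) = P.w x y) {j : ℕ} (hj : j ≤ P.K) :
    IsMetric P.n (P.stDist s j) where
  self x hx := (hT.isHopDist hw hj).self ⟨x, hx⟩
  comm x hx y hy := (hT.isHopDist hw hj).comm ⟨x, hx⟩ ⟨y, hy⟩
  triangle x hx y hy z hz := (hT.isHopDist hw hj).triangle ⟨x, hx⟩ ⟨y, hy⟩ ⟨z, hz⟩

/-- The routing is the one that the memory describes. -/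
structure Represents (P : Params) {w : Sym2 (Fin P.n) → ℕ} (A : Routing w P.h P.β P.K)
    (s : State) : Prop where
  env : P.Env s
  next_eq : ∀ j ≤ P.K, ∀ m < P.n, ∀ x y : Fin P.n,
    s.arrs 5 (j * P.n + m) (x * P.n + y) = A.next j m x y
  center_eq : ∀ j ≤ P.K, ∀ x : Fin P.n, s.arrs 6 j x = A.center j x
  dist_eq : ∀ j ≤ P.K, ∀ x y : Fin P.n,
    s.arrs 4 (j * P.n + (P.n - 1)) (x * P.n + y) = A.D j x y

theorem Represents.frame {A : Routing w P.h P.β P.K} {c : Cmd} {s s' : State}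
    (hR : P.Represents A s) (hF : Frame c s s')
    (hc : (∀ x < 4, x ∉ c.modVars) ∧ 0 ∉ c.modArrs ∧ 3 ∉ c.modArrs)
    (hc' : 4 ∉ c.modArrs ∧ 5 ∉ c.modArrs ∧ 6 ∉ c.modArrs) : P.Represents A s' where
  env := hR.env.frame hF hc
  next_eq := by rw [hF.arrs 5 hc'.2.1]; exact hR.next_eq
  center_eq := by rw [hF.arrs 6 hc'.2.2]; exact hR.center_eq
  dist_eq := by rw [hF.arrs 4 hc'.1]; exact hR.dist_eq

/-- From here on the combinatorial analysis of `Routing` applies to the tables in memory. The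
remainders modulo `n` only serve to land in `Fin P.n`; the stored numbers are already below `n`. -/
theorem exists_routing (hE : P.Env s) (hT : P.Tables s) (hH : P.HomeTables s)
    (hw : ∀ x y : Fin P.n, x ≠ y → w s(x, y) = P.w x y) :
    ∃ A : Routing w P.h P.β P.K, P.Represents A s := by
  have hn := P.n_pos
  have hβ : 0 < P.β := by
    rcases Nat.eq_zero_or_pos P.β with h0 | h0
    · have := P.lt_pow
      rw [h0, pow_zero] at this
      omega
    · exact h0
  have hcen : ∀ j ≤ P.K, ∀ x < P.n, s.arrs 6 j x < P.n := by
    intro j hj x hx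
    rcases Nat.eq_zero_or_pos j with rfl | hj0
    · rw [hH.center_zero x hx]; exact hx
    · exact (hH.homes j hj0 hj).center_lt x hx
  -- The last scale is good for every pair: table entries are at most `top`, which is at most `2 * h
  -- * 2 ^ K` as `h ≥ 1`. So the infimum below is attained.
  have hex : ∀ x y : Fin P.n, 1 ≤ P.K ∧
      P.tableDist s P.K (P.n - 1) x y ≤ 2 * P.h * 2 ^ P.K := by
    intro x y
    refine ⟨P.K_pos, (hT.entry le_rfl (by omega) x y).le_top.trans ?_⟩
    have := Nat.mul_le_mul_right (2 ^ P.K) P.h_pos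
    rw [top, mul_assoc]
    omega
  set S : Fin P.n → Fin P.n → Set ℕ := fun x y =>
    {j | 1 ≤ j ∧ P.tableDist s j (P.n - 1) x y ≤ 2 * P.h * 2 ^ j} with hS
  have hmem : ∀ x y, sInf (S x y) ∈ S x y := fun x y => Nat.sInf_mem ⟨P.K, hex x y⟩
  refine ⟨{
    dist := P.tableDist s
    next := P.tableNext s
    center := fun j x => ⟨s.arrs 6 j x % P.n, Nat.mod_lt _ hn⟩
    cls := fun j x => s.arrs 7 j x
    scale := fun x y => sInf (S x y)
    isDP := fun j hj => by rw [Fintype.card_fin]; exact hT.isDP hw hj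
    center_zero := fun x => Fin.ext (by
      simp [hH.center_zero x x.2, Nat.mod_eq_of_lt x.2])
    dist_center := fun j hj x => ?_
    cls_lt := fun j hj x => ?_
    center_eq := fun j hj1 hj x y hcl hd => ?_
    one_le_scale := fun x y => (hmem x y).1
    scale_le := fun x y => Nat.sInf_le (hex x y)
    dist_scale := fun x y => by rw [Fintype.card_fin]; exact (hmem x y).2
    lt_dist := fun x y j hj1 hj => ?_ }, hE, ?_, ?_, ?_⟩
  · rw [Fintype.card_fin]
    rcases Nat.eq_zero_or_pos j with rfl | hj0
    · have : (⟨s.arrs 6 0 x % P.n, Nat.mod_lt _ hn⟩ : Fin P.n) = x := Fin.ext (by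
        simp [hH.center_zero x x.2, Nat.mod_eq_of_lt x.2])
      rw [this, (hT.isHopDist hw hj).self]
      exact Nat.zero_le _
    · have := (hH.homes j hj0 hj).dist_le x x.2
      simp only [tableDist, Nat.mod_eq_of_lt (hcen j hj x x.2)]
      exact this
  · rcases Nat.eq_zero_or_pos j with rfl | hj0
    · rw [hH.cls_zero x x.2]; exact hβ
    · exact (hH.homes j hj0 hj).cls_lt x x.2
  · rw [Fintype.card_fin] at hd
    by_contra hne
    refine absurd ((hH.homes j hj1 hj).far x x.2 y y.2 hcl fun h => hne ?_) (not_lt.2 hd)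
    exact Fin.ext (by simp [h])
  · rw [Fintype.card_fin]
    by_contra! hcon
    exact absurd (Nat.sInf_le (show j ∈ S x y from ⟨hj1, hcon⟩)) (not_le.2 hj)
  · exact fun j hj m hm x y => (hT.tableNext hj hm x y).symm
  · exact fun j hj x => (Nat.mod_eq_of_lt (hcen j hj x x.2)).symm
  · intro j hj x y
    simp only [Routing.D, Fintype.card_fin, tableDist]

end Tables

section Output

variable {w : Sym2 (Fin P.n) → ℕ} {A : Routing w P.h P.β P.K} {s : State} {u v : Fin P.n}

/-- The levels are scanned downwards and each good one overwrites the answer, so the smallest good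
level remains. It need not be true that all levels above the scale are good. -/
theorem reach_scaleProg (hR : P.Represents A s) (hu : s.vars 25 = u) (hv : s.vars 26 = v) :
    Reach P.Y scaleProg s fun s' => s'.vars 29 = A.scale u v := by
  have hgood : ∀ j, 1 ≤ j → A.D j u v ≤ 2 * P.h * 2 ^ j → A.scale u v ≤ j := by
    intro j hj hd
    by_contra! hcon
    exact absurd (A.lt_dist u v j hj hcon) (not_lt.2 hd)
  have hsK := A.scale_le u v
  have hs1 := A.one_le_scale u v
  refine reach_seq (reach_assign (by simpa [hR.env.K_eq] using P.lt_of_le (P.K_le (Nat.le_succ _)))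
    ?_)
  have hR₁ : P.Represents A (s.setVar 29 ((Expr.var 3).val s)) :=
    hR.frame (c := scaleProg) (Frame.setVar _ _ _ (by decide)) (by decide) (by decide)
  refine reach_for P.K (fun i s' => A.scale u v ≤ s'.vars 29 ∧
    (P.K + 1 - i ≤ A.scale u v → s'.vars 29 = A.scale u v)) (P.K_le (Nat.le_succ _))
    (by decide) ?_ ?_ ?_ ?_
  · intro s' hF
    exact (hR₁.frame hF (by decide) (by decide)).env.K_eq
  · simp [hR.env.K_eq]
    omega
  · rintro i hi s' hF - hi' ⟨I1, I2⟩
    have hR' := hR₁.frame hF (by decide) (by decide)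
    have hu' : s'.vars 25 = u := by simp [hF.vars 25 (by decide), hu]
    have hv' : s'.vars 26 = v := by simp [hF.vars 26 (by decide), hv]
    refine reach_seq (reach_assign ?_ ?_)
    · simp only [Expr.val_sub, Expr.val_var, hR'.env.K_eq]
      exact P.lt_of_le (P.K_le (by omega))
    simp only [Expr.val_sub, Expr.val_var, hR'.env.K_eq, hi']
    refine reach_cond (fun hlt => reach_skip ?_) fun hlt => reach_assign ?_ ?_
    · rw [Expr.val_lt_ne_zero] at hlt
      simp [hR'.env.n_eq, hR'.env.h_eq, hu', hv', hR'.env.pow_eq (P.K - i) (by omega),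
        hR'.dist_eq (P.K - i) (by omega) u v] at hlt
      have hne : A.scale u v ≠ P.K - i := by
        intro h
        have := A.dist_scale u v
        rw [h] at this
        exact absurd hlt (not_lt.2 this)
      simp
      omega
    · simp
      exact P.lt_of_le (P.K_le (by omega))
    · rw [Expr.val_lt_eq_zero] at hlt
      simp [hR'.env.n_eq, hR'.env.h_eq, hu', hv', hR'.env.pow_eq (P.K - i) (by omega),
        hR'.dist_eq (P.K - i) (by omega) u v] at hlt
      have := hgood (P.K - i) (by omega) hlt
      simp
      omega
  · rintro s' - ⟨I1, I2⟩
    exact I2 (by omega)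

theorem length_walkOf_le {V : Type*} [DecidableEq V] (p : ℕ → V) (N : ℕ) :
    (walkOf p N).length ≤ N := by
  induction N with
  | zero => simp [walkOf]
  | succ N ih => rw [length_walkOf_succ]; split_ifs <;> omega

/-- The memory during the output of the path from `u` to `v`. -/
structure MoveEnv (P : Params) {w : Sym2 (Fin P.n) → ℕ} (A : Routing w P.h P.β P.K)
    (u v : Fin P.n) (s : State) : Prop where
  rep : P.Represents A s
  idx_eq : s.vars 24 = u * P.n + v
  u_eq : s.vars 25 = u
  v_eq : s.vars 26 = v
  scale_eq : s.vars 29 = A.scale u v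

theorem MoveEnv.frame {c : Cmd} {s s' : State} (hE : P.MoveEnv A u v s) (hF : Frame c s s')
    (hc : (∀ x < 4, x ∉ c.modVars) ∧ 0 ∉ c.modArrs ∧ 3 ∉ c.modArrs)
    (hc' : 4 ∉ c.modArrs ∧ 5 ∉ c.modArrs ∧ 6 ∉ c.modArrs)
    (hc'' : 24 ∉ c.modVars ∧ 25 ∉ c.modVars ∧ 26 ∉ c.modVars ∧ 29 ∉ c.modVars) :
    P.MoveEnv A u v s' where
  rep := hE.rep.frame hF hc hc'
  idx_eq := (hF.vars 24 hc''.1).trans hE.idx_eq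
  u_eq := (hF.vars 25 hc''.2.1).trans hE.u_eq
  v_eq := (hF.vars 26 hc''.2.2.1).trans hE.v_eq
  scale_eq := (hF.vars 29 hc''.2.2.2).trans hE.scale_eq

/-- The first `q` steps of the path from `u` to `v` have been written. -/
structure MoveInv (P : Params) {w : Sym2 (Fin P.n) → ℕ} (A : Routing w P.h P.β P.K)
    (u v : Fin P.n) (s : State) (q : ℕ) (s' : State) : Prop where
  cur : s'.vars 34 = A.node u v q
  len : s'.vars 35 = (walkOf (A.node u v) q).length
  vert : ∀ i ≤ (walkOf (A.node u v) q).length,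
    s'.arrs 2 (u * P.n + v) i = (walkOf (A.node u v) q).getVert i
  rows : ∀ r ≠ (u * P.n + v : ℕ), s'.arrs 2 r = s.arrs 2 r

/-- A step of the node sequence that stays put writes nothing, just as `walkOf` leaves out stays.
Hence the counter of written hops follows the length of the walk rather than the number of steps. -/
theorem reach_moveProg {s₀ : State} (hE : P.MoveEnv A u v s) {q : ℕ}
    (hq : q < 2 * A.scale u v * P.n) (h30 : s.vars 30 = q) (hI : P.MoveInv A u v s₀ q s) :
    Reach P.Y moveProg s fun s' => P.MoveInv A u v s₀ (q + 1) s' := by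
  have hn := P.n_pos
  have hsK := A.scale_le u v
  have hs1 := A.one_le_scale u v
  have hqY : q + 1 ≤ P.Y := le_trans (Nat.succ_le_of_lt hq)
    (le_trans (Nat.mul_le_mul_right _ (Nat.mul_le_mul_left _ hsK)) P.size_path)
  have hb : q / P.n < 2 * A.scale u v := Nat.div_lt_of_lt_mul (by rwa [mul_comm])
  have hlevel := (A.level_le hb).trans hsK
  have hi : q - q / P.n * P.n = q % P.n := by
    have := Nat.div_add_mod' q P.n; omega
  have hil : q % P.n < P.n := Nat.mod_lt _ hn
  refine reach_seq (reach_assign ?_ (reach_seq (reach_assign ?_ ?_)))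
  · simp only [Expr.val_div, Expr.val_var, h30]
    exact P.lt_of_le ((Nat.div_le_self _ _).trans (by omega))
  · simp [h30, hE.rep.env.n_eq]
    exact P.lt_of_le (P.n_le (by omega))
  simp only [Expr.val_div, Expr.val_var, Expr.val_sub, Expr.val_mul, Expr.val_one, h30,
    hE.rep.env.n_eq, State.vars_setVar]
  norm_num [h30, hE.rep.env.n_eq, hi]
  set s₁ := (s.setVar 31 (q / P.n)).setVar 32 (P.n - 1 - q % P.n) with hs₁
  have hF₁ : Frame moveProg s s₁ :=
    (Frame.setVar _ _ _ (by decide)).trans (Frame.setVar _ _ _ (by decide))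
  have hE₁ := hE.frame hF₁ (by decide) (by decide) (by decide)
  refine reach_seq ((reach_cond (Q := fun s' => s'.vars 28 = A.level u v (q / P.n) ∧
    s'.vars 33 = A.target u v (q / P.n)) (fun hlt => ?_) fun hlt => ?_).mono
    fun s₂ _ hF ⟨g28, g33⟩ => ?_)
  · have hlt' : q / P.n < A.scale u v := by
      rw [Expr.val_lt_ne_zero] at hlt
      simpa [hs₁, hE.scale_eq] using hlt
    refine reach_seq (reach_assign ?_ (reach_assign ?_ ?_))
    · simp [hs₁]
      exact P.lt_of_le (P.K_le (by omega))
    · simp [hs₁, hE.u_eq, hE.rep.center_eq (q / P.n + 1) (by omega) u]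
      exact P.lt_of_le (P.n_le (Fin.is_lt _).le)
    · simp [hs₁, hE.u_eq, hE.rep.center_eq (q / P.n + 1) (by omega) u, Routing.level,
        Routing.target, hlt']
  · have hlt' : ¬ q / P.n < A.scale u v := by
      rw [Expr.val_lt_eq_zero] at hlt
      simpa [hs₁, hE.scale_eq] using hlt
    refine reach_seq (reach_assign ?_ (reach_assign ?_ ?_))
    · simp [hs₁, hE.scale_eq]
      exact P.lt_of_le (P.K_le (by omega))
    · simp [hs₁, hE.v_eq, hE.scale_eq,
        hE.rep.center_eq (2 * A.scale u v - q / P.n - 1) (by omega) v]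
      exact P.lt_of_le (P.n_le (Fin.is_lt _).le)
    · simp [hs₁, hE.v_eq, hE.scale_eq,
        hE.rep.center_eq (2 * A.scale u v - q / P.n - 1) (by omega) v, Routing.level,
        Routing.target, hlt']
  have hF₂ : Frame moveProg s s₂ := hF₁.trans (hF.mono (by decide) (by decide))
  have hE₂ := hE.frame hF₂ (by decide) (by decide) (by decide)
  have g32 : s₂.vars 32 = P.n - 1 - q % P.n := by rw [hF.vars 32 (by decide)]; simp [hs₁]
  have g34 : s₂.vars 34 = A.node u v q := by
    rw [hF.vars 34 (by decide)]; simpa [hs₁] using hI.cur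
  have g35 : s₂.vars 35 = (walkOf (A.node u v) q).length := by
    rw [hF.vars 35 (by decide)]; simpa [hs₁] using hI.len
  have g2 : s₂.arrs 2 = s.arrs 2 := by rw [hF.arrs 2 (by decide)]; simp [hs₁]
  have hnext : (Expr.get 5 (.var 28 * .var 0 + .var 32) (.var 34 * .var 0 + .var 33)).val s₂ =
      (A.node u v (q + 1) : ℕ) := by
    simp only [Expr.val_get, Expr.val_add, Expr.val_mul, Expr.val_var, g28, g32, g33, g34,
      hE₂.rep.env.n_eq]
    rw [hE₂.rep.next_eq _ hlevel _ (by omega)]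
    simp only [Routing.node, Fintype.card_fin]
  refine reach_seq (reach_assign ?_ ?_)
  · rw [hnext]; exact P.lt_of_le (P.n_le (Fin.is_lt _).le)
  rw [hnext]
  have hlen := length_walkOf_succ (A.node u v) q
  refine reach_cond (fun heq => reach_skip ?_) fun hne => ?_
  · rw [Expr.val_eq_ne_zero] at heq
    have heq' : A.node u v q = A.node u v (q + 1) := by
      simp [g34] at heq
      exact Fin.ext heq.symm
    rw [if_pos heq', add_zero] at hlen
    refine ⟨?_, ?_, ?_, ?_⟩
    · simpa [← heq'] using g34
    · simpa [hlen] using g35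
    · intro i hi
      rw [getVert_walkOf_succ_of_le _ (hlen ▸ hi), State.arrs_setVar, g2]
      exact hI.vert i (hlen ▸ hi)
    · intro r hr
      rw [State.arrs_setVar, g2]
      exact hI.rows r hr
  · rw [Expr.val_eq_eq_zero] at hne
    have hne' : A.node u v q ≠ A.node u v (q + 1) := by
      simp [g34] at hne
      exact fun h => hne (by rw [h])
    rw [if_neg hne'] at hlen
    have hle := length_walkOf_le (A.node u v) q
    refine reach_seq (reach_assign ?_ (reach_seq (reach_put ?_ (reach_assign ?_ ?_))))
    · simp [g35]
      exact P.lt_of_le (by omega)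
    · simp
      exact P.lt_of_le (P.n_le (Fin.is_lt _).le)
    · simp
      exact P.lt_of_le (P.n_le (Fin.is_lt _).le)
    · refine ⟨?_, ?_, ?_, ?_⟩
      · simp
      · simp [hlen, g35]
      · intro i hi
        simp [State.arrs_setArr, hE₂.idx_eq, g35, g2]
        split_ifs with h
        · rw [h, ← hlen, getVert_length_walkOf]
        · rw [getVert_walkOf_succ_of_le _ (by omega)]
          exact hI.vert i (by omega)
      · intro r hr
        funext i
        simp [State.arrs_setArr, hE₂.idx_eq, hr, g2, hI.rows r hr]

/-- The memory holds the path from `u` to `v`. -/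
def HoldsPair (P : Params) {w : Sym2 (Fin P.n) → ℕ} (A : Routing w P.h P.β P.K)
    (u v : Fin P.n) (s : State) : Prop :=
  s.arrs 1 u v = (A.path u v).length ∧
    ∀ i ≤ (A.path u v).length, s.arrs 2 (u * P.n + v) i = (A.path u v).getVert i

theorem reach_walkProg (hE : P.MoveEnv A u v s) (huv : u ≠ v) :
    Reach P.Y walkProg s fun s' => P.HoldsPair A u v s' ∧
      (∀ r ≠ (u * P.n + v : ℕ), s'.arrs 2 r = s.arrs 2 r) ∧
      ∀ u' v', ¬ (u' = (u : ℕ) ∧ v' = (v : ℕ)) → s'.arrs 1 u' v' = s.arrs 1 u' v' := by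
  have hsK := A.scale_le u v
  have hY : 2 * A.scale u v * P.n ≤ P.Y :=
    le_trans (Nat.mul_le_mul_right _ (Nat.mul_le_mul_left _ hsK)) P.size_path
  have hul : (u : ℕ) < 2 ^ P.Y := P.lt_of_le (P.n_le u.2.le)
  refine reach_seq (reach_assign (by simpa [hE.u_eq] using hul) (reach_seq (reach_assign (by simp)
    (reach_seq (reach_put (by simpa [hE.u_eq] using hul) ?_)))))
  simp only [Expr.val_var, Expr.val_zero, State.vars_setVar, hE.u_eq, hE.idx_eq]
  norm_num [hE.u_eq, hE.idx_eq]
  set s₁ := ((s.setVar 34 u).setVar 35 0).setArr 2 (u * P.n + v) 0 u with hs₁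
  have hF₁ : Frame walkProg s s₁ := by
    refine ⟨fun x hx => ?_, fun a ha => ?_⟩
    · rw [hs₁, State.vars_setArr]
      exact ((Frame.setVar walkProg s u (by decide)).trans
        (Frame.setVar walkProg _ 0 (by decide))).vars x hx
    · rw [hs₁, State.arrs_setArr_of_ne]
      · rfl
      · rintro rfl; exact ha (by decide)
  have hE₁ := hE.frame hF₁ (by decide) (by decide) (by decide)
  refine reach_seq ((reach_for (Q := fun s' => P.MoveInv A u v s (2 * A.scale u v * P.n) s')
    (2 * A.scale u v * P.n) (fun q s' => P.MoveInv A u v s q s') hY (by decide)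
    ?_ ?_ ?_ ?_).mono fun s₂ _ hF₂ hM => ?_)
  · intro s' hF
    have hE' := hE₁.frame hF (by decide) (by decide) (by decide)
    simp [hE'.scale_eq, hE'.rep.env.n_eq]
  · refine ⟨?_, ?_, ?_, ?_⟩
    · simp [hs₁, Routing.node]
    · simp [hs₁, walkOf]
    · intro i hi
      have : i = 0 := by simpa [walkOf] using hi
      subst this
      simp [hs₁, State.arrs_setArr, walkOf, Routing.node]
    · intro r hr
      funext i
      simp [hs₁, State.arrs_setArr, hr]
  · intro q hq s' hF _ hq' hI
    have hE' := hE₁.frame hF (by decide) (by decide) (by decide)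
    refine (reach_moveProg hE' hq hq' hI).mono fun s'' _ _ h => ⟨?_, ?_, h.vert, h.rows⟩
    · simpa using h.cur
    · simpa using h.len
  · exact fun s' _ h => h
  · have hE₂ := hE₁.frame hF₂ (by decide) (by decide) (by decide)
    have hlen : (A.path u v).length = (walkOf (A.node u v) (2 * A.scale u v * P.n)).length := by
      rw [Routing.path, dif_neg huv, SimpleGraph.Walk.length_copy, Fintype.card_fin]
    have hvert : ∀ i, (A.path u v).getVert i =
        (walkOf (A.node u v) (2 * A.scale u v * P.n)).getVert i := by
      intro i
      rw [Routing.path, dif_neg huv, SimpleGraph.Walk.getVert_copy, Fintype.card_fin]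
    have hle := length_walkOf_le (A.node u v) (2 * A.scale u v * P.n)
    have e1 : s₂.arrs 1 = s.arrs 1 := by
      rw [hF₂.arrs 1 (by decide), hs₁, State.arrs_setArr_of_ne (by norm_num)]
      rfl
    refine reach_put ?_ ⟨⟨?_, ?_⟩, ?_, ?_⟩
    · rw [Expr.val_var, hM.len]
      exact P.lt_of_le (hle.trans hY)
    · simp [State.arrs_setArr, hE₂.u_eq, hE₂.v_eq, hM.len, hlen]
    · intro i hi
      rw [State.arrs_setArr_of_ne (by norm_num), hvert]
      exact hM.vert i (hlen ▸ hi)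
    · intro r hr
      rw [State.arrs_setArr_of_ne (by norm_num)]
      exact hM.rows r hr
    · intro u' v' hne
      rw [State.arrs_setArr_self, Expr.val_var, Expr.val_var, hE₂.u_eq, hE₂.v_eq,
        if_neg (by tauto), e1]

theorem reach_pairProg (hR : P.Represents A s) (h24 : s.vars 24 = u * P.n + v) :
    Reach P.Y pairProg s fun s' => P.HoldsPair A u v s' ∧
      (∀ r ≠ (u * P.n + v : ℕ), s'.arrs 2 r = s.arrs 2 r) ∧
      ∀ u' v', ¬ (u' = (u : ℕ) ∧ v' = (v : ℕ)) → s'.arrs 1 u' v' = s.arrs 1 u' v' := by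
  have hul : (u : ℕ) < 2 ^ P.Y := P.lt_of_le (P.n_le u.2.le)
  have hvl : (v : ℕ) < 2 ^ P.Y := P.lt_of_le (P.n_le v.2.le)
  have e1 : (u * P.n + v : ℕ) / P.n = u := row_div v.2
  have e2 : (u * P.n + v : ℕ) - u * P.n = v := by omega
  refine reach_seq (reach_assign (by simpa [h24, hR.env.n_eq, e1] using hul) (reach_seq
    (reach_assign (by simpa [h24, hR.env.n_eq, e1] using hvl) ?_)))
  simp only [Expr.val_var, Expr.val_div, Expr.val_sub, Expr.val_mul, State.vars_setVar, h24,
    hR.env.n_eq, e1]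
  norm_num [h24, hR.env.n_eq, e2]
  set s₁ := (s.setVar 25 u).setVar 26 v with hs₁
  have hF₁ : Frame pairProg s s₁ :=
    (Frame.setVar _ _ _ (by decide)).trans (Frame.setVar _ _ _ (by decide))
  have hR₁ := hR.frame hF₁ (by decide) (by decide)
  have g24 : s₁.vars 24 = u * P.n + v := (hF₁.vars 24 (by decide)).trans h24
  have g25 : s₁.vars 25 = u := by simp [hs₁]
  have g26 : s₁.vars 26 = v := by simp [hs₁]
  refine reach_cond (fun heq => ?_) fun hne => ?_
  · rw [Expr.val_eq_ne_zero, Expr.val_var, Expr.val_var, g25, g26] at heq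
    obtain rfl : u = v := Fin.ext heq
    refine reach_seq (reach_put (by simp) (reach_put (by simpa [g25] using hul) ⟨⟨?_, ?_⟩, ?_, ?_⟩))
    · simp [State.arrs_setArr, g25, g26, Routing.path]
    · intro i hi
      have : i = 0 := by simpa [Routing.path] using hi
      subst this
      simp [State.arrs_setArr, g24, g25, Routing.path]
    · intro r hr
      funext i
      rw [State.arrs_setArr_self, Expr.val_var, State.vars_setArr, g24,
        if_neg fun h => hr h.1, State.arrs_setArr_of_ne (by norm_num)]
      rfl
    · intro u' v' hne
      rw [State.arrs_setArr_of_ne (by norm_num), State.arrs_setArr_self, Expr.val_var,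
        Expr.val_var, g25, g26, if_neg (by tauto)]
      rfl
  · rw [Expr.val_eq_eq_zero, Expr.val_var, Expr.val_var, g25, g26] at hne
    have huv : u ≠ v := fun h => hne (by rw [h])
    refine reach_seq ((reach_scaleProg hR₁ g25 g26).mono fun s₂ _ hF₂ h29 => ?_)
    have hE₂ : P.MoveEnv A u v s₂ := ⟨hR₁.frame hF₂ (by decide) (by decide),
      (hF₂.vars 24 (by decide)).trans g24, (hF₂.vars 25 (by decide)).trans g25,
      (hF₂.vars 26 (by decide)).trans g26, h29⟩
    have a1 : s₂.arrs 1 = s.arrs 1 := hF₂.arrs 1 (by decide)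
    have a2 : s₂.arrs 2 = s.arrs 2 := hF₂.arrs 2 (by decide)
    rw [← a1, ← a2]
    simpa using reach_walkProg hE₂ huv

theorem reach_outputProg (hR : P.Represents A s) :
    Reach P.Y outputProg s fun s' => ∀ u v, P.HoldsPair A u v s' := by
  refine reach_for (P.n * P.n) (fun i s' => ∀ u v : Fin P.n, (u * P.n + v : ℕ) < i →
    P.HoldsPair A u v s') (P.table_le le_rfl) (by decide) ?_ ?_ ?_ ?_
  · intro s' hF
    have hR' := hR.frame hF (by decide) (by decide)
    simp [hR'.env.n_eq]
  · intro u v h; omega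
  · intro i hi s' hF _ hi' hI
    have hR' := hR.frame hF (by decide) (by decide)
    obtain ⟨u, v, rfl⟩ : ∃ u v : Fin P.n, i = u * P.n + v :=
      ⟨⟨i / P.n, Nat.div_lt_of_lt_mul hi⟩, ⟨i % P.n, Nat.mod_lt _ P.n_pos⟩,
        (Nat.div_add_mod' _ _).symm⟩
    refine (reach_pairProg hR' hi').mono ?_
    rintro s'' - - ⟨h1, h2, h3⟩ u' v' hlt
    by_cases hc : u' = u ∧ v' = v
    · rw [hc.1, hc.2]; exact h1
    · have hne : ¬ ((u' : ℕ) = u ∧ (v' : ℕ) = v) := fun h => hc ⟨Fin.ext h.1, Fin.ext h.2⟩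
      have hrow : (u' * P.n + v' : ℕ) ≠ u * P.n + v := by
        intro h
        -- Division by `n` recovers the first vertex, so different pairs own different rows of array
        -- `2`.
        have hd : (u' : ℕ) = u := by
          have := congrArg (· / P.n) h
          simpa only [row_div u'.2, row_div v'.2, row_div v.2] using this
        rw [hd] at h
        exact hne ⟨hd, by omega⟩
      have h4 := hI u' v' (by omega)
      refine ⟨?_, ?_⟩
      · rw [State.arrs_setVar, h3 _ _ hne]; exact h4.1
      · rw [State.arrs_setVar, h2 _ hrow]; exact h4.2
  · exact fun s' _ hI u v => hI u v (row_lt u.2 v.2)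

end Output

end Params

end HopND

namespace HopND

/-! ## The algorithm -/

/-- The algorithm. It does not use random bits. -/
def algorithm (a : ℕ) : Cmd := sizeProg a ;; powProg ;; distProg ;; homeProg ;; outputProg

/-- A bound on the sizes of the numbers that occur and on the numbers of iterations of the loops,
for inputs of length `S`. -/
def sizePoly (a S : ℕ) : ℕ :=
  -- The summands account for the number of entries of the distance table, for the number of steps
  -- of a path, and for the bit lengths of the numbers.
  (a * S + 1 + 1) * S * (S * S) + 2 * (a * S + 1) * S + (S + (a * S + 1) + 4)

theorem isPoly_sizePoly (a : ℕ) : IsPoly (sizePoly a) := by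
  have h1 : IsPoly fun S => a * S + 1 := ((IsPoly.const a).mul .id).add (.const 1)
  exact ((((h1.add (.const 1)).mul .id).mul (IsPoly.id.mul .id)).add
    (((IsPoly.const 2).mul h1).mul .id)).add ((IsPoly.id.add h1).add (.const 4))

namespace Instance

variable (I : Instance)

theorem init_arrs_zero {u v : Fin I.n} (h : u ≠ v) : I.init.arrs 0 u v = I.w s(u, v) := by
  have h' : (u : ℕ) ≠ v := fun h' => h (Fin.ext h')
  simp [Instance.init, h']

theorem one_le_w {u v : Fin I.n} (h : u ≠ v) : 1 ≤ I.w s(u, v) :=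
  I.w_pos _ (by simpa using h)

theorem init_arrs_le {a : ℕ} (hw : ∀ e, ¬ e.IsDiag → I.w e ≤ I.n ^ a) (i u v : ℕ) :
    I.init.arrs i u v ≤ I.n ^ a := by
  by_cases hx : i = 0 ∧ u < I.n ∧ v < I.n ∧ u ≠ v
  · simp only [Instance.init, dif_pos hx]
    refine hw _ ?_
    simpa using hx.2.2.2
  · simp [Instance.init, dif_neg hx]

/-- Weights are positive, so for `n ≥ 2` each row of the weight matrix has at least one bit. Hence
time polynomial in `n` is polynomial in the input length. -/
theorem n_le_size : I.n ≤ I.size := by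
  unfold Instance.size
  rcases Nat.lt_or_eq_of_le I.n_pos with hn | hn
  · have h1 : ∀ u : Fin I.n, 1 ≤ ∑ v : Fin I.n, Nat.size (I.init.arrs 0 u v) := by
      intro u
      obtain ⟨v, hv⟩ : ∃ v : Fin I.n, u ≠ v := by
        have : Nontrivial (Fin I.n) := Fin.nontrivial_iff_two_le.2 hn
        obtain ⟨v, hv⟩ := exists_ne u
        exact ⟨v, hv.symm⟩
      have h2 : 1 ≤ Nat.size (I.init.arrs 0 u v) := by
        rw [I.init_arrs_zero hv]
        exact Nat.size_pos.2 (I.one_le_w hv)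
      exact h2.trans (Finset.single_le_sum (f := fun v : Fin I.n => Nat.size (I.init.arrs 0 u v))
        (fun _ _ => Nat.zero_le _) (Finset.mem_univ v))
    have h3 := Finset.sum_le_sum fun (u : Fin I.n) (_ : u ∈ Finset.univ) => h1 u
    simp only [Finset.sum_const, Finset.card_univ, Fintype.card_fin, smul_eq_mul, mul_one] at h3
    omega
  · have : 1 ≤ Nat.size I.n := Nat.size_pos.2 I.n_pos
    omega

/-- The parameters of the execution of the algorithm. -/
def params {a : ℕ} (hw : ∀ e, ¬ e.IsDiag → I.w e ≤ I.n ^ a) : Params where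
  n := I.n
  h := I.h
  β := Nat.size I.n
  K := a * Nat.size I.n + 1
  Y := sizePoly a I.size
  w := I.init.arrs 0
  n_pos := I.n_pos
  h_pos := I.h_pos
  K_pos := Nat.succ_pos _
  lt_pow := Nat.lt_size_self _
  w_le x y := by
    refine (I.init_arrs_le hw 0 x y).trans ?_
    calc I.n ^ a ≤ (2 ^ Nat.size I.n) ^ a := Nat.pow_le_pow_left (Nat.lt_size_self _).le _
      _ = 2 ^ (a * Nat.size I.n) := by rw [← pow_mul, mul_comm]
      _ ≤ _ := Nat.pow_le_pow_right (by norm_num) (Nat.le_succ _)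
  size_table := by
    have h1 := I.n_le_size
    have h2 : Nat.size I.n ≤ I.size := by unfold Instance.size; omega
    unfold sizePoly
    refine le_trans (le_trans ?_ (Nat.le_add_right _ _)) (Nat.le_add_right _ _)
    gcongr
  size_path := by
    have h1 := I.n_le_size
    have h2 : Nat.size I.n ≤ I.size := by unfold Instance.size; omega
    unfold sizePoly
    refine le_trans (le_trans ?_ (Nat.le_add_left _ _)) (Nat.le_add_right _ _)
    gcongr
  size_cls := by
    have h2 : Nat.size I.n ≤ I.size := by unfold Instance.size; omega
    unfold sizePoly
    omega
  size_scale := by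
    have h2 : Nat.size I.n + Nat.size I.h ≤ I.size := by unfold Instance.size; omega
    have h3 : a * Nat.size I.n ≤ a * I.size := Nat.mul_le_mul_left _ (by omega)
    have hh : I.h + 1 ≤ 2 ^ Nat.size I.h := Nat.lt_size_self _
    calc 8 * I.h * 2 ^ (a * Nat.size I.n + 1) + 2 ^ (a * Nat.size I.n + 1 + 1)
        = (8 * I.h + 2) * 2 ^ (a * Nat.size I.n + 1) := by ring
      _ < (8 * 2 ^ Nat.size I.h) * 2 ^ (a * Nat.size I.n + 1) :=
          Nat.mul_lt_mul_of_pos_right (by omega) (by positivity)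
      _ = 2 ^ (3 + Nat.size I.h + (a * Nat.size I.n + 1)) := by
          rw [pow_add 2 (3 + _), pow_add 2 3]; norm_num
      _ ≤ _ := Nat.pow_le_pow_right (by norm_num) (by unfold sizePoly; omega)

theorem init_bdd {a : ℕ} (hw : ∀ e, ¬ e.IsDiag → I.w e ≤ I.n ^ a) :
    I.init.Bdd (sizePoly a I.size) := by
  have hK : 2 ^ (a * Nat.size I.n + 1 + 1) < 2 ^ sizePoly a I.size :=
    lt_of_le_of_lt (Nat.le_add_left _ _) (I.params hw).size_scale
  constructor
  · intro x
    have h2 : Nat.size I.n + Nat.size I.h ≤ I.size := by unfold Instance.size; omega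
    have h3 : I.size ≤ sizePoly a I.size := by unfold sizePoly; omega
    have hn : I.n < 2 ^ sizePoly a I.size := (Nat.lt_size_self _).trans_le
      (Nat.pow_le_pow_right (by norm_num) (by omega))
    have hh : I.h < 2 ^ sizePoly a I.size := (Nat.lt_size_self _).trans_le
      (Nat.pow_le_pow_right (by norm_num) (by omega))
    simp only [Instance.init]
    split_ifs
    exacts [hn, hh, by positivity]
  · intro i u v
    refine lt_of_le_of_lt (I.init_arrs_le hw i u v) (lt_of_le_of_lt ?_ hK)
    calc I.n ^ a ≤ (2 ^ Nat.size I.n) ^ a := Nat.pow_le_pow_left (Nat.lt_size_self _).le _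
      _ = 2 ^ (a * Nat.size I.n) := by rw [← pow_mul, mul_comm]
      _ ≤ _ := Nat.pow_le_pow_right (by norm_num) (by omega)

theorem reach_algorithm {a : ℕ} (hw : ∀ e, ¬ e.IsDiag → I.w e ≤ I.n ^ a) :
    Reach (sizePoly a I.size) (algorithm a) I.init fun s =>
      ∃ A : Routing I.w I.h (Nat.size I.n) (a * Nat.size I.n + 1), s.Holds A.path := by
  set P := I.params hw with hP
  have hn : I.n ≤ sizePoly a I.size := P.n_le le_rfl
  have hK : a * Nat.size I.n + 1 + 1 ≤ sizePoly a I.size := P.K_le le_rfl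
  have h2n : 2 * I.n + 1 < 2 ^ sizePoly a I.size := by
    have h1 : I.n + 1 ≤ 2 ^ Nat.size I.n := Nat.lt_size_self _
    have h2 : Nat.size I.n + 1 ≤ sizePoly a I.size := by
      have : Nat.size I.n ≤ I.size := by unfold Instance.size; omega
      unfold sizePoly; omega
    have h3 : 2 ^ (Nat.size I.n + 1) ≤ 2 ^ sizePoly a I.size :=
      Nat.pow_le_pow_right (by norm_num) h2
    rw [pow_succ] at h3
    omega
  refine reach_seq ((reach_sizeProg (n := I.n) rfl rfl hn h2n
    (P.lt_of_le ((Nat.le_succ _).trans hK))).mono ?_)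
  rintro s₁ - F₁ ⟨hβ₁, hK₁⟩
  refine reach_seq ((reach_powProg hK₁ hK
    (lt_of_le_of_lt (Nat.le_add_left _ _) P.size_scale)).mono ?_)
  intro s₂ _ F₂ hpow
  have hE₂ : P.Env s₂ := by
    refine ⟨?_, ?_, ?_, ?_, ?_, hpow⟩
    · rw [F₂.vars 0 (by decide), F₁.vars 0 (by simp [sizeProg, Cmd.for, Cmd.modVars])]; rfl
    · rw [F₂.vars 1 (by decide), F₁.vars 1 (by simp [sizeProg, Cmd.for, Cmd.modVars])]; rfl
    · exact (F₂.vars 2 (by decide)).trans hβ₁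
    · exact (F₂.vars 3 (by decide)).trans hK₁
    · rw [F₂.arrs 0 (by decide), F₁.arrs 0 (by simp [sizeProg, Cmd.for, Cmd.modArrs])]; rfl
  -- The carving assumes zeros in the arrays `7`, `8` and `9`; none of the earlier programs writes
  -- there.
  have hinit : ∀ i, 4 ≤ i → ∀ u v, s₂.arrs i u v = 0 := by
    intro i hi u v
    rw [F₂.arrs i (by simp [powProg, Cmd.for, Cmd.modArrs]; omega),
      F₁.arrs i (by simp [sizeProg, Cmd.for, Cmd.modArrs])]
    simp [Instance.init, show i ≠ 0 by omega]
  refine reach_seq ((Params.reach_distProg hE₂).mono fun s₃ _ F₃ hT => ?_)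
  have hE₃ := hE₂.frame F₃ (by decide)
  have hw₃ : ∀ x y : Fin P.n, x ≠ y → I.w s(x, y) = P.w x y := fun x y hxy =>
    (I.init_arrs_zero hxy).symm
  have hinit₃ : ∀ i, 6 ≤ i → ∀ u v, s₃.arrs i u v = 0 := by
    intro i hi u v
    rw [F₃.arrs i (by
      simp [distProg, entryProg, argminProg, Cmd.for, Cmd.modArrs]; omega)]
    exact hinit i (by omega) u v
  refine reach_seq ((Params.reach_homeProg hE₃ (fun j hj => hT.isMetric hw₃ hj)
    (hinit₃ 7 (by norm_num) 0) (hinit₃ 8 (by norm_num)) (hinit₃ 9 (by norm_num))).mono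
    fun s₄ _ F₄ hH => ?_)
  have hT₄ : P.Tables s₄ := by
    unfold Params.Tables
    rw [F₄.arrs 4 (by decide), F₄.arrs 5 (by decide)]
    exact hT
  obtain ⟨A, hA⟩ := Params.exists_routing (hE₃.frame F₄ (by decide)) hT₄ hH hw₃
  exact (Params.reach_outputProg hA).mono fun s₅ _ _ h => ⟨A, h⟩

end Instance

/-! ## The guarantees -/

theorem optCost_nonempty {V : Type*} {k h : ℕ} (hh : 1 ≤ h) (s t : Fin k → V) :
    Nonempty {P : (i : Fin k) → GPath (s i) (t i) // ∀ i, (P i).length ≤ h} := by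
  have hex : ∀ u v : V, ∃ q : GPath u v, q.length ≤ h := by
    intro u v
    by_cases huv : u = v
    · subst huv; exact ⟨.nil, by simp⟩
    · exact ⟨.cons (by simpa using huv) .nil, by simpa using hh⟩
  choose q hq using hex
  exact ⟨⟨fun i => q (s i) (t i), fun i => hq _ _⟩⟩

/-- The bit length is at most `1 + log n / log 2`, hence at most `2 * log n / log 2` for `n ≥ 2`,
and `2 / log 2 < 3`. -/
theorem size_le_log {n : ℕ} (hn : 2 ≤ n) : (Nat.size n : ℝ) ≤ 3 * Real.log n := by
  have h1 : 1 ≤ Nat.size n := Nat.size_pos.2 (by omega)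
  have h2 : 2 ^ (Nat.size n - 1) ≤ n := Nat.lt_size.1 (by omega)
  have h3 : ((Nat.size n - 1 : ℕ) : ℝ) * Real.log 2 ≤ Real.log n := by
    rw [← Real.log_pow]
    exact Real.log_le_log (by positivity) (by exact_mod_cast h2)
  have h4 : Real.log 2 ≤ Real.log n := Real.log_le_log (by norm_num) (by exact_mod_cast hn)
  rw [Nat.cast_sub h1, Nat.cast_one] at h3
  have h5 := Real.log_two_gt_d9
  nlinarith [(Nat.cast_nonneg (Nat.size n) : (0 : ℝ) ≤ Nat.size n)]

/-- Dividing by the ratio lets the bound against each feasible solution pass to the infimum.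
Feasible solutions exist because the graph is complete and `h ≥ 1`. -/
theorem isCompetitive_path {V : Type*} [Fintype V] [DecidableEq V] {w : Sym2 V → ℕ} {h β K : ℕ}
    (hh : 1 ≤ h) (hw : ∀ x y : V, x ≠ y → 1 ≤ w s(x, y)) (A : Routing w h β K) :
    Selection.IsCompetitive A.path w h
      ((1 + K * (2 * (β * (β * (8 * (16 * β + 2))))) : ℕ) : ℝ) := by
  intro f hf k s t
  set R : ℕ := 1 + K * (2 * (β * (β * (8 * (16 * β + 2))))) with hR
  have hpos : (0 : ℝ≥0) < (R : ℝ≥0) := by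
    have : 0 < R := by omega
    exact_mod_cast this
  have := optCost_nonempty hh s t
  have h1 : netCost w f (fun i => A.path (s i) (t i)) / R ≤ optCost w f h s t :=
    le_ciInf fun Q => by
      rw [div_le_iff₀' hpos]
      exact A.netCost_path_le s t hh hw hf Q.1 Q.2
  rw [div_le_iff₀' hpos] at h1
  exact_mod_cast h1

theorem Selection.IsCompetitive.mono {V : Type*} [Fintype V] [DecidableEq V] {P : Selection V}
    {w : Sym2 V → ℕ} {h : ℕ} {r r' : ℝ} (hP : P.IsCompetitive w h r) (hr : r ≤ r') :
    P.IsCompetitive w h r' := fun f hf k s t =>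
  (hP f hf k s t).trans (mul_le_mul_of_nonneg_right hr (NNReal.coe_nonneg _))

theorem coinProb_eq_one (m : ℕ) {E : (ℕ → Bool) → Prop} (hE : ∀ ω, E ω) : coinProb m E = 1 := by
  simp [coinProb, hE]

theorem coinProb_nonneg (m : ℕ) (E : (ℕ → Bool) → Prop) : 0 ≤ coinProb m E := by
  unfold coinProb
  positivity

/-- The constant in the guarantees. -/
def guarantee (a : ℕ) : ℕ := 23409 * (a + 1)

theorem hops_le {a n : ℕ} (hn : 2 ≤ n) :
    ((2 * (a * Nat.size n + 1) * (16 * Nat.size n + 2) : ℕ) : ℝ) ≤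
      guarantee a * Real.log n ^ 3 := by
  have hβ := size_le_log hn
  have h1 : 1 ≤ Nat.size n := Nat.size_pos.2 (by omega)
  have h2 : 2 * (a * Nat.size n + 1) * (16 * Nat.size n + 2) ≤
      36 * (a + 1) * Nat.size n ^ 3 := by
    calc _ ≤ 2 * (a * Nat.size n + Nat.size n) * (16 * Nat.size n + 2 * Nat.size n) := by
          gcongr; omega
      _ = 36 * (a + 1) * Nat.size n ^ 2 := by ring
      -- The construction needs only two logarithmic factors for the hops; the third is given away
      -- to match the statement.
      _ ≤ _ := by gcongr; norm_num
  calc ((2 * (a * Nat.size n + 1) * (16 * Nat.size n + 2) : ℕ) : ℝ)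
      ≤ ((36 * (a + 1) * Nat.size n ^ 3 : ℕ) : ℝ) := by exact_mod_cast h2
    _ = 36 * (a + 1) * (Nat.size n : ℝ) ^ 3 := by push_cast; ring
    _ ≤ 36 * (a + 1) * (3 * Real.log n) ^ 3 := by gcongr
    _ = 972 * ((a + 1) * Real.log n ^ 3) := by ring
    _ ≤ 23409 * ((a + 1) * Real.log n ^ 3) := by
        have := Real.log_nonneg (show (1 : ℝ) ≤ n by exact_mod_cast (by omega : 1 ≤ n))
        gcongr; norm_num
    _ = _ := by unfold guarantee; push_cast; ring

theorem ratio_le {a n : ℕ} (hn : 2 ≤ n) :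
    ((1 + (a * Nat.size n + 1) * (2 * (Nat.size n * (Nat.size n *
      (8 * (16 * Nat.size n + 2))))) : ℕ) : ℝ) ≤ guarantee a * Real.log n ^ 4 := by
  have hβ := size_le_log hn
  have h1 : 1 ≤ Nat.size n := Nat.size_pos.2 (by omega)
  have h2 : 1 + (a * Nat.size n + 1) * (2 * (Nat.size n * (Nat.size n *
      (8 * (16 * Nat.size n + 2))))) ≤ 289 * (a + 1) * Nat.size n ^ 4 := by
    have h3 : 1 ≤ (a + 1) * Nat.size n ^ 4 := Nat.mul_pos (Nat.succ_pos a) (by positivity)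
    calc _ ≤ (a + 1) * Nat.size n ^ 4 + (a * Nat.size n + Nat.size n) *
          (2 * (Nat.size n * (Nat.size n * (8 * (16 * Nat.size n + 2 * Nat.size n))))) := by
          gcongr; omega
      _ = _ := by ring
  calc _ ≤ ((289 * (a + 1) * Nat.size n ^ 4 : ℕ) : ℝ) := by exact_mod_cast h2
    _ = 289 * (a + 1) * (Nat.size n : ℝ) ^ 4 := by push_cast; ring
    _ ≤ 289 * (a + 1) * (3 * Real.log n) ^ 4 := by gcongr
    _ = _ := by unfold guarantee; push_cast; ring

end HopND

theorem mainTheorem9 (a c : ℕ) :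
    ∃ (C : ℝ) (prog : HopND.Cmd) (p : Polynomial ℕ), ∀ I : HopND.Instance,
      (∀ e, ¬ e.IsDiag → I.w e ≤ I.n ^ a) →
        HopND.HaltsWithin prog I (p.eval I.size) ∧
        1 - 1 / (I.n : ℝ) ^ c ≤
          HopND.coinProb (p.eval I.size) (fun ω =>
            ∃ P : HopND.Selection (Fin I.n),
              HopND.Outputs prog I ω P ∧
              P.HopsAtMost (C * Real.log I.n ^ 3 * I.h) ∧
              P.IsCompetitive I.w I.h (C * Real.log I.n ^ 4)) := by
  obtain ⟨p, hp⟩ := (HopND.algorithm a).isPoly_timeBound.comp (HopND.isPoly_sizePoly a)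
  refine ⟨HopND.guarantee a, HopND.algorithm a, p, fun I hw => ?_⟩
  obtain ⟨T, s, hexec, hT, -, A, hA⟩ := I.reach_algorithm hw (I.init_bdd hw)
  refine ⟨fun ω => ⟨T, s, hexec ω, by rw [← hp]; exact hT⟩, ?_⟩
  rcases Nat.lt_or_eq_of_le I.n_pos with hn | hn
  · have hP : HopND.Selection.HopsAtMost A.path (HopND.guarantee a * Real.log I.n ^ 3 * I.h) :=
      fun u v =>
      calc (((A.path u v).length : ℕ) : ℝ)
          ≤ ((2 * (a * Nat.size I.n + 1) * (16 * Nat.size I.n + 2) : ℕ) : ℝ) * I.h := by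
            rw [← Nat.cast_mul]
            exact_mod_cast (A.length_path u v).trans (le_of_eq (by ring))
        _ ≤ _ := mul_le_mul_of_nonneg_right (HopND.hops_le hn) (Nat.cast_nonneg _)
    have hC := (HopND.isCompetitive_path I.h_pos (fun x y h => I.one_le_w h) A).mono
      (HopND.ratio_le hn)
    -- The same execution works for every tape, so the success probability is `1`.
    rw [HopND.coinProb_eq_one _ fun ω => ⟨A.path, ⟨T, s, hexec ω, hA⟩, hP, hC⟩]
    have : (0 : ℝ) ≤ 1 / (I.n : ℝ) ^ c := by positivity
    linarith
  -- For a single vertex the logarithms vanish and the bounds in terms of `log n` do not apply, but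
  -- the required probability is `0`.
  · have h1 : (I.n : ℝ) = 1 := by exact_mod_cast hn.symm
    have h2 : (1 : ℝ) - 1 / (I.n : ℝ) ^ c = 0 := by rw [h1]; simp
    rw [h2]
    exact HopND.coinProb_nonneg _ _
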